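/- **Setting.** Let $\delta_1,\delta_2,\rho_1,\rho_2,k_1,k_2,\gamma\in\mathbb R$ and consider the two-component long-wave–short-wave resonant interaction (2-LSRI) system $$iA_t-A_{xx}+LA=0,\qquad iB_t-B_{xx}+LB=0,\qquad L_t=2(\delta_1|A|^2+\delta_2|B|^2)_x$$ for complex $A,B$ and real $L$. Put $\mathcal Q(p)=\frac{\delta_1\rho_1^2}{p-ik_1}+\frac{\delta_2\rho_2^2}{p-ik_2}+ip^2$. Let $p_0$ with $\operatorname{Re}p_0\ne0$ be a simple root of $\mathcal Q'$, that is $\mathcal Q'(p_0)=0\neq\mathcal Q''(p_0)$, and let $N\ge1$. Near $p_0$ there are analytic branches $$\mathcal T(p)=\sqrt{\frac{\mathcal Q(p)^2-\mathcal Q(p_0)^2}{\mathcal Q'(p)^2}},\qquad \mathcal W(p)=\frac{\mathcal Q(p)\pm\sqrt{\mathcal Q(p)^2-\mathcal Q(p_0)^2}}{\mathcal Q(p_0)},$$ and near $\kappa=0$ there is an analytic $p(\kappa)$ with $p(0)=p_0$ and $\mathcal Q(p(\kappa))=\mathcal Q(p_0)\cosh\kappa$. Each branch of any one of the three can be completed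 by branches of the other two to a *matching* triple, meaning that $\mathcal T=\mathcal W/\mathcal W'$ near $p_0$ and $\mathcal W(p(\kappa))=e^\kappa$ near $0$. For a family $\tau_{n,k}(x,t)$, $n,k\in\mathbb Z$, put $f=\tau_{0,0}$, $g=\tau_{1,0}$, $h=\tau_{0,1}$ and $$A=\rho_1e^{i(k_1x+(\gamma+k_1^2)t)}\frac gf,\qquad B=\rho_2e^{i(k_2x+(\gamma+k_2^2)t)}\frac hf,\qquad L=\gamma-2(\log |f|)_{xx}.\tag{1}$$ **(a) Differential operator form.** Let $\mathcal T,\mathcal W$ be any such branches and let $(\widehat a_r)_{r\ge1}$ be complex numbers such that $\sum_r\widehat a_rz^r$ converges near $z=0$. Let $\xi(p)=px-ip^2t+\sum_{r\ge1}\widehat a_r(\ln\mathcal W(p))^r$ and, with $p$ and $p^*$ treated as independent variables, let $$m_{s,j}^{(n,k)}=\frac{[\mathcal T(p)\partial_p]^s}{s!}\frac{[\mathcal T^*(p^*)\partial_{p^*}]^j}{j!}\,m\Big|_{p=p_0},\qquad m=\frac1{p+p^*}\Big(-\frac{p-ik_1}{p^*+ik_1}\Big)^n\Big(-\frac{p-ik_2}{p^*+ik_2}\Big)^ke^{\xi+\xi^*}.$$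 Then $\tau_{n,k}=\det_{1\le s,j\le N}\big(m_{2s-1,2j-1}^{(n,k)}\big)$ has $f$ real and without zeros on $\mathbb R^2$, and (1) is a smooth solution of the 2-LSRI system on $\mathbb R^2$. **(b) Schur polynomial form.** Let $p(\kappa)$ be any such function and let $(a_r)_{r\ge1}$ be arbitrary complex numbers. Let $S_j$ be given by $\sum_jS_j(\mathbf x)\epsilon^j=\exp(\sum_{r\ge1}x_r\epsilon^r)$ and let $$\widehat m_{s,j}^{(n,k)}=\sum_{\nu=0}^{\min(s,j)}\Big[\frac{|\lambda_1|^2}{(p_0+p_0^*)^2}\Big]^\nu S_{s-\nu}(\mathbf x^+(n,k)+\nu\mathbf s)\,S_{j-\nu}(\mathbf x^-(n,k)+\nu\mathbf s^*),$$ $$x_r^+=\lambda_rx-i\beta_rt+n\theta_r^{(1)}+k\theta_r^{(2)}+a_r,\qquad x_r^-=\lambda_r^*x+i\beta_r^*t-n\theta_r^{(1)*}-k\theta_r^{(2)*}+a_r^*,$$ where $p(\kappa)-p_0=\sum_{r\ge1}\lambda_r\kappa^r$, $p(\kappa)^2-p_0^2=\sum_{r\ge1}\beta_r\kappa^r$,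 $\ln\frac{p(\kappa)-ik_l}{p_0-ik_l}=\sum_{r\ge1}\theta_r^{(l)}\kappa^r$ for $l=1,2$, and $\ln\big[\frac1\kappa\frac{p_0+p_0^*}{\lambda_1}\frac{p(\kappa)-p_0}{p(\kappa)+p_0^*}\big]=\sum_{r\ge1}s_r\kappa^r$. Then $\tau_{n,k}=\det_{1\le s,j\le N}\big(\widehat m_{2s-1,2j-1}^{(n,k)}\big)$ has $f$ real and without zeros on $\mathbb R^2$, and (1) is a smooth solution of the 2-LSRI system on $\mathbb R^2$. Moreover every $\tau_{n,k}$ is a polynomial in $x,t$ of degree $N(N+1)$ in $x$, in $t$, and in total. **Rational rogue waves.** Each solution in (a) and (b) is a rational rogue wave consisting of $M=N(N+1)/2$ fundamental rogue waves, in the following sense. There are polynomials $F>0$ (real), $G$, $H$ (complex) in $x,t$, each of degree $2M$ in $x$, in $t$, and in total (a fundamental rogue wave has degree $2$), such that $A=\rho_1e^{i(k_1x+(\gamma+k_1^2)t)}G/F$, $B=\rho_2e^{i(k_2x+(\gamma+k_2^2)t)}H/F$, $L=\gamma-2(\log F)_{xx}$. As $(x,t)\to\infty$ in $\mathbb R^2$,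 $F/F_0^M$ tends to a positive constant, where $F_0=(x+2\operatorname{Im}(p_0)t)^2+(2\operatorname{Re}(p_0)t)^2+\frac1{4(\operatorname{Re}p_0)^2}$ is the tau function of the fundamental rogue wave, and $|A|\to|\rho_1|$, $|B|\to|\rho_2|$, $L\to\gamma$. **Equivalence of (a) and (b).** Let $\mathcal T,\mathcal W,p(\kappa)$ match and let $a_r=\widehat a_r-b_r$ for $r\ge1$, where $\ln\frac{p(\kappa)+p_0^*}{p_0+p_0^*}=\sum_{r\ge1}b_r\kappa^r$. Then $m_{s,j}^{(n,k)}=\big(m|_{p=p_0}\big)\,\widehat m_{s,j}^{(n,k)}$ for all $n,k\in\mathbb Z$ and $s,j\ge0$. Hence the determinant in (a) is $(m|_{p=p_0})^N$ times that in (b), the two forms give the same $L$, and they give the same $A$ and the same $B$ up to constant phase factors. -/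

import Mathlib

open Filter Topology
open scoped ComplexConjugate

noncomputable section

namespace LSRI

/-- The real parameters of the two-component long-wave--short-wave resonant interaction system
(`δ₁`, `δ₂`) and of its plane-wave background (`ρ₁`, `ρ₂`, `k₁`, `k₂`, `γ`). -/
structure Params where
  δ₁ : ℝ
  δ₂ : ℝ
  ρ₁ : ℝ
  ρ₂ : ℝ
  k₁ : ℝ
  k₂ : ℝ
  γ : ℝ

/-! ### The system -/

/-- `(A, B, L)`, as functions of `x` and `t`, is a smooth solution on the whole plane of
`i A_t - A_xx + L A = 0`, `i B_t - B_xx + L B = 0`, `L_t = 2 (δ₁ |A|² + δ₂ |B|²)_x`. -/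
structure IsSolution (P : Params) (A B : ℝ → ℝ → ℂ) (L : ℝ → ℝ → ℝ) : Prop where
  smooth_A : ContDiff ℝ ((⊤ : ℕ∞) : WithTop ℕ∞) (fun z : ℝ × ℝ => A z.1 z.2)
  smooth_B : ContDiff ℝ ((⊤ : ℕ∞) : WithTop ℕ∞) (fun z : ℝ × ℝ => B z.1 z.2)
  smooth_L : ContDiff ℝ ((⊤ : ℕ∞) : WithTop ℕ∞) (fun z : ℝ × ℝ => L z.1 z.2)
  eq_A : ∀ x t : ℝ, Complex.I * deriv (fun t' => A x t') t
    - iteratedDeriv 2 (fun x' => A x' t) x + (L x t : ℂ) * A x t = 0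
  eq_B : ∀ x t : ℝ, Complex.I * deriv (fun t' => B x t') t
    - iteratedDeriv 2 (fun x' => B x' t) x + (L x t : ℂ) * B x t = 0
  eq_L : ∀ x t : ℝ, deriv (fun t' => L x t') t
    = 2 * deriv (fun x' => P.δ₁ * ‖A x' t‖ ^ 2 + P.δ₂ * ‖B x' t‖ ^ 2) x

/-- The plane wave `ρ exp(i (k x + (γ + k²) t))`. -/
def planeWave (ρ k γ : ℝ) (x t : ℝ) : ℂ :=
  (ρ : ℂ) * Complex.exp (Complex.I * ((k : ℂ) * x + ((γ : ℂ) + (k : ℂ) ^ 2) * t))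

/-- The short wave `A` obtained from a family `τ n k x t` of tau functions. -/
def fieldA (P : Params) (τ : ℤ → ℤ → ℝ → ℝ → ℂ) (x t : ℝ) : ℂ :=
  planeWave P.ρ₁ P.k₁ P.γ x t * (τ 1 0 x t / τ 0 0 x t)

/-- The short wave `B` obtained from a family `τ n k x t` of tau functions. -/
def fieldB (P : Params) (τ : ℤ → ℤ → ℝ → ℝ → ℂ) (x t : ℝ) : ℂ :=
  planeWave P.ρ₂ P.k₂ P.γ x t * (τ 0 1 x t / τ 0 0 x t)

/-- The long wave `L = γ - 2 (log f)_xx`, with `f = τ₀₀`. It is only used together with the fact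
that `f` is real and has no zeros; where `f < 0`, `Real.log f = log |f|` has the same derivatives
as any branch of `log f`. -/
def fieldL (P : Params) (τ : ℤ → ℤ → ℝ → ℝ → ℂ) (x t : ℝ) : ℝ :=
  P.γ - 2 * iteratedDeriv 2 (fun x' => Real.log (τ 0 0 x' t).re) x

/-- The tau functions `τ` yield a solution of the system: `f = τ₀₀` is real and nowhere zero, and
the fields built from `f = τ₀₀`, `g = τ₁₀`, `h = τ₀₁` solve it. -/
structure TauSolves (P : Params) (τ : ℤ → ℤ → ℝ → ℝ → ℂ) : Prop where
  real_f : ∀ x t : ℝ, (τ 0 0 x t).im = 0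
  f_ne_zero : ∀ x t : ℝ, τ 0 0 x t ≠ 0
  solution : IsSolution P (fieldA P τ) (fieldB P τ) (fieldL P τ)

/-! ### Rational rogue waves -/

/-- The polynomial `F` in the two variables `x` (index `0`) and `t` (index `1`) has degree `d`
in `x`, degree `d` in `t`, and total degree `d`. -/
def HasDegree {R : Type*} [CommSemiring R] (F : MvPolynomial (Fin 2) R) (d : ℕ) : Prop :=
  MvPolynomial.degreeOf 0 F = d ∧ MvPolynomial.degreeOf 1 F = d ∧ F.totalDegree = d

/-- The tau function `ℓ₁² + ℓ₂² + ζ₀` of the fundamental (first-order) rogue wave centred at the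
origin, where `ℓ₁ = x + 2 (Im p₀) t`, `ℓ₂ = -2 (Re p₀) t`, `ζ₀ = 1 / (4 (Re p₀)²)`. -/
def fundamentalTau (p₀ : ℂ) (x t : ℝ) : ℝ :=
  (x + 2 * p₀.im * t) ^ 2 + (-2 * p₀.re * t) ^ 2 + 1 / (4 * p₀.re ^ 2)

/-- `(A, B, L)` is a rational rogue wave made of `M` fundamental rogue waves.
* `rational`: `A` and `B` are their plane waves times rational functions `G / F`, `H / F`, and
  `L = γ - 2 (log F)_xx`, with polynomials `F`, `G`, `H` in `x` and `t` and `F > 0`. The number of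
  fundamental waves is counted by the degree: all degrees are `2 M`, that is `M` times the degree
  `2` of the tau function of a fundamental rogue wave, and in the far field `F` is asymptotic to a
  constant times the `M`-th power of the latter.
* `tendsto_A`, `tendsto_B`, `tendsto_L`: the wave is localized in space and time, i.e. it tends to
  the background amplitudes as `(x, t) → ∞` in any direction of the plane. -/
structure IsRationalRogueWave (P : Params) (p₀ : ℂ) (M : ℕ)
    (A B : ℝ → ℝ → ℂ) (L : ℝ → ℝ → ℝ) : Prop where
  rational : ∃ (F : MvPolynomial (Fin 2) ℝ) (G H : MvPolynomial (Fin 2) ℂ),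
    HasDegree F (2 * M) ∧ HasDegree G (2 * M) ∧ HasDegree H (2 * M) ∧
    (∀ x t : ℝ, 0 < MvPolynomial.eval ![x, t] F) ∧
    (∀ x t : ℝ, A x t = planeWave P.ρ₁ P.k₁ P.γ x t *
      (MvPolynomial.eval ![(x : ℂ), (t : ℂ)] G / ((MvPolynomial.eval ![x, t] F : ℝ) : ℂ))) ∧
    (∀ x t : ℝ, B x t = planeWave P.ρ₂ P.k₂ P.γ x t *
      (MvPolynomial.eval ![(x : ℂ), (t : ℂ)] H / ((MvPolynomial.eval ![x, t] F : ℝ) : ℂ))) ∧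
    (∀ x t : ℝ, L x t =
      P.γ - 2 * iteratedDeriv 2 (fun x' => Real.log (MvPolynomial.eval ![x', t] F)) x) ∧
    (∃ c : ℝ, 0 < c ∧ Tendsto
      (fun z : ℝ × ℝ => MvPolynomial.eval ![z.1, z.2] F / fundamentalTau p₀ z.1 z.2 ^ M)
      (cocompact (ℝ × ℝ)) (𝓝 c))
  tendsto_A : Tendsto (fun z : ℝ × ℝ => ‖A z.1 z.2‖) (cocompact (ℝ × ℝ)) (𝓝 |P.ρ₁|)
  tendsto_B : Tendsto (fun z : ℝ × ℝ => ‖B z.1 z.2‖) (cocompact (ℝ × ℝ)) (𝓝 |P.ρ₂|)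
  tendsto_L : Tendsto (fun z : ℝ × ℝ => L z.1 z.2) (cocompact (ℝ × ℝ)) (𝓝 P.γ)

/-! ### The function `Q` and the auxiliary local functions at a root of `Q'` -/

/-- `Q(p) = δ₁ρ₁² / (p - i k₁) + δ₂ρ₂² / (p - i k₂) + i p²`. -/
def Q (P : Params) (p : ℂ) : ℂ :=
  ((P.δ₁ * P.ρ₁ ^ 2 : ℝ) : ℂ) / (p - Complex.I * P.k₁)
    + ((P.δ₂ * P.ρ₂ ^ 2 : ℝ) : ℂ) / (p - Complex.I * P.k₂) + Complex.I * p ^ 2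

/-- `p₀` is a simple root of `Q'(p) = 0` (used off the imaginary axis, where `Q` is analytic). -/
def IsSimpleRoot (P : Params) (p₀ : ℂ) : Prop :=
  deriv (Q P) p₀ = 0 ∧ deriv (deriv (Q P)) p₀ ≠ 0

/-- `T` is, near `p₀`, an analytic branch of `√((Q² - Q(p₀)²) / Q'²)`. -/
def IsBranchT (P : Params) (p₀ : ℂ) (T : ℂ → ℂ) : Prop :=
  AnalyticAt ℂ T p₀ ∧
    ∀ᶠ p in 𝓝 p₀, T p ^ 2 * deriv (Q P) p ^ 2 = Q P p ^ 2 - Q P p₀ ^ 2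

/-- `W` is, near `p₀`, an analytic branch of `(Q ± √(Q² - Q(p₀)²)) / Q(p₀)`. -/
def IsBranchW (P : Params) (p₀ : ℂ) (W : ℂ → ℂ) : Prop :=
  AnalyticAt ℂ W p₀ ∧
    ∀ᶠ p in 𝓝 p₀, ∃ w : ℂ, w ^ 2 = Q P p ^ 2 - Q P p₀ ^ 2 ∧ W p = (Q P p + w) / Q P p₀

/-- `pκ` is, near `κ = 0`, an analytic solution `p(κ)` of `Q(p(κ)) = Q(p₀) cosh κ`,
`p(0) = p₀`. -/
def IsBranchP (P : Params) (p₀ : ℂ) (pκ : ℂ → ℂ) : Prop :=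
  AnalyticAt ℂ pκ 0 ∧ pκ 0 = p₀ ∧ ∀ᶠ κ in 𝓝 (0 : ℂ), Q P (pκ κ) = Q P p₀ * Complex.cosh κ

/-- The choices of signs in `T`, `W` and `p(κ)` match: near `p₀`, `T = W / W'`, and near
`κ = 0`, `W(p(κ)) = exp κ`. -/
def Compatible (p₀ : ℂ) (T W pκ : ℂ → ℂ) : Prop :=
  (∀ᶠ p in 𝓝 p₀, T p * deriv W p = W p) ∧ ∀ᶠ κ in 𝓝 (0 : ℂ), W (pκ κ) = Complex.exp κ

/-! ### Matrix entries in differential operator form -/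

/-- The series `∑_{r ≥ 1} a_r z^r` converges for all `z` near `0`. -/
def ConvergesNearZero (a : ℕ → ℂ) : Prop :=
  ∀ᶠ z in 𝓝 (0 : ℂ), Summable fun r : ℕ => a (r + 1) * z ^ (r + 1)

/-- `ξ(p) = p x - i p² t + ∑_{r ≥ 1} a_r (ln W(p))^r`. -/
def xi (W : ℂ → ℂ) (a : ℕ → ℂ) (x t : ℝ) (p : ℂ) : ℂ :=
  p * x - Complex.I * p ^ 2 * t + ∑' r : ℕ, a (r + 1) * Complex.log (W p) ^ (r + 1)

/-- The function `m` of the independent variables `p` and `q`, where `q` stands for `p*`; in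
particular `ξ*`, as a function of `q`, is `conj (ξ (conj q))`. -/
def kernel (P : Params) (W : ℂ → ℂ) (a : ℕ → ℂ) (n k : ℤ) (x t : ℝ) (p q : ℂ) : ℂ :=
  1 / (p + q)
    * (-((p - Complex.I * P.k₁) / (q + Complex.I * P.k₁))) ^ n
    * (-((p - Complex.I * P.k₂) / (q + Complex.I * P.k₂))) ^ k
    * Complex.exp (xi W a x t p + conj (xi W a x t (conj q)))

/-- The differential operator `T(p) ∂_p`. -/
def dOp (T : ℂ → ℂ) (F : ℂ → ℂ) : ℂ → ℂ := fun p => T p * deriv F p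

/-- `m_{s,j}^{(n,k)} = ([T(p) ∂_p]^s / s!) ([T*(p*) ∂_{p*}]^j / j!) m` at `p = p₀`, `p* = p₀*`. -/
def entryDiff (P : Params) (p₀ : ℂ) (T W : ℂ → ℂ) (a : ℕ → ℂ) (n k : ℤ) (x t : ℝ)
    (s j : ℕ) : ℂ :=
  (dOp T)^[s] (fun p =>
      (dOp fun q => conj (T (conj q)))^[j] (fun q => kernel P W a n k x t p q) (conj p₀)) p₀
    / ((s.factorial : ℂ) * (j.factorial : ℂ))

/-- `τ_{n,k} = det (m_{2s-1,2j-1}^{(n,k)})_{1 ≤ s,j ≤ N}` in differential operator form. -/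
def tauDiff (P : Params) (p₀ : ℂ) (T W : ℂ → ℂ) (a : ℕ → ℂ) (N : ℕ) (n k : ℤ) (x t : ℝ) : ℂ :=
  Matrix.det (Matrix.of fun s j : Fin N =>
    entryDiff P p₀ T W a n k x t (2 * (s : ℕ) + 1) (2 * (j : ℕ) + 1))

/-! ### Matrix entries through Schur polynomials -/

/-- The Schur polynomials: `∑_j S_j(x) ε^j = exp (∑_{r ≥ 1} x_r ε^r)` (`x 0` plays no role). -/
def schur (j : ℕ) (x : ℕ → ℂ) : ℂ :=
  PowerSeries.coeff j
    ((PowerSeries.exp ℂ).subst (PowerSeries.mk fun r => if r = 0 then 0 else x r))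

/-- The `r`-th Taylor coefficient of `F` at `0`. -/
def taylorCoeff (F : ℂ → ℂ) (r : ℕ) : ℂ := iteratedDeriv r F 0 / (r.factorial : ℂ)

/-- `p(κ) - p₀ = ∑_{r ≥ 1} λ_r κ^r`. -/
def lam (p₀ : ℂ) (pκ : ℂ → ℂ) (r : ℕ) : ℂ := taylorCoeff (fun κ => pκ κ - p₀) r

/-- `p(κ)² - p₀² = ∑_{r ≥ 1} β_r κ^r`. -/
def beta (p₀ : ℂ) (pκ : ℂ → ℂ) (r : ℕ) : ℂ := taylorCoeff (fun κ => pκ κ ^ 2 - p₀ ^ 2) r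

/-- `ln ((p(κ) - i k) / (p₀ - i k)) = ∑_{r ≥ 1} θ_r κ^r`. -/
def theta (p₀ : ℂ) (pκ : ℂ → ℂ) (k : ℝ) (r : ℕ) : ℂ :=
  taylorCoeff (fun κ => Complex.log ((pκ κ - Complex.I * k) / (p₀ - Complex.I * k))) r

/-- `ln [(1/κ) ((p₀ + p₀*) / λ₁) ((p(κ) - p₀) / (p(κ) + p₀*))] = ∑_{r ≥ 1} s_r κ^r`; the quotient
`(p(κ) - p₀) / κ`, continued analytically to `κ = 0`, is `dslope pκ 0 κ`. -/
def sCoeff (p₀ : ℂ) (pκ : ℂ → ℂ) (r : ℕ) : ℂ :=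
  taylorCoeff (fun κ => Complex.log
    ((p₀ + conj p₀) / lam p₀ pκ 1 * (dslope pκ 0 κ / (pκ κ + conj p₀)))) r

/-- `ln ((p(κ) + p₀*) / (p₀ + p₀*)) = ∑_{r ≥ 1} b_r κ^r`. -/
def bCoeff (p₀ : ℂ) (pκ : ℂ → ℂ) (r : ℕ) : ℂ :=
  taylorCoeff (fun κ => Complex.log ((pκ κ + conj p₀) / (p₀ + conj p₀))) r

/-- `x_r⁺(n,k) = λ_r x - i β_r t + n θ_r⁽¹⁾ + k θ_r⁽²⁾ + a_r`. -/
def xPlus (P : Params) (p₀ : ℂ) (pκ : ℂ → ℂ) (a : ℕ → ℂ) (n k : ℤ) (x t : ℝ) (r : ℕ) : ℂ :=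
  lam p₀ pκ r * x - Complex.I * beta p₀ pκ r * t
    + n * theta p₀ pκ P.k₁ r + k * theta p₀ pκ P.k₂ r + a r

/-- `x_r⁻(n,k) = λ_r* x + i β_r* t - n θ_r⁽¹⁾* - k θ_r⁽²⁾* + a_r*`. -/
def xMinus (P : Params) (p₀ : ℂ) (pκ : ℂ → ℂ) (a : ℕ → ℂ) (n k : ℤ) (x t : ℝ) (r : ℕ) : ℂ :=
  conj (lam p₀ pκ r) * x + Complex.I * conj (beta p₀ pκ r) * t
    - n * conj (theta p₀ pκ P.k₁ r) - k * conj (theta p₀ pκ P.k₂ r) + conj (a r)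

/-- The matrix entry
`∑_{ν=0}^{min(s,j)} [|λ₁|²/(p₀+p₀*)²]^ν S_{s-ν}(x⁺(n,k) + ν s) S_{j-ν}(x⁻(n,k) + ν s*)`. -/
def entrySchur (P : Params) (p₀ : ℂ) (pκ : ℂ → ℂ) (a : ℕ → ℂ) (n k : ℤ) (x t : ℝ)
    (s j : ℕ) : ℂ :=
  ∑ ν ∈ Finset.range (min s j + 1),
    (((‖lam p₀ pκ 1‖ ^ 2 : ℝ) : ℂ) / (p₀ + conj p₀) ^ 2) ^ ν
      * schur (s - ν) (fun r => xPlus P p₀ pκ a n k x t r + ν * sCoeff p₀ pκ r)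
      * schur (j - ν) (fun r => xMinus P p₀ pκ a n k x t r + ν * conj (sCoeff p₀ pκ r))

/-- `τ_{n,k} = det (m̂_{2s-1,2j-1}^{(n,k)})_{1 ≤ s,j ≤ N}` through Schur polynomials. -/
def tauSchur (P : Params) (p₀ : ℂ) (pκ : ℂ → ℂ) (a : ℕ → ℂ) (N : ℕ) (n k : ℤ) (x t : ℝ) : ℂ :=
  Matrix.det (Matrix.of fun s j : Fin N =>
    entrySchur P p₀ pκ a n k x t (2 * (s : ℕ) + 1) (2 * (j : ℕ) + 1))

end LSRI

end

/-! Both forms of the tau functions come from one Gram-type matrix. Let p(κ) satisfy Q(p(κ)) = Q(p₀)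
cosh κ, let p̄ be its conjugate series in a second variable σ, and put u = (p - p₀)/(p + p₀*), which
vanishes at κ = 0. The identity 1 - u(κ)ū(σ) = (p₀ + p₀*)(p + p̄)/((p + p₀*)(p̄ + p₀)) turns 1/(p +
p̄) into a geometric series in uū. The Schur entries are thus the coefficients of E⁺(κ)E⁻(σ)/(1 -
uū), where E⁺ and E⁻ are the exponentials of ∑ x_r⁺κ^r and ∑ x_r⁻σ^r, and τ is the determinant `bil`
of those with odd indices (`tauSchur_eq`).

For n = k = 0 one has E⁻ = Ē with E = E⁺, and the matrix M is ΦΦᴴ with Φ of full row rank, so f > 0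
(`bil_det_pos`). The series E obeys E_x = (p - p₀)E and E_t = -i(p² - p₀²)E. Multiplying by p + p̄
cancels the denominator, so a combination such as `bil (pA) B + bil A (p̄B)` has rank one
(`Uniformizer.sylvester`). Hence the brackets [B, A] = ψ_Bᵀ M⁻¹ φ_A obey closed quadratic evolution
equations (`IsFlow.br_x`, `IsFlow.br_t`). The bracket v = [1, 1] is (log f)_x up to a constant
(`IsFlow.det_x`), and g/f, h/f are constant phases times G_l = 1 - [Z_l, 1] with Z_l = 1/(p̄ + ik_l)
(`det_bil_shift`, `tau_shift_aux`).

The two Schrödinger equations follow from the bracket calculus for every uniformizing series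
(`IsFlow.exists_schroedinger`). Only the equation for L uses the choice of p(κ): Q(p(κ)) is even in
κ, and multiplication by an even series acts on vectors of odd coefficients by a matrix. Evaluating
the same sum of `bil` matrices once by this action and once by the rank-one identities gives v_t = ∑
δ_lρ_l²(1 - |G_l|²) (`IsFlow.br_one_one_t`), whose x-derivative is the third equation.

In the far field each Schur polynomial is governed by its first argument, a multiple of ℓ = x -
2ip₀t. The leading term of the determinant is a nonzero constant, the same for all n and k, times
|ℓ|^{N(N+1)} (`exists_tendsto_tauSchur`). This gives the limits of |A|, |B|, L, and the degrees
through growth along rays (`hasDegree_of_tendsto`).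

For the branches, Q(p₀) ≠ 0 (`Q_ne_zero`), and W is characterized by W + 1/W = 2Q/Q(p₀). So ln W is
a local coordinate at p₀ with inverse p(κ), and T = W/W' makes T∂_p equal to d/dκ. The kernel m
splits into a function of p, a function of p*, and 1/(1 - uū) (`kernel_eq`), whence the entries of
the two forms are proportional (`entryDiff_eq`). Form (a) then inherits everything from (b), the
factor changing A and B by constant phases and log |f| by an affine function. -/

namespace LSRI
open PowerSeries

/-! ### Exponentials of formal power series -/

/-- The series `∑_{r ≥ 1} y_r X^r`. -/
noncomputable def serOf (y : ℕ → ℂ) : ℂ⟦X⟧ := PowerSeries.mk fun r => if r = 0 then 0 else y r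

/-- The series `exp (∑_{r ≥ 1} y_r X^r)`. -/
noncomputable def expSer (y : ℕ → ℂ) : ℂ⟦X⟧ := (PowerSeries.exp ℂ).subst (serOf y)

theorem schur_eq_coeff (j : ℕ) (y : ℕ → ℂ) : schur j y = coeff j (expSer y) := rfl

theorem coeff_serOf_succ (y : ℕ → ℂ) (j : ℕ) : coeff (j + 1) (serOf y) = y (j + 1) := by
  simp [serOf]

theorem constantCoeff_serOf (y : ℕ → ℂ) : constantCoeff (serOf y) = 0 := by
  simp [serOf, ← coeff_zero_eq_constantCoeff_apply]

theorem hasSubst_serOf (y : ℕ → ℂ) : HasSubst (serOf y) :=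
  HasSubst.of_constantCoeff_zero' (constantCoeff_serOf y)

theorem serOf_add (y z : ℕ → ℂ) : serOf (fun r => y r + z r) = serOf y + serOf z := by
  ext j; cases j <;> simp [serOf]

theorem serOf_smul (c : ℂ) (y : ℕ → ℂ) : serOf (fun r => c * y r) = C c * serOf y := by
  ext j; cases j <;> simp [serOf]

theorem constantCoeff_expSer (y : ℕ → ℂ) : constantCoeff (expSer y) = 1 := by
  rw [expSer, ← coeff_zero_eq_constantCoeff_apply, coeff_subst' (hasSubst_serOf y),
    finsum_eq_single _ 0]
  · simp
  · intro d hd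
    simp [map_pow, constantCoeff_serOf, hd]

theorem derivative_expSer (y : ℕ → ℂ) :
    d⁄dX ℂ (expSer y) = d⁄dX ℂ (serOf y) * expSer y := by
  rw [expSer, derivative_subst (hasSubst_serOf y), derivative_exp, mul_comm]

/-- Comparing coefficients in F' = BF expresses (n + 1) times coefficient n + 1 through earlier
ones, so the constant term determines F in characteristic zero. -/
theorem eq_of_derivative_eq_mul {B F G : ℂ⟦X⟧} (hF : d⁄dX ℂ F = B * F) (hG : d⁄dX ℂ G = B * G)
    (h0 : constantCoeff F = constantCoeff G) : F = G := by
  ext n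
  induction n using Nat.strong_induction_on with
  | _ n ih =>
    cases n with
    | zero => simpa using h0
    | succ n =>
      have h1 := congrArg (coeff n) hF
      have h2 := congrArg (coeff n) hG
      rw [coeff_derivative, coeff_mul] at h1 h2
      have h3 : coeff (n + 1) F * ((n : ℂ) + 1) = coeff (n + 1) G * ((n : ℂ) + 1) := by
        rw [h1, h2]
        refine Finset.sum_congr rfl fun x hx => ?_
        rw [ih x.2 (by have := Finset.HasAntidiagonal.mem_antidiagonal.1 hx; omega)]
      exact mul_right_cancel₀ (by exact_mod_cast Nat.succ_ne_zero n) h3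

/-- The product rule for exponentials, their conjugation and their comparison with analytic
exponentials are all checked through this characterization. -/
theorem expSer_unique {y : ℕ → ℂ} {F : ℂ⟦X⟧} (hF : d⁄dX ℂ F = d⁄dX ℂ (serOf y) * F)
    (h0 : constantCoeff F = 1) : F = expSer y :=
  eq_of_derivative_eq_mul hF (derivative_expSer y) (by rw [h0, constantCoeff_expSer])

theorem expSer_add (y z : ℕ → ℂ) : expSer (fun r => y r + z r) = expSer y * expSer z := by
  symm
  apply expSer_unique
  · rw [serOf_add, Derivation.leibniz, derivative_expSer, derivative_expSer, map_add]
    simp only [smul_eq_mul]; ring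
  · simp [constantCoeff_expSer]

theorem expSer_zero : expSer (fun _ => 0) = 1 := by
  symm
  apply expSer_unique
  · have : serOf (fun _ => 0) = 0 := by ext j; simp [serOf]
    simp [this]
  · simp

theorem expSer_nat_mul (n : ℕ) (y : ℕ → ℂ) : expSer (fun r => n * y r) = expSer y ^ n := by
  induction n with
  | zero => simp [expSer_zero]
  | succ n ih =>
    rw [pow_succ, ← ih, ← expSer_add]
    congr 1; funext r; push_cast; ring

theorem expSer_neg_mul (y : ℕ → ℂ) : expSer (fun r => - y r) * expSer y = 1 := by
  rw [← expSer_add]; simpa using expSer_zero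

/-- Coefficientwise complex conjugation. -/
noncomputable def bar : ℂ⟦X⟧ →+* ℂ⟦X⟧ := PowerSeries.map (starRingEnd ℂ)

@[simp] theorem coeff_bar (j : ℕ) (F : ℂ⟦X⟧) : coeff j (bar F) = conj (coeff j F) := by
  simp [bar]

@[simp] theorem bar_bar (F : ℂ⟦X⟧) : bar (bar F) = F := by
  ext j; simp

@[simp] theorem bar_C (c : ℂ) : bar (C c) = C (conj c) := by
  simp [bar]

theorem derivative_bar (F : ℂ⟦X⟧) : d⁄dX ℂ (bar F) = bar (d⁄dX ℂ F) := by
  ext j; simp [coeff_derivative]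

theorem bar_expSer (y : ℕ → ℂ) : bar (expSer y) = expSer (fun r => conj (y r)) := by
  apply expSer_unique
  · rw [derivative_bar, derivative_expSer, map_mul, ← derivative_bar]
    congr 2
    ext j; cases j <;> simp [serOf]
  · rw [← coeff_zero_eq_constantCoeff_apply, coeff_bar, coeff_zero_eq_constantCoeff_apply,
      constantCoeff_expSer, map_one]

/-- The recursion `(j + 1) S_{j+1} = ∑ (r + 1) y_{r+1} S_{j-r}`. -/
theorem coeff_expSer_succ (y : ℕ → ℂ) (j : ℕ) :
    ((j : ℂ) + 1) * coeff (j + 1) (expSer y) =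
      ∑ r ∈ Finset.range (j + 1), ((r : ℂ) + 1) * y (r + 1) * coeff (j - r) (expSer y) := by
  have h := congrArg (coeff j) (derivative_expSer y)
  rw [coeff_derivative, coeff_mul, Finset.Nat.sum_antidiagonal_eq_sum_range_succ_mk] at h
  rw [mul_comm, h]
  refine Finset.sum_congr rfl fun r _ => ?_
  rw [coeff_derivative, coeff_serOf_succ]; ring

/-- The exponential of an affine family of series is differentiable coefficientwise. -/
theorem hasDerivAt_coeff_expSer (y z : ℕ → ℂ) (x : ℝ) (j : ℕ) :
    HasDerivAt (fun x : ℝ => coeff j (expSer fun r => y r * x + z r))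
      (coeff j (serOf y * expSer fun r => y r * x + z r)) x := by
  induction j using Nat.strong_induction_on with
  | _ j ih =>
    cases j with
    | zero =>
      simp only [coeff_zero_eq_constantCoeff_apply, constantCoeff_expSer, map_mul,
        constantCoeff_serOf, zero_mul]
      exact hasDerivAt_const x 1
    | succ j =>
      set E := fun x : ℝ => expSer fun r => y r * x + z r with hE
      have hj : ((j : ℂ) + 1) ≠ 0 := by exact_mod_cast Nat.succ_ne_zero j
      -- The recursion writes coefficient j + 1 through lower ones, so the induction hypothesis
      -- differentiates it term by term.
      have h1 : (fun x : ℝ => coeff (j + 1) (E x)) = fun x : ℝ => ((j : ℂ) + 1)⁻¹ *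
          ∑ r ∈ Finset.range (j + 1), ((r : ℂ) + 1) * (y (r + 1) * x + z (r + 1))
            * coeff (j - r) (E x) := by
        funext x
        rw [eq_inv_mul_iff_mul_eq₀ hj]
        exact coeff_expSer_succ _ j
      have h2 : HasDerivAt (fun x : ℝ => ((j : ℂ) + 1)⁻¹ *
          ∑ r ∈ Finset.range (j + 1), ((r : ℂ) + 1) * (y (r + 1) * x + z (r + 1))
            * coeff (j - r) (E x))
          (((j : ℂ) + 1)⁻¹ * ∑ r ∈ Finset.range (j + 1), (((r : ℂ) + 1) * y (r + 1)
            * coeff (j - r) (E x) + ((r : ℂ) + 1) * (y (r + 1) * x + z (r + 1)) *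
              coeff (j - r) (serOf y * E x))) x := by
        refine HasDerivAt.const_mul _ (HasDerivAt.fun_sum fun r hr => ?_)
        refine HasDerivAt.mul ?_ (ih (j - r) (by omega))
        refine HasDerivAt.const_mul _ (HasDerivAt.add_const _ ?_)
        simpa using (Complex.ofRealCLM.hasDerivAt (x := x)).const_mul (y (r + 1))
      rw [← h1] at h2
      convert h2 using 1
      -- The sum just obtained is coefficient j of (yE)' = yE' + y'E, where ' is d/dX; dividing by j
      -- + 1 gives coefficient j + 1 of yE.
      have h3 := congrArg (coeff j) (Derivation.leibniz (d⁄dX ℂ) (serOf y) (E x))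
      rw [hE, derivative_expSer, coeff_derivative, ← hE] at h3
      rw [eq_inv_mul_iff_mul_eq₀ hj, mul_comm, h3, Finset.sum_add_distrib, map_add, add_comm]
      congr 1
      · rw [smul_eq_mul, mul_comm, coeff_mul, Finset.Nat.sum_antidiagonal_eq_sum_range_succ_mk]
        refine Finset.sum_congr rfl fun r _ => ?_
        rw [coeff_derivative, coeff_serOf_succ]; ring
      · rw [smul_eq_mul, mul_left_comm, coeff_mul,
          Finset.Nat.sum_antidiagonal_eq_sum_range_succ_mk]
        refine Finset.sum_congr rfl fun r _ => ?_
        rw [coeff_derivative, coeff_serOf_succ]; ring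

end LSRI

namespace LSRI
open PowerSeries

/-! ### Taylor series at the origin -/

/-- The Taylor series of `F` at `0`, as a formal power series. -/
noncomputable def tps (F : ℂ → ℂ) : ℂ⟦X⟧ := PowerSeries.mk (taylorCoeff F)

@[simp] theorem coeff_tps (F : ℂ → ℂ) (j : ℕ) : coeff j (tps F) = taylorCoeff F j := by
  simp [tps]

theorem taylorCoeff_zero (F : ℂ → ℂ) : taylorCoeff F 0 = F 0 := by
  simp [taylorCoeff]

theorem constantCoeff_tps (F : ℂ → ℂ) : constantCoeff (tps F) = F 0 := by
  rw [← coeff_zero_eq_constantCoeff_apply, coeff_tps, taylorCoeff_zero]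

theorem tps_congr {F G : ℂ → ℂ} (h : F =ᶠ[𝓝 0] G) : tps F = tps G := by
  ext j; simp [taylorCoeff, h.iteratedDeriv_eq j]

theorem tps_add {F G : ℂ → ℂ} (hF : AnalyticAt ℂ F 0) (hG : AnalyticAt ℂ G 0) :
    tps (fun z => F z + G z) = tps F + tps G := by
  ext j
  have := iteratedDeriv_add (n := j) hF.contDiffAt hG.contDiffAt
  simp only [coeff_tps, map_add, taylorCoeff, ← add_div]
  rw [← this]; rfl

theorem tps_sub {F G : ℂ → ℂ} (hF : AnalyticAt ℂ F 0) (hG : AnalyticAt ℂ G 0) :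
    tps (fun z => F z - G z) = tps F - tps G := by
  ext j
  have := iteratedDeriv_sub (n := j) hF.contDiffAt hG.contDiffAt
  simp only [coeff_tps, map_sub, taylorCoeff, ← sub_div]
  rw [← this]; rfl

theorem tps_mul {F G : ℂ → ℂ} (hF : AnalyticAt ℂ F 0) (hG : AnalyticAt ℂ G 0) :
    tps (fun z => F z * G z) = tps F * tps G := by
  ext j
  have := iteratedDeriv_mul (n := j) hF.contDiffAt hG.contDiffAt
  rw [coeff_mul, Finset.Nat.sum_antidiagonal_eq_sum_range_succ_mk]
  simp only [coeff_tps, taylorCoeff]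
  change iteratedDeriv j (F * G) 0 / _ = _
  rw [this, Finset.sum_div]
  refine Finset.sum_congr rfl fun i hi => ?_
  have hij : i ≤ j := Nat.lt_succ_iff.1 (Finset.mem_range.1 hi)
  rw [Nat.cast_choose ℂ hij]
  have := Nat.factorial_ne_zero
  field_simp [this]

theorem tps_const (c : ℂ) : tps (fun _ => c) = C c := by
  ext j
  rw [coeff_tps, taylorCoeff, coeff_C]
  cases j <;> simp [iteratedDeriv_const]

theorem tps_id : tps (fun z => z) = X := by
  ext j
  rw [coeff_tps, taylorCoeff, coeff_X, iteratedDeriv_fun_id_zero]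
  split_ifs with h <;> simp [h]

theorem tps_const_mul (c : ℂ) {F : ℂ → ℂ} (hF : AnalyticAt ℂ F 0) :
    tps (fun z => c * F z) = C c * tps F := by
  rw [tps_mul analyticAt_const hF, tps_const]

theorem tps_pow {F : ℂ → ℂ} (hF : AnalyticAt ℂ F 0) (n : ℕ) :
    tps (fun z => F z ^ n) = tps F ^ n := by
  induction n with
  | zero => simpa using tps_const 1
  | succ n ih => simp only [pow_succ]; rw [tps_mul (hF.fun_pow n) hF, ih]

theorem derivative_tps (F : ℂ → ℂ) : d⁄dX ℂ (tps F) = tps (deriv F) := by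
  ext j
  rw [coeff_derivative, coeff_tps, coeff_tps, taylorCoeff, taylorCoeff, iteratedDeriv_succ',
    Nat.factorial_succ]
  have := Nat.factorial_ne_zero j
  have : (j : ℂ) + 1 ≠ 0 := by exact_mod_cast Nat.succ_ne_zero j
  push_cast
  field_simp

theorem serOf_taylorCoeff {F : ℂ → ℂ} (h0 : F 0 = 0) : serOf (taylorCoeff F) = tps F := by
  ext j
  cases j
  · simp [serOf, taylorCoeff_zero, h0]
  · simp [serOf]

/-- Both series have the same logarithmic derivative and constant term 1. This carries identities
between analytic functions over to `expSer`. -/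
theorem tps_exp {F : ℂ → ℂ} (hF : AnalyticAt ℂ F 0) (h0 : F 0 = 0) :
    tps (fun z => Complex.exp (F z)) = expSer (taylorCoeff F) := by
  apply expSer_unique
  · rw [serOf_taylorCoeff h0, derivative_tps, derivative_tps,
      ← tps_mul hF.deriv (show AnalyticAt ℂ (fun z => Complex.exp (F z)) 0 from hF.cexp)]
    apply tps_congr
    filter_upwards [hF.eventually_analyticAt] with z hz
    rw [(hz.differentiableAt.hasDerivAt.cexp).deriv, mul_comm]
  · simp [constantCoeff_tps, h0]

theorem iteratedDeriv_conj_conj (F : ℂ → ℂ) (j : ℕ) :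
    iteratedDeriv j (fun z => conj (F (conj z))) = fun z => conj (iteratedDeriv j F (conj z)) := by
  induction j with
  | zero => simp
  | succ j ih =>
    rw [iteratedDeriv_succ, ih, iteratedDeriv_succ]
    funext z
    exact congrFun (deriv_conj_conj (f := iteratedDeriv j F)) z

/-- This is how functions of p*, treated as an independent variable, become series in the image of
`bar`. -/
theorem tps_conj (F : ℂ → ℂ) : tps (fun z => conj (F (conj z))) = bar (tps F) := by
  ext j
  simp [taylorCoeff, iteratedDeriv_conj_conj]

theorem _root_.AnalyticAt.conj_conj' {F : ℂ → ℂ} {z : ℂ} (hF : AnalyticAt ℂ F (conj z)) :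
    AnalyticAt ℂ (fun z => conj (F (conj z))) z := by
  rw [Complex.analyticAt_iff_eventually_differentiableAt] at hF ⊢
  have h := (Complex.continuous_conj.tendsto z).eventually hF
  filter_upwards [h] with w hw
  exact differentiableAt_conj_conj_iff.2 hw

/-- Absolute summability at one positive point inside the disc of convergence forces a positive
radius. -/
theorem hasFPowerSeriesAt_of_convergesNearZero {a : ℕ → ℂ} (ha : ConvergesNearZero a) :
    HasFPowerSeriesAt (fun z => ∑' r : ℕ, a (r + 1) * z ^ (r + 1))
      (FormalMultilinearSeries.ofScalars ℂ fun r => if r = 0 then 0 else a r) 0 := by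
  obtain ⟨ε, hε, h⟩ := Metric.eventually_nhds_iff.1 ha
  set c : ℕ → ℂ := fun r => if r = 0 then 0 else a r with hc
  let r : NNReal := ⟨ε / 2, by positivity⟩
  have hr : (r : ℝ) = ε / 2 := rfl
  have hs : ∀ z : ℂ, ‖z‖ < ε → Summable fun n => c n * z ^ n := by
    intro z hz
    have := h (y := z) (by simpa using hz)
    rw [← summable_nat_add_iff 1]
    simpa [hc] using this
  have hrad : (r : ENNReal) ≤ (FormalMultilinearSeries.ofScalars ℂ c).radius := by
    have h1 := (hs ((r : ℝ) : ℂ) (by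
      rw [Complex.norm_real, Real.norm_of_nonneg r.coe_nonneg]; linarith)).norm
    apply FormalMultilinearSeries.le_radius_of_summable
    refine h1.congr fun n => ?_
    simp
  have hr0 : (0 : ENNReal) < r := by
    rw [ENNReal.coe_pos, ← NNReal.coe_pos, hr]; positivity
  have h2 := (FormalMultilinearSeries.ofScalars ℂ c).hasFPowerSeriesOnBall
    (hr0.trans_le hrad)
  refine h2.hasFPowerSeriesAt.congr ?_
  filter_upwards [Metric.ball_mem_nhds (0 : ℂ) hε] with z hz
  rw [FormalMultilinearSeries.sum]
  simp only [FormalMultilinearSeries.ofScalars_apply_eq, smul_eq_mul]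
  rw [(hs z (by simpa using hz)).tsum_eq_zero_add]
  simp [hc]

theorem analyticAt_of_convergesNearZero {a : ℕ → ℂ} (ha : ConvergesNearZero a) :
    AnalyticAt ℂ (fun z => ∑' r : ℕ, a (r + 1) * z ^ (r + 1)) 0 :=
  ⟨_, hasFPowerSeriesAt_of_convergesNearZero ha⟩

theorem tps_of_convergesNearZero {a : ℕ → ℂ} (ha : ConvergesNearZero a) :
    tps (fun z => ∑' r : ℕ, a (r + 1) * z ^ (r + 1)) = serOf a := by
  ext j
  obtain ⟨r, hr⟩ := hasFPowerSeriesAt_of_convergesNearZero ha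
  have h := hr.factorial_smul 1 j
  rw [← iteratedDeriv_eq_iteratedFDeriv, FormalMultilinearSeries.ofScalars_apply_eq] at h
  rw [coeff_tps, taylorCoeff, ← h]
  have := Nat.factorial_ne_zero j
  rw [serOf, coeff_mk]
  simp only [one_pow, smul_eq_mul, mul_one, nsmul_eq_mul]
  field_simp

end LSRI

namespace LSRI
open PowerSeries Matrix

/-! ### Differentiation of determinants and inverses of matrices -/

/-- Entrywise differentiability of a matrix-valued function of a real variable. -/
def MatDeriv {m n : Type*} (F : ℝ → Matrix m n ℂ) (F' : Matrix m n ℂ) (s : ℝ) : Prop :=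
  ∀ i j, HasDerivAt (fun s => F s i j) (F' i j) s

section MatDeriv
variable {m : Type*} [Fintype m] {F G : ℝ → Matrix m m ℂ} {F' G' : Matrix m m ℂ}
  {s : ℝ}

theorem MatDeriv.mul (hF : MatDeriv F F' s) (hG : MatDeriv G G' s) :
    MatDeriv (fun s => F s * G s) (F' * G s + F s * G') s := by
  intro i j
  simp only [Matrix.mul_apply, Matrix.add_apply, ← Finset.sum_add_distrib]
  exact HasDerivAt.fun_sum fun k _ => (hF i k).mul (hG k j)

theorem MatDeriv.bilin (hF : MatDeriv F F' s) {a b : ℝ → m → ℂ} {a' b' : m → ℂ}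
    (ha : ∀ i, HasDerivAt (fun s => a s i) (a' i) s)
    (hb : ∀ i, HasDerivAt (fun s => b s i) (b' i) s) :
    HasDerivAt (fun s => a s ⬝ᵥ F s *ᵥ b s)
      (a' ⬝ᵥ F s *ᵥ b s + a s ⬝ᵥ F' *ᵥ b s + a s ⬝ᵥ F s *ᵥ b') s := by
  simp only [dotProduct, mulVec, Finset.mul_sum, ← Finset.sum_add_distrib]
  refine HasDerivAt.fun_sum fun i _ => HasDerivAt.fun_sum fun j _ => ?_
  refine ((ha i).fun_mul ((hF i j).fun_mul (hb j))).congr_deriv ?_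
  ring

variable [DecidableEq m]

/-- Jacobi's formula. -/
theorem MatDeriv.det (hF : MatDeriv F F' s) :
    HasDerivAt (fun s => (F s).det) ((F s).adjugate * F').trace s := by
  have h1 : HasDerivAt (fun s => (F s).det)
      (∑ σ : Equiv.Perm m, ((Equiv.Perm.sign σ : ℤ) : ℂ) *
        ∑ k : m, (∏ i ∈ Finset.univ.erase k, F s (σ i) i) * F' (σ k) k) s := by
    simp only [Matrix.det_apply']
    refine HasDerivAt.fun_sum fun σ _ => HasDerivAt.const_mul _ ?_
    have := HasDerivAt.fun_finsetProd (u := Finset.univ) (f := fun i s => F s (σ i) i)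
      (f' := fun i => F' (σ i) i) (x := s) fun i _ => hF (σ i) i
    simpa [smul_eq_mul] using this
  convert h1 using 1
  simp only [Finset.mul_sum]
  rw [Finset.sum_comm, Matrix.trace]
  refine Finset.sum_congr rfl fun k _ => ?_
  -- Cramer's rule: this diagonal entry is the determinant with column k replaced by its derivative,
  -- which is the k-th term of the product rule.
  have h2 : ((F s).adjugate * F') k k = ((F s).updateCol k (fun i => F' i k)).det := by
    rw [← Matrix.cramer_apply, Matrix.cramer_eq_adjugate_mulVec]
    rfl
  rw [Matrix.diag_apply, h2, Matrix.det_apply']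
  refine Finset.sum_congr rfl fun σ _ => ?_
  congr 1
  rw [← Finset.mul_prod_erase Finset.univ _ (Finset.mem_univ k), mul_comm]
  congr 1
  · refine Finset.prod_congr rfl fun i hi => ?_
    rw [Matrix.updateCol_ne (Finset.ne_of_mem_erase hi)]
  · rw [Matrix.updateCol_self]

/-- By Cramer's rule the entries of the inverse are quotients of differentiable determinants. The
value of the derivative is then found by differentiating F F⁻¹ = 1. -/
theorem MatDeriv.exists_inv (hF : MatDeriv F F' s) (h : (F s).det ≠ 0) :
    ∃ G', MatDeriv (fun s => (F s)⁻¹) G' s := by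
  have h1 : ∀ i j, DifferentiableAt ℝ (fun s => (F s)⁻¹ i j) s := by
    intro i j
    have h2 : ∀ s, (F s)⁻¹ i j
        = ((F s).det)⁻¹ * ((F s).updateRow j (Pi.single i 1)).det := by
      intro s
      rw [Matrix.inv_def, Ring.inverse_eq_inv', Matrix.smul_apply, Matrix.adjugate_apply,
        smul_eq_mul]
    simp only [h2]
    have h3 : MatDeriv (fun s => (F s).updateRow j (Pi.single i 1)) (F'.updateRow j 0) s := by
      intro a b
      by_cases ha : a = j
      · subst ha
        simp only [Matrix.updateRow_self, Pi.zero_apply]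
        exact hasDerivAt_const _ _
      · simp only [Matrix.updateRow_ne ha]
        exact hF a b
    exact (hF.det.differentiableAt.inv h).mul h3.det.differentiableAt
  exact ⟨fun i j => deriv (fun s => (F s)⁻¹ i j) s, fun i j => (h1 i j).hasDerivAt⟩

theorem MatDeriv.inv (hF : MatDeriv F F' s) (h : (F s).det ≠ 0) :
    MatDeriv (fun s => (F s)⁻¹) (-((F s)⁻¹ * F' * (F s)⁻¹)) s := by
  obtain ⟨G', hG⟩ := hF.exists_inv h
  have h0 : ∀ᶠ r in 𝓝 s, (F r).det ≠ 0 := hF.det.continuousAt.eventually_ne h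
  have h1 : F' * (F s)⁻¹ + F s * G' = 0 := by
    ext i j
    refine (hF.mul hG i j).unique ?_
    refine (hasDerivAt_const s ((1 : Matrix m m ℂ) i j)).congr_of_eventuallyEq ?_
    filter_upwards [h0] with r hr
    rw [Matrix.mul_nonsing_inv _ (isUnit_iff_ne_zero.2 hr)]
  have h2 : G' = -((F s)⁻¹ * F' * (F s)⁻¹) := by
    have h3 := congrArg (fun A => (F s)⁻¹ * A) h1
    simp only [Matrix.mul_add, Matrix.mul_zero] at h3
    rw [Matrix.nonsing_inv_mul_cancel_left _ _ (isUnit_iff_ne_zero.2 h)] at h3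
    rw [Matrix.mul_assoc]
    exact eq_neg_of_add_eq_zero_right h3
  rw [← h2]; exact hG

end MatDeriv

/-! ### Gram matrices of power series -/

/-- The odd coefficients of a power series. -/
noncomputable def col (N : ℕ) : ℂ⟦X⟧ →ₗ[ℂ] (Fin N → ℂ) where
  toFun A := fun s => coeff (2 * (s : ℕ) + 1) A
  map_add' A B := by ext; simp
  map_smul' c A := by ext; simp

theorem col_apply (N : ℕ) (A : ℂ⟦X⟧) (s : Fin N) : col N A s = coeff (2 * (s : ℕ) + 1) A := rfl

/-- The odd coefficients of `A(κ) B(σ) / (1 - u(κ) ū(σ))`, where `u` has no constant term. -/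
noncomputable def bil (N : ℕ) (u : ℂ⟦X⟧) :
    ℂ⟦X⟧ →ₗ[ℂ] ℂ⟦X⟧ →ₗ[ℂ] Matrix (Fin N) (Fin N) ℂ :=
  LinearMap.mk₂ ℂ (fun A B => ∑ ν ∈ Finset.range (2 * N),
      vecMulVec (col N (A * u ^ ν)) (col N (B * bar u ^ ν)))
    (fun A A' B => by
      simp only [add_mul, map_add, add_vecMulVec, Finset.sum_add_distrib])
    (fun c A B => by
      simp only [smul_mul_assoc, map_smul, smul_vecMulVec, Finset.smul_sum])
    (fun A B B' => by
      simp only [add_mul, map_add, vecMulVec_add, Finset.sum_add_distrib])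
    (fun c A B => by
      simp only [smul_mul_assoc, map_smul, vecMulVec_smul, Finset.smul_sum])

theorem bil_apply (N : ℕ) (u A B : ℂ⟦X⟧) : bil N u A B = ∑ ν ∈ Finset.range (2 * N),
      vecMulVec (col N (A * u ^ ν)) (col N (B * bar u ^ ν)) := rfl

theorem coeff_mul_pow_eq_zero {u : ℂ⟦X⟧} (hu0 : constantCoeff u = 0) (A : ℂ⟦X⟧) {j k : ℕ}
    (h : j < k) : coeff j (A * u ^ k) = 0 := by
  have : X ^ k ∣ A * u ^ k :=
    Dvd.dvd.mul_left (pow_dvd_pow_of_dvd (X_dvd_iff.2 hu0) k) _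
  exact X_pow_dvd_iff.1 this j h

/-- Multiplication by 1 - uū telescopes the geometric sum. Truncation at 2N costs nothing: u^(2N)
starts in degree 2N, above the largest odd index 2N - 1. -/
theorem bil_sub_bil {N : ℕ} {u : ℂ⟦X⟧} (hu0 : constantCoeff u = 0) (A B : ℂ⟦X⟧) :
    bil N u A B - bil N u (A * u) (B * bar u) = vecMulVec (col N A) (col N B) := by
  have h : ∀ ν, vecMulVec (col N (A * u * u ^ ν)) (col N (B * bar u * bar u ^ ν))
      = vecMulVec (col N (A * u ^ (ν + 1))) (col N (B * bar u ^ (ν + 1))) := by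
    intro ν; rw [pow_succ', pow_succ', mul_assoc, mul_assoc]
  rw [bil_apply, bil_apply]
  simp only [h]
  rw [← Finset.sum_sub_distrib, Finset.sum_range_sub'
    (fun ν => vecMulVec (col N (A * u ^ ν)) (col N (B * bar u ^ ν)))]
  have h2 : col N (A * u ^ (2 * N)) = 0 := by
    ext s
    exact coeff_mul_pow_eq_zero hu0 A (by have := s.2; omega)
  simp [h2]

/-- The data of a uniformizing series `p(κ)` with `p(0) = p₀`, and `u = (p - p₀) / (p + p₀*)`. -/
structure Uniformizer (p₀ : ℂ) (p u : ℂ⟦X⟧) : Prop where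
  re_ne : p₀.re ≠ 0
  constantCoeff_p : constantCoeff p = p₀
  constantCoeff_u : constantCoeff u = 0
  u_mul : u * (p + C (conj p₀)) = p - C p₀

theorem Uniformizer.add_conj_ne {p₀ : ℂ} {p u : ℂ⟦X⟧} (h : Uniformizer p₀ p u) :
    p₀ + conj p₀ ≠ 0 := by
  rw [Complex.add_conj]
  exact_mod_cast mul_ne_zero two_ne_zero h.re_ne

/-- The reason is (p + p₀*)(p̄ + p₀) - (p - p₀)(p̄ - p₀*) = (p₀ + p₀*)(p + p̄): the factor p + p̄
cancels the denominator 1 - uū and leaves a product of a function of κ and a function of σ. -/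
theorem Uniformizer.sylvester {p₀ : ℂ} {p u : ℂ⟦X⟧} (h : Uniformizer p₀ p u) (N : ℕ)
    (A B : ℂ⟦X⟧) :
    bil N u (p * A) B + bil N u A (bar p * B) = vecMulVec (col N ((p + C (conj p₀)) * A))
      ((p₀ + conj p₀)⁻¹ • col N ((bar p + C p₀) * B)) := by
  have h1 := bil_sub_bil (N := N) h.constantCoeff_u ((p + C (conj p₀)) * A) ((bar p + C p₀) * B)
  have h2 : (p + C (conj p₀)) * A * u = (p - C p₀) * A := by rw [← h.u_mul]; ring
  have h3 : (bar p + C p₀) * B * bar u = (bar p - C (conj p₀)) * B := by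
    have := congrArg bar h.u_mul
    simp only [map_mul, map_add, map_sub, bar_C, Complex.conj_conj] at this
    rw [← this]; ring
  rw [h2, h3] at h1
  rw [vecMulVec_smul, ← h1, eq_inv_smul_iff₀ h.add_conj_ne]
  simp only [add_mul, sub_mul, ← smul_eq_C_mul, map_add, map_sub, map_smul, LinearMap.add_apply,
    LinearMap.sub_apply, LinearMap.smul_apply]
  module

theorem bil_conjTranspose (N : ℕ) (u A B : ℂ⟦X⟧) :
    (bil N u A B)ᴴ = bil N u (bar B) (bar A) := by
  rw [bil_apply, bil_apply, conjTranspose_sum]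
  refine Finset.sum_congr rfl fun ν _ => ?_
  ext i j
  simp [vecMulVec_apply, conjTranspose_apply, col_apply, ← coeff_bar, mul_comm]

end LSRI

namespace LSRI
open PowerSeries Matrix

/-! ### Brackets -/

/-- The bracket `ψ_Bᵀ M⁻¹ φ_A` with `φ_A` the odd coefficients of `(p + p₀*) A E`, `ψ_B` those of
`(p* + p₀) B E* / (p₀ + p₀*)`, and `M` the Gram matrix of `E` and `E*`. -/
noncomputable def br (N : ℕ) (p₀ : ℂ) (p u E B A : ℂ⟦X⟧) : ℂ :=
  ((p₀ + conj p₀)⁻¹ • col N ((bar p + C p₀) * (B * bar E))) ⬝ᵥ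
    (bil N u E (bar E))⁻¹ *ᵥ col N ((p + C (conj p₀)) * (A * E))

section
variable {N : ℕ} {p₀ : ℂ} {p u E : ℂ⟦X⟧}

theorem br_add_left (B B' A : ℂ⟦X⟧) :
    br N p₀ p u E (B + B') A = br N p₀ p u E B A + br N p₀ p u E B' A := by
  simp only [br, add_mul, mul_add, map_add, smul_add, add_dotProduct]

theorem br_add_right (B A A' : ℂ⟦X⟧) :
    br N p₀ p u E B (A + A') = br N p₀ p u E B A + br N p₀ p u E B A' := by
  simp only [br, add_mul, mul_add, map_add, mulVec_add, dotProduct_add]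

theorem br_C_mul_left (c : ℂ) (B A : ℂ⟦X⟧) :
    br N p₀ p u E (C c * B) A = c * br N p₀ p u E B A := by
  have : (bar p + C p₀) * (C c * B * bar E) = c • ((bar p + C p₀) * (B * bar E)) := by
    rw [smul_eq_C_mul]; ring
  rw [br, this, map_smul, smul_comm, smul_dotProduct, smul_eq_mul, br]

theorem br_C_mul_right (c : ℂ) (B A : ℂ⟦X⟧) :
    br N p₀ p u E B (C c * A) = c * br N p₀ p u E B A := by
  have : (p + C (conj p₀)) * (C c * A * E) = c • ((p + C (conj p₀)) * (A * E)) := by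
    rw [smul_eq_C_mul]; ring
  rw [br, this, map_smul, mulVec_smul, dotProduct_smul, smul_eq_mul, br]

theorem br_sub_left (B B' A : ℂ⟦X⟧) :
    br N p₀ p u E (B - B') A = br N p₀ p u E B A - br N p₀ p u E B' A := by
  have := br_add_left (N := N) (p₀ := p₀) (p := p) (u := u) (E := E) (B - B') B' A
  rw [sub_add_cancel] at this
  rw [this]; ring

/-- The Gram matrix of E and Ē is Hermitian and p₀ + p₀* is real, so conjugation exchanges the two
slots. In particular the conjugate of 1 - [Z, 1] is 1 - [1, Z̄]. -/
theorem conj_br (B A : ℂ⟦X⟧) :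
    conj (br N p₀ p u E B A) = br N p₀ p u E (bar A) (bar B) := by
  have hv : ∀ (F : ℂ⟦X⟧), star (col N F) = col N (bar F) := by
    intro F; ext s; simp [col_apply]
  have hM : (bil N u E (bar E))⁻¹ᴴ = (bil N u E (bar E))⁻¹ := by
    rw [conjTranspose_nonsing_inv, bil_conjTranspose, bar_bar]
  change star _ = _
  rw [br, ← star_dotProduct_star, star_mulVec, ← dotProduct_mulVec, hM, hv, star_smul, hv, br]
  simp only [map_mul, map_add, bar_bar, bar_C, Complex.conj_conj, mulVec_smul, dotProduct_smul,
    smul_dotProduct, star_inv₀, star_add]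
  congr 1
  simp [add_comm]

/-- Coefficientwise differentiability of a family of power series. -/
def CoeffDeriv (E : ℝ → ℂ⟦X⟧) (E' : ℂ⟦X⟧) (s : ℝ) : Prop :=
  ∀ j, HasDerivAt (fun s => coeff j (E s)) (coeff j E') s

theorem CoeffDeriv.mul_left {E : ℝ → ℂ⟦X⟧} {E' : ℂ⟦X⟧} {s : ℝ} (h : CoeffDeriv E E' s)
    (A : ℂ⟦X⟧) : CoeffDeriv (fun s => A * E s) (A * E') s := by
  intro j
  simp only [coeff_mul]
  exact HasDerivAt.fun_sum fun k _ => (h k.2).const_mul _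

theorem CoeffDeriv.bar {E : ℝ → ℂ⟦X⟧} {E' : ℂ⟦X⟧} {s : ℝ} (h : CoeffDeriv E E' s) :
    CoeffDeriv (fun s => bar (E s)) (bar E') s := by
  intro j
  simpa using! (h j).star

theorem CoeffDeriv.bil {E : ℝ → ℂ⟦X⟧} {E' : ℂ⟦X⟧} {s : ℝ} (h : CoeffDeriv E E' s) :
    MatDeriv (fun s => bil N u (E s) (LSRI.bar (E s)))
      (LSRI.bil N u E' (LSRI.bar (E s)) + LSRI.bil N u (E s) (LSRI.bar E')) s := by
  intro i j
  simp only [bil_apply, Matrix.add_apply, Matrix.sum_apply, vecMulVec_apply,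
    ← Finset.sum_add_distrib, col_apply]
  refine HasDerivAt.fun_sum fun ν _ => ?_
  have h1 := h.mul_left (u ^ ν)
  have h2 := h.bar.mul_left (LSRI.bar u ^ ν)
  simp only [mul_comm (u ^ ν), mul_comm (LSRI.bar u ^ ν)] at h1 h2
  exact (h1 _).fun_mul (h2 _)

/-- Product rule with (M⁻¹)' = -M⁻¹M'M⁻¹. The normalizing constant k contributes -k and -k̄ through
the two vectors and k + k̄ through M⁻¹, so it drops out. -/
theorem br_hasDerivAt {E : ℝ → ℂ⟦X⟧} {K : ℂ⟦X⟧} {k : ℂ} {s : ℝ}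
    (h : CoeffDeriv E ((K - C k) * E s) s) {R : Matrix (Fin N) (Fin N) ℂ}
    (hR : bil N u (K * E s) (bar (E s)) + bil N u (E s) (bar K * bar (E s)) = R)
    (h0 : (bil N u (E s) (bar (E s))).det ≠ 0) (B A : ℂ⟦X⟧) :
    HasDerivAt (fun s => br N p₀ p u (E s) B A)
      (br N p₀ p u (E s) (bar K * B) A + br N p₀ p u (E s) B (K * A)
        - ((p₀ + conj p₀)⁻¹ • col N ((bar p + C p₀) * (B * bar (E s)))) ⬝ᵥ
          ((bil N u (E s) (bar (E s)))⁻¹ * R * (bil N u (E s) (bar (E s)))⁻¹) *ᵥ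
            col N ((p + C (conj p₀)) * (A * E s))) s := by
  set M := bil N u (E s) (bar (E s)) with hMdef
  have hM := (h.bil (N := N) (u := u)).inv h0
  have hA : ∀ i, HasDerivAt (fun s => col N ((p + C (conj p₀)) * (A * E s)) i)
      (col N ((p + C (conj p₀)) * (A * ((K - C k) * E s))) i) s := fun i =>
    (h.mul_left A).mul_left _ _
  have hB : ∀ i, HasDerivAt
      (fun s => ((p₀ + conj p₀)⁻¹ • col N ((bar p + C p₀) * (B * bar (E s)))) i)
      (((p₀ + conj p₀)⁻¹ • col N ((bar p + C p₀) * (B * bar ((K - C k) * E s)))) i) s := fun i =>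
    ((h.bar.mul_left B).mul_left _ _).const_mul _
  refine (hM.bilin hB hA).congr_deriv ?_
  have e1 : bil N u ((K - C k) * E s) (bar (E s)) + bil N u (E s) (bar ((K - C k) * E s))
      = R - (k + conj k) • M := by
    rw [← hR, hMdef, map_mul bar, map_sub bar, bar_C]
    simp only [sub_mul, map_sub, ← smul_eq_C_mul, map_smul, LinearMap.sub_apply,
      LinearMap.smul_apply]
    module
  have e2 : M⁻¹ * M * M⁻¹ = M⁻¹ := by
    rw [Matrix.nonsing_inv_mul _ (isUnit_iff_ne_zero.2 h0), Matrix.one_mul]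
  have e3 : (p + C (conj p₀)) * (A * ((K - C k) * E s))
      = (p + C (conj p₀)) * (K * A * E s) - k • ((p + C (conj p₀)) * (A * E s)) := by
    rw [smul_eq_C_mul]; ring
  have e4 : (bar p + C p₀) * (B * bar ((K - C k) * E s))
      = (bar p + C p₀) * (bar K * B * bar (E s))
        - conj k • ((bar p + C p₀) * (B * bar (E s))) := by
    rw [smul_eq_C_mul, map_mul, map_sub, bar_C]; ring
  rw [e1, e3, e4]
  simp only [br, ← hMdef, map_sub, map_smul, smul_sub, sub_dotProduct, mulVec_sub, dotProduct_sub,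
    Matrix.mul_sub, Matrix.sub_mul, Matrix.mul_smul, Matrix.smul_mul, e2, neg_sub, sub_mulVec,
    smul_mulVec, mulVec_smul, dotProduct_smul, smul_dotProduct, smul_eq_mul]
  ring

/-- A rank-one term in the derivative of M splits into a product of two brackets, the source of the
nonlinearity. -/
theorem dotProduct_mul_vecMulVec_mul (a b c d : Fin N → ℂ) (M : Matrix (Fin N) (Fin N) ℂ) :
    a ⬝ᵥ (M * vecMulVec b c * M) *ᵥ d = (a ⬝ᵥ M *ᵥ b) * (c ⬝ᵥ M *ᵥ d) := by
  rw [Matrix.mul_vecMulVec, Matrix.vecMulVec_mul, vecMulVec_mulVec]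
  simp [dotProduct_smul, dotProduct_mulVec, mul_comm]

end

end LSRI

namespace LSRI
open PowerSeries Matrix

/-! ### Evolution of the brackets -/

section
variable {N : ℕ} {p₀ : ℂ} {p u : ℂ⟦X⟧}

theorem Uniformizer.sylvester_mul (h : Uniformizer p₀ p u) (E A B : ℂ⟦X⟧) :
    bil N u (p * A * E) (B * bar E) + bil N u (A * E) (bar p * B * bar E)
      = vecMulVec (col N ((p + C (conj p₀)) * (A * E)))
        ((p₀ + conj p₀)⁻¹ • col N ((bar p + C p₀) * (B * bar E))) := by
  rw [← h.sylvester, mul_assoc, mul_assoc]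

/-- A family `E(x, t)` of power series with `E_x = (p - p₀) E` and `E_t = -i (p² - p₀²) E`, and
with invertible Gram matrices. -/
structure IsFlow (N : ℕ) (p₀ : ℂ) (p u : ℂ⟦X⟧) (E : ℝ → ℝ → ℂ⟦X⟧) : Prop where
  deriv_x : ∀ x t, CoeffDeriv (fun x => E x t) ((p - C p₀) * E x t) x
  deriv_t : ∀ x t, CoeffDeriv (fun t => E x t)
    ((C (-Complex.I) * p ^ 2 - C (-Complex.I * p₀ ^ 2)) * E x t) t
  det_ne : ∀ x t, (bil N u (E x t) (bar (E x t))).det ≠ 0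

variable {E : ℝ → ℝ → ℂ⟦X⟧}

theorem IsFlow.br_x (hE : IsFlow N p₀ p u E) (h : Uniformizer p₀ p u) (B A : ℂ⟦X⟧) (x t : ℝ) :
    HasDerivAt (fun x => br N p₀ p u (E x t) B A)
      (br N p₀ p u (E x t) (bar p * B) A + br N p₀ p u (E x t) B (p * A)
        - br N p₀ p u (E x t) B 1 * br N p₀ p u (E x t) 1 A) x := by
  refine (br_hasDerivAt (hE.deriv_x x t) (h.sylvester N (E x t) (bar (E x t)))
    (hE.det_ne x t) B A).congr_deriv ?_
  rw [dotProduct_mul_vecMulVec_mul]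
  simp only [br, one_mul]

theorem IsFlow.br_t (hE : IsFlow N p₀ p u E) (h : Uniformizer p₀ p u) (B A : ℂ⟦X⟧) (x t : ℝ) :
    HasDerivAt (fun t => br N p₀ p u (E x t) B A)
      (Complex.I * br N p₀ p u (E x t) (bar p ^ 2 * B) A
        - Complex.I * br N p₀ p u (E x t) B (p ^ 2 * A)
        + Complex.I * (br N p₀ p u (E x t) B p * br N p₀ p u (E x t) 1 A
          - br N p₀ p u (E x t) B 1 * br N p₀ p u (E x t) (bar p) A)) t := by
  -- The factorization p² - p̄² = p(p + p̄) - (p + p̄)p̄ makes the t-derivative of M, up to a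
  -- multiple of M, a difference of two rank-one matrices.
  have hR : bil N u (C (-Complex.I) * p ^ 2 * E x t) (bar (E x t))
      + bil N u (E x t) (bar (C (-Complex.I) * p ^ 2) * bar (E x t))
      = (-Complex.I) • (vecMulVec (col N ((p + C (conj p₀)) * (p * E x t)))
          ((p₀ + conj p₀)⁻¹ • col N ((bar p + C p₀) * (1 * bar (E x t))))
        - vecMulVec (col N ((p + C (conj p₀)) * (1 * E x t)))
          ((p₀ + conj p₀)⁻¹ • col N ((bar p + C p₀) * (bar p * bar (E x t))))) := by
    rw [← h.sylvester_mul, ← h.sylvester_mul, map_mul bar, map_pow bar, bar_C, mul_assoc (C _),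
      mul_assoc (C _), ← smul_eq_C_mul, ← smul_eq_C_mul, map_smul, map_smul, LinearMap.smul_apply,
      pow_two, pow_two, one_mul, mul_one, mul_one, map_neg, Complex.conj_I, one_mul]
    module
  refine (br_hasDerivAt (hE.deriv_t x t) hR (hE.det_ne x t) B A).congr_deriv ?_
  rw [Matrix.mul_smul, Matrix.smul_mul, smul_mulVec, dotProduct_smul, Matrix.mul_sub,
    Matrix.sub_mul, sub_mulVec, dotProduct_sub, dotProduct_mul_vecMulVec_mul,
    dotProduct_mul_vecMulVec_mul, map_mul bar, map_pow bar, bar_C, mul_assoc (C _),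
    mul_assoc (C _), br_C_mul_left, br_C_mul_right, map_neg, Complex.conj_I, smul_eq_mul]
  simp only [br]
  ring

/-- Logarithmic derivative of the determinant of the Gram matrix. -/
theorem IsFlow.det_x (hE : IsFlow N p₀ p u E) (h : Uniformizer p₀ p u) (x t : ℝ) :
    HasDerivAt (fun x => (bil N u (E x t) (bar (E x t))).det)
      ((bil N u (E x t) (bar (E x t))).det *
        (br N p₀ p u (E x t) 1 1 - N * (p₀ + conj p₀))) x := by
  have h0 := hE.det_ne x t
  refine ((hE.deriv_x x t).bil (N := N) (u := u)).det.congr_deriv ?_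
  set M := bil N u (E x t) (bar (E x t)) with hM
  -- M_x is a rank-one matrix minus (p₀ + p₀*)M. In Jacobi's formula the first part has trace [1, 1]
  -- against M⁻¹, and the second gives N(p₀ + p₀*).
  have e1 : bil N u ((p - C p₀) * E x t) (bar (E x t))
      + bil N u (E x t) (bar ((p - C p₀) * E x t))
      = vecMulVec (col N ((p + C (conj p₀)) * (1 * E x t)))
          ((p₀ + conj p₀)⁻¹ • col N ((bar p + C p₀) * (1 * bar (E x t))))
        - (p₀ + conj p₀) • M := by
    rw [← h.sylvester_mul, map_mul bar, map_sub bar, bar_C, hM]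
    simp only [sub_mul, map_sub, ← smul_eq_C_mul, map_smul, LinearMap.sub_apply,
      LinearMap.smul_apply, mul_one, one_mul]
    module
  have e2 : M.adjugate = M.det • M⁻¹ := by
    rw [Matrix.inv_def, Ring.inverse_eq_inv', smul_smul, mul_inv_cancel₀ h0, one_smul]
  rw [e1, e2, Matrix.smul_mul, trace_smul, smul_eq_mul, Matrix.mul_sub, trace_sub, Matrix.mul_smul,
    Matrix.nonsing_inv_mul _ (isUnit_iff_ne_zero.2 h0), trace_smul, trace_one, Matrix.mul_vecMulVec,
    trace_vecMulVec, Fintype.card_fin, dotProduct_comm, br, ← hM, smul_eq_mul]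
  ring

/-- The two nonlinear equations satisfied by the brackets, in terms of `G = 1 - u` with
`u = [1/(p* + a), 1]` and `v = [1, 1]`. -/
theorem IsFlow.exists_schroedinger (hE : IsFlow N p₀ p u E) (h : Uniformizer p₀ p u) {a : ℂ}
    {Z : ℂ⟦X⟧} (hZ : (bar p + C a) * Z = 1) :
    ∃ G₁ G₂ G₃ v₁ : ℝ → ℝ → ℂ,
      (∀ x t, HasDerivAt (fun x => 1 - br N p₀ p u (E x t) Z 1) (G₁ x t) x) ∧
      (∀ x t, HasDerivAt (fun x => G₁ x t) (G₂ x t) x) ∧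
      (∀ x t, HasDerivAt (fun t => 1 - br N p₀ p u (E x t) Z 1) (G₃ x t) t) ∧
      (∀ x t, HasDerivAt (fun x => br N p₀ p u (E x t) 1 1) (v₁ x t) x) ∧
      ∀ x t, Complex.I * G₃ x t - 2 * a * G₁ x t - G₂ x t
        - 2 * v₁ x t * (1 - br N p₀ p u (E x t) Z 1) = 0 := by
  have q1 : bar p * Z = 1 - C a * Z := by rw [← hZ]; ring
  have q2 : bar p ^ 2 * Z = bar p - C a * 1 + C (a ^ 2) * Z := by
    rw [pow_two, mul_assoc, q1, mul_sub, mul_one, mul_left_comm, q1, map_pow]; ring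
  have hux := hE.br_x h Z 1
  have hu1x := hE.br_x h Z p
  have hvx := hE.br_x h 1 1
  have hut := hE.br_t h Z 1
  -- With u = [Z, 1], u₁ = [Z, p] and v = [1, 1], the relation p̄Z = 1 - aZ gives G_x = -(v - au +
  -- u₁ - uv), which is differentiated once more here.
  have hG2 := fun x t => ((((hvx x t).fun_sub ((hux x t).const_mul a)).fun_add
    (hu1x x t)).fun_sub ((hux x t).fun_mul (hvx x t))).fun_neg
  refine ⟨_, _, _, _, fun x t => ?_, hG2, fun x t => (hut x t).const_sub 1, fun x t => hvx x t,
    fun x t => ?_⟩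
  · refine ((hux x t).const_sub 1).congr_deriv ?_
    rw [q1, br_sub_left, br_C_mul_left, mul_one]
  · rw [q1, q2]
    simp only [br_sub_left, br_add_left, br_C_mul_left]
    simp only [mul_one, ← pow_two p]
    ring_nf
    rw [Complex.I_sq]
    ring

theorem sum_range_two_mul {R : Type*} [AddCommMonoid R] (f : ℕ → R) (n : ℕ) :
    ∑ k ∈ Finset.range (2 * n), f k = ∑ k ∈ Finset.range n, (f (2 * k) + f (2 * k + 1)) := by
  induction n with
  | zero => simp
  | succ n ih => rw [mul_add, Finset.sum_range_succ, Finset.sum_range_succ, ih,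
      Finset.sum_range_succ, add_assoc]

/-- The action of the even part of `F` on odd coefficients. -/
noncomputable def evenMat (N : ℕ) (F : ℂ⟦X⟧) : Matrix (Fin N) (Fin N) ℂ :=
  of fun i k => if (k : ℕ) ≤ i then coeff (2 * ((i : ℕ) - k)) F else 0

/-- An odd coefficient of FA pairs even coefficients of F with odd coefficients of A of no larger
index. The first N odd coefficients therefore form a closed system, which is why only odd indices
enter the determinant. -/
theorem col_mul_of_even {F : ℂ⟦X⟧} (hF : ∀ j, coeff (2 * j + 1) F = 0) (A : ℂ⟦X⟧) :
    col N (F * A) = evenMat N F *ᵥ col N A := by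
  ext i
  rw [col_apply, mul_comm F, coeff_mul, Finset.Nat.sum_antidiagonal_eq_sum_range_succ_mk,
    show (2 * (i : ℕ) + 1).succ = 2 * ((i : ℕ) + 1) by omega, sum_range_two_mul]
  have h1 : (evenMat N F *ᵥ col N A) i = ∑ k ∈ Finset.range N,
      if k ≤ (i : ℕ) then coeff (2 * k + 1) A * coeff (2 * ((i : ℕ) - k)) F else 0 := by
    rw [← Fin.sum_univ_eq_sum_range (fun k => if k ≤ (i : ℕ) then
      coeff (2 * k + 1) A * coeff (2 * ((i : ℕ) - k)) F else 0)]
    simp only [mulVec, dotProduct, evenMat, of_apply, col_apply]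
    refine Finset.sum_congr rfl fun k _ => ?_
    split_ifs <;> ring
  rw [h1, ← Finset.sum_filter]
  have h2 : Finset.filter (fun k => k ≤ (i : ℕ)) (Finset.range N) = Finset.range ((i : ℕ) + 1) := by
    ext k; have := i.2; simp; omega
  rw [h2]
  refine Finset.sum_congr rfl fun k hk => ?_
  have hk' : k ≤ i := Nat.lt_succ_iff.1 (Finset.mem_range.1 hk)
  rw [show 2 * (i : ℕ) + 1 - 2 * k = 2 * (i - k) + 1 by omega, hF,
    show 2 * (i : ℕ) + 1 - (2 * k + 1) = 2 * (i - k) by omega]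
  ring

theorem bil_even_left {F : ℂ⟦X⟧} (hF : ∀ j, coeff (2 * j + 1) F = 0) (A B : ℂ⟦X⟧) :
    bil N u (F * A) B = evenMat N F * bil N u A B := by
  rw [bil_apply, bil_apply, Matrix.mul_sum]
  refine Finset.sum_congr rfl fun ν _ => ?_
  rw [mul_assoc, col_mul_of_even hF, Matrix.mul_vecMulVec]

theorem bil_even_right {F : ℂ⟦X⟧} (hF : ∀ j, coeff (2 * j + 1) F = 0) (A B : ℂ⟦X⟧) :
    bil N u A (F * B) = bil N u A B * (evenMat N F)ᵀ := by
  rw [bil_apply, bil_apply, Matrix.sum_mul]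
  refine Finset.sum_congr rfl fun ν _ => ?_
  rw [mul_assoc, col_mul_of_even hF, Matrix.vecMulVec_mul, vecMul_transpose]

/-- The reduction: if `Q = c₁/(p - a₁) + c₂/(p - a₂) + i p²` is even in `κ`, then
`v_t = ∑ c_l (1 - (1 - [Z_l, 1]) (1 - [1, Z_l*]))`. -/
theorem IsFlow.br_one_one_t (hE : IsFlow N p₀ p u E) (h : Uniformizer p₀ p u)
    {c₁ c₂ : ℝ} {Z₁ Z₂ : ℂ⟦X⟧} {a₁ a₂ : ℂ} (ha₁ : conj a₁ = -a₁) (ha₂ : conj a₂ = -a₂)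
    (hZ₁ : (bar p + C a₁) * Z₁ = 1) (hZ₂ : (bar p + C a₂) * Z₂ = 1) 
    (hodd : ∀ j, coeff (2 * j + 1) (C (c₁ : ℂ) * bar Z₁ + C (c₂ : ℂ) * bar Z₂
      + C Complex.I * p ^ 2) = 0) (x t : ℝ) :
    HasDerivAt (fun t => br N p₀ p u (E x t) 1 1)
      (c₁ + c₂ - c₁ * ((1 - br N p₀ p u (E x t) Z₁ 1) * (1 - br N p₀ p u (E x t) 1 (bar Z₁)))
        - c₂ * ((1 - br N p₀ p u (E x t) Z₂ 1) * (1 - br N p₀ p u (E x t) 1 (bar Z₂)))) t := by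
  refine (hE.br_t h 1 1 x t).congr_deriv ?_
  have h0 := hE.det_ne x t
  set e := E x t with he
  set F := C (c₁ : ℂ) * bar Z₁ + C (c₂ : ℂ) * bar Z₂ + C Complex.I * p ^ 2 with hF
  have hbF : bar F = C (c₁ : ℂ) * Z₁ + C (c₂ : ℂ) * Z₂ - C Complex.I * bar p ^ 2 := by
    rw [hF]
    simp only [map_add, map_mul, bar_bar, bar_C, map_pow, Complex.conj_ofReal, Complex.conj_I,
      map_neg]
    ring
  have hodd' : ∀ j, coeff (2 * j + 1) (bar F) = 0 := fun j => by rw [coeff_bar, hodd, map_zero]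
  set φ : ℂ⟦X⟧ → Fin N → ℂ := fun A => col N ((p + C (conj p₀)) * (A * e)) with hφ
  set ψ : ℂ⟦X⟧ → Fin N → ℂ :=
    fun B => (p₀ + conj p₀)⁻¹ • col N ((bar p + C p₀) * (B * bar e)) with hψ
  -- Here Z̄ = 1/(p - a), and 1/(p - a) + 1/(p̄ + a) = (p + p̄)/((p - a)(p̄ + a)), so the sum again
  -- has rank one.
  have key : ∀ {a : ℂ} {Z : ℂ⟦X⟧}, conj a = -a → (bar p + C a) * Z = 1 →
      bil N u (bar Z * e) (bar e) + bil N u e (Z * bar e) = vecMulVec (φ (bar Z)) (ψ Z) := by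
    intro a Z ha hZ
    have q1 : bar p * Z = 1 - C a * Z := by rw [← hZ]; ring
    have q2 : p * bar Z = 1 + C a * bar Z := by
      have := congrArg bar hZ
      rw [map_mul, map_add, bar_bar, bar_C, ha, map_one, map_neg] at this
      rw [← this]; ring
    simp only [hφ, hψ]
    rw [← h.sylvester_mul, q1, q2]
    simp only [add_mul, sub_mul, one_mul, ← smul_eq_C_mul, map_add, map_sub, map_smul,
      LinearMap.add_apply, LinearMap.smul_apply, smul_mul_assoc]
    module
  have hR : bil N u (F * e) (bar e) + bil N u e (bar F * bar e)
      = (c₁ : ℂ) • vecMulVec (φ (bar Z₁)) (ψ Z₁) + (c₂ : ℂ) • vecMulVec (φ (bar Z₂)) (ψ Z₂)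
        + Complex.I • (vecMulVec (φ p) (ψ 1) - vecMulVec (φ 1) (ψ (bar p))) := by
    rw [← key ha₁ hZ₁, ← key ha₂ hZ₂, hbF, hF]
    simp only [hφ, hψ]
    rw [← h.sylvester_mul, ← h.sylvester_mul]
    simp only [add_mul, sub_mul, one_mul, mul_one, mul_assoc, ← smul_eq_C_mul, map_add, map_sub,
      map_smul, LinearMap.add_apply, LinearMap.smul_apply, pow_two, smul_mul_assoc]
    module
  -- Evenness evaluates the matrix of `hR` as SM + MS'ᵀ, with S and S' the actions of F and F̄.
  -- Between ψ₁ᵀM⁻¹ and M⁻¹φ₁ it becomes [F̄, 1] + [1, F]; equating this with the rank-one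
  -- evaluation is the reduction.
  have hL : ψ 1 ⬝ᵥ ((bil N u e (bar e))⁻¹ *
      (bil N u (F * e) (bar e) + bil N u e (bar F * bar e)) * (bil N u e (bar e))⁻¹) *ᵥ φ 1
      = br N p₀ p u e (bar F) 1 + br N p₀ p u e 1 F := by
    have e1 : φ F = evenMat N F *ᵥ φ 1 := by
      simp only [hφ]
      rw [← col_mul_of_even hodd]; congr 1; ring
    have e2 : ψ (bar F) = evenMat N (bar F) *ᵥ ψ 1 := by
      simp only [hψ]
      rw [mulVec_smul, ← col_mul_of_even hodd']; congr 2; ring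
    change _ = ψ (bar F) ⬝ᵥ (bil N u e (bar e))⁻¹ *ᵥ φ 1
      + ψ 1 ⬝ᵥ (bil N u e (bar e))⁻¹ *ᵥ φ F
    rw [bil_even_left hodd, bil_even_right hodd', Matrix.mul_add, Matrix.add_mul,
      ← Matrix.mul_assoc _ (bil N u e (bar e)),
      Matrix.nonsing_inv_mul _ (isUnit_iff_ne_zero.2 h0), Matrix.one_mul, ← Matrix.mul_assoc,
      Matrix.mul_assoc _ (bil N u e (bar e)),
      Matrix.mul_nonsing_inv _ (isUnit_iff_ne_zero.2 h0), Matrix.mul_one, add_mulVec,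
      dotProduct_add, e1, e2, mulVec_mulVec, add_comm]
    congr 1
    rw [← mulVec_mulVec, dotProduct_mulVec, vecMul_transpose]
  rw [hR] at hL
  simp only [Matrix.mul_add, Matrix.add_mul, Matrix.mul_sub, Matrix.sub_mul, Matrix.mul_smul,
    Matrix.smul_mul, add_mulVec, sub_mulVec, smul_mulVec, dotProduct_add, dotProduct_sub,
    dotProduct_smul, dotProduct_mul_vecMulVec_mul, smul_eq_mul] at hL
  change c₁ * (br N p₀ p u e 1 (bar Z₁) * br N p₀ p u e Z₁ 1)
    + c₂ * (br N p₀ p u e 1 (bar Z₂) * br N p₀ p u e Z₂ 1)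
    + Complex.I * (br N p₀ p u e 1 p * br N p₀ p u e 1 1
      - br N p₀ p u e 1 1 * br N p₀ p u e (bar p) 1) = _ at hL
  rw [hbF, hF] at hL
  simp only [br_sub_left, br_add_left, br_add_right, br_C_mul_left, br_C_mul_right] at hL
  rw [mul_one, mul_one]
  linear_combination hL
end

end LSRI

namespace LSRI

/-! ### The function `Q` -/

/-- A real monic quartic with a non-real double root a + ib is ((y - a)² + b²)². Then s = 4a and q =
6a² + 2b², so 4q exceeds s² = 16a². -/
theorem no_double_root {s q C D : ℝ} (hs : 4 * q ≤ s ^ 2) {y : ℂ} (hy : y.im ≠ 0)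
    (h0 : y ^ 4 - s * y ^ 3 + q * y ^ 2 + C * y + D = 0)
    (h1 : 4 * y ^ 3 - 3 * s * y ^ 2 + 2 * q * y + C = 0) : False := by
  obtain ⟨a, b⟩ := y
  simp only at hy
  have e1 := congrArg Complex.im h1
  -- Subtracting y times the derivative removes the linear coefficient C, leaving an imaginary part
  -- in s and q alone.
  have e0 := congrArg Complex.im (show (-3 : ℂ) * (⟨a, b⟩ : ℂ) ^ 4 + 2 * s * (⟨a, b⟩ : ℂ) ^ 3
    - q * (⟨a, b⟩ : ℂ) ^ 2 + D = 0 by linear_combination h0 - (⟨a, b⟩ : ℂ) * h1)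
  simp [pow_succ] at e1 e0
  have f1 : 4 * (3 * a ^ 2 - b ^ 2) - 6 * s * a + 2 * q = 0 := by
    apply mul_left_cancel₀ hy; linear_combination e1
  have f0 : -12 * a * (a ^ 2 - b ^ 2) + 2 * s * (3 * a ^ 2 - b ^ 2) - 2 * q * a = 0 := by
    apply mul_left_cancel₀ hy; linear_combination e0
  have f2 : 2 * b ^ 2 * (4 * a - s) = 0 := by linear_combination f0 + a * f1
  have f3 : s = 4 * a := by
    rcases mul_eq_zero.1 f2 with h | h
    · exact absurd (by simpa using h) hy
    · linarith
  have : 0 < b ^ 2 := by positivity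
  subst f3
  nlinarith [sq_nonneg a]

variable {P : Params} {p₀ : ℂ}

theorem sub_I_mul_ne {p : ℂ} (hp : p.re ≠ 0) (k : ℝ) : p - Complex.I * k ≠ 0 := by
  intro h
  apply hp
  have := congrArg Complex.re h
  simpa using this

theorem analyticAt_Q (P : Params) {p : ℂ} (hp : p.re ≠ 0) : AnalyticAt ℂ (Q P) p := by
  have h1 := sub_I_mul_ne hp P.k₁
  have h2 := sub_I_mul_ne hp P.k₂
  unfold Q
  fun_prop (disch := assumption)

theorem hasDerivAt_Q (P : Params) {p : ℂ} (hp : p.re ≠ 0) :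
    HasDerivAt (Q P) (-((P.δ₁ * P.ρ₁ ^ 2 : ℝ) : ℂ) / (p - Complex.I * P.k₁) ^ 2
      - ((P.δ₂ * P.ρ₂ ^ 2 : ℝ) : ℂ) / (p - Complex.I * P.k₂) ^ 2 + 2 * Complex.I * p) p := by
  have h1 := sub_I_mul_ne hp P.k₁
  have h2 := sub_I_mul_ne hp P.k₂
  have d1 := (hasDerivAt_const p ((P.δ₁ * P.ρ₁ ^ 2 : ℝ) : ℂ)).fun_div
    ((hasDerivAt_id p).sub_const (Complex.I * P.k₁)) h1
  have d2 := (hasDerivAt_const p ((P.δ₂ * P.ρ₂ ^ 2 : ℝ) : ℂ)).fun_div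
    ((hasDerivAt_id p).sub_const (Complex.I * P.k₂)) h2
  have d3 := ((hasDerivAt_id p).fun_pow 2).const_mul Complex.I
  refine ((d1.fun_add d2).fun_add d3).congr_deriv ?_
  simp only [id]
  push_cast
  ring

/-- With p₀ = iy, vanishing of both Q and Q' at p₀ makes y a double root of the real quartic y²(y -
k₁)(y - k₂) + c₁(y - k₂) + c₂(y - k₁), where c_l = δ_lρ_l². Since y is not real, (k₁ + k₂)² ≥ 4k₁k₂
excludes this. Without it W and cosh κ = Q/Q(p₀) would be meaningless. -/
theorem Q_ne_zero (hre : p₀.re ≠ 0) (hroot : IsSimpleRoot P p₀) : Q P p₀ ≠ 0 := by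
  intro h
  have h1 := sub_I_mul_ne hre P.k₁
  have h2 := sub_I_mul_ne hre P.k₂
  have h' := hroot.1
  rw [(hasDerivAt_Q P hre).deriv] at h'
  rw [Q] at h
  set c₁ := P.δ₁ * P.ρ₁ ^ 2
  set c₂ := P.δ₂ * P.ρ₂ ^ 2
  set k₁ := P.k₁
  set k₂ := P.k₂
  set A := p₀ - Complex.I * k₁ with hA
  set B := p₀ - Complex.I * k₂ with hB
  have g0 : c₁ * B + c₂ * A + Complex.I * p₀ ^ 2 * A * B = 0 := by
    have := congrArg (fun z => z * (A * B)) h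
    simp only [zero_mul] at this
    rw [← this]; field_simp
  have g1 : c₁ + c₂ + Complex.I * (2 * p₀ * A * B + p₀ ^ 2 * (A + B)) = 0 := by
    have h3 : (c₁ / A + c₂ / B + Complex.I * p₀ ^ 2) * (A + B)
      + (-c₁ / A ^ 2 - c₂ / B ^ 2 + 2 * Complex.I * p₀) * (A * B) = 0 := by rw [h, h']; ring
    rw [← h3]; field_simp; ring
  have hI : Complex.I ^ 2 = -1 := Complex.I_sq
  have hp : p₀ = Complex.I * (-Complex.I * p₀) := by linear_combination p₀ * hI
  set y := -Complex.I * p₀ with hy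
  have hA' : A = Complex.I * (y - k₁) := by rw [hA, hp]; ring
  have hB' : B = Complex.I * (y - k₂) := by rw [hB, hp]; ring
  rw [hA', hB', hp] at g0 g1
  refine no_double_root (s := k₁ + k₂) (q := k₁ * k₂) (C := c₁ + c₂) (D := -(c₁ * k₂ + c₂ * k₁))
    (by nlinarith [sq_nonneg (k₁ - k₂)]) (y := y) ?_ ?_ ?_
  · rw [hy]; simpa using hre
  · push_cast
    have hI5 : Complex.I ^ 5 = Complex.I := by
      rw [show (5 : ℕ) = 2 + 2 + 1 from rfl, pow_add, pow_add, hI]; ring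
    have : Complex.I * (y ^ 4 - (k₁ + k₂) * y ^ 3 + k₁ * k₂ * y ^ 2 + (c₁ + c₂) * y
        + -(c₁ * k₂ + c₂ * k₁)) = 0 := by
      linear_combination g0 - (y ^ 2 * (y - k₁) * (y - k₂)) * hI5
    exact (mul_eq_zero.1 this).resolve_left Complex.I_ne_zero
  · push_cast
    have hI4 : Complex.I ^ 4 = 1 := by
      rw [show (4 : ℕ) = 2 + 2 from rfl, pow_add, hI]; ring
    linear_combination g1 - (2 * y * (y - k₁) * (y - k₂) + y ^ 2 * (y - k₁ + (y - k₂))) * hI4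

theorem lam_one (p₀ : ℂ) (pκ : ℂ → ℂ) : lam p₀ pκ 1 = deriv pκ 0 := by
  rw [lam, taylorCoeff, iteratedDeriv_one]
  simp

/-- Differentiate Q(p(κ)) = Q(p₀) cosh κ twice at 0; the term with p''(0) drops because Q'(p₀) = 0.
Hence p'(0) ≠ 0. -/
theorem deriv_sq_of_isBranchP (hre : p₀.re ≠ 0) (hroot : IsSimpleRoot P p₀) {pκ : ℂ → ℂ}
    (hp : IsBranchP P p₀ pκ) : deriv (deriv (Q P)) p₀ * deriv pκ 0 ^ 2 = Q P p₀ := by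
  obtain ⟨ha, h0, hQ⟩ := hp
  have hQa := analyticAt_Q P hre
  have hre' : ∀ᶠ κ in 𝓝 (0 : ℂ), (pκ κ).re ≠ 0 := by
    have : ContinuousAt (fun κ => (pκ κ).re) 0 := Complex.continuous_re.continuousAt.comp ha.continuousAt
    exact this.eventually_ne (by rwa [h0])
  have h1 : ∀ᶠ κ in 𝓝 (0 : ℂ), deriv (Q P) (pκ κ) * deriv pκ κ = Q P p₀ * Complex.sinh κ := by
    filter_upwards [hQ.eventually_nhds, hre', ha.eventually_analyticAt] with κ h2 h3 h4
    have h5 := ((analyticAt_Q P h3).differentiableAt.hasDerivAt).comp κ h4.differentiableAt.hasDerivAt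
    refine h5.unique ?_
    exact ((Complex.hasDerivAt_cosh κ).const_mul (Q P p₀)).congr_of_eventuallyEq h2
  have hda : HasDerivAt (deriv (Q P)) (deriv (deriv (Q P)) p₀) (pκ 0) := by
    rw [h0]; exact hQa.deriv.differentiableAt.hasDerivAt
  have h6 := (hda.comp (0 : ℂ) ha.differentiableAt.hasDerivAt).mul
    ha.deriv.differentiableAt.hasDerivAt
  have h7 := ((Complex.hasDerivAt_sinh 0).const_mul (Q P p₀)).congr_of_eventuallyEq h1
  have h8 := h6.unique h7
  simp only [Function.comp, h0, hroot.1, Complex.cosh_zero] at h8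
  linear_combination h8

theorem lam_one_ne_zero (hre : p₀.re ≠ 0) (hroot : IsSimpleRoot P p₀) {pκ : ℂ → ℂ}
    (hp : IsBranchP P p₀ pκ) : lam p₀ pκ 1 ≠ 0 := by
  intro h
  have := deriv_sq_of_isBranchP hre hroot hp
  rw [← lam_one p₀, h] at this
  exact Q_ne_zero hre hroot (by rw [← this]; ring)

end LSRI

namespace LSRI
open PowerSeries Matrix

/-! ### Positivity of Gram matrices -/

theorem coeff_mul_pow_self {u : ℂ⟦X⟧} (hu0 : constantCoeff u = 0) (A : ℂ⟦X⟧) (k : ℕ) :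
    coeff k (A * u ^ k) = constantCoeff A * coeff 1 u ^ k := by
  obtain ⟨w, rfl⟩ := X_dvd_iff.2 hu0
  have h1 : coeff 1 (X * w) = constantCoeff w := by
    rw [show (1 : ℕ) = 0 + 1 from rfl, coeff_succ_X_mul, coeff_zero_eq_constantCoeff_apply]
  rw [h1, mul_pow, mul_left_comm, coeff_X_pow_mul', if_pos le_rfl, Nat.sub_self,
    coeff_zero_eq_constantCoeff_apply, map_mul, map_pow]

open scoped ComplexOrder in
-- The geometric sum is ΦΦᴴ, where column ν of Φ holds the odd coefficients of Au^ν. Since Au^ν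
-- starts exactly in degree ν, the columns ν = 1, 3, …, 2N - 1 form a triangular matrix with nonzero
-- diagonal, so Φ has full row rank.
theorem bil_det_pos {u A : ℂ⟦X⟧} (hu0 : constantCoeff u = 0) (hu1 : coeff 1 u ≠ 0)
    (hA : constantCoeff A ≠ 0) (N : ℕ) : 0 < (bil N u A (bar A)).det := by
  set Φ : Matrix (Fin N) (Fin (2 * N)) ℂ := of fun s ν => coeff (2 * (s : ℕ) + 1) (A * u ^ (ν : ℕ))
    with hΦ
  have h1 : bil N u A (bar A) = Φ * Φᴴ := by
    ext s j
    rw [bil_apply, Matrix.sum_apply, Matrix.mul_apply, ← Fin.sum_univ_eq_sum_range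
      (fun ν => vecMulVec (col N (A * u ^ ν)) (col N (bar A * bar u ^ ν)) s j)]
    refine Finset.sum_congr rfl fun ν _ => ?_
    simp [vecMulVec_apply, col_apply, hΦ, conjTranspose_apply, ← coeff_bar]
  rw [h1]
  refine (PosDef.mul_conjTranspose_self Φ ?_).det_pos
  set f : Fin N → Fin (2 * N) := fun s => ⟨2 * s + 1, by have := s.2; omega⟩ with hf
  set Ψ : Matrix (Fin N) (Fin N) ℂ := Φ.submatrix id f with hΨ
  have htri : Ψ.IsLowerTriangular := by
    intro s j hsj
    have hsj' : s < j := hsj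
    exact coeff_mul_pow_eq_zero hu0 A (by have : (s : ℕ) < j := hsj'; simp [hf]; omega)
  have hdet : Ψ.det ≠ 0 := by
    rw [Matrix.det_of_isLowerTriangular Ψ htri]
    refine Finset.prod_ne_zero_iff.2 fun s _ => ?_
    have : Ψ s s = constantCoeff A * coeff 1 u ^ (2 * (s : ℕ) + 1) := coeff_mul_pow_self hu0 A _
    rw [this]
    exact mul_ne_zero hA (pow_ne_zero _ hu1)
  have hinj : Function.Injective Ψ.vecMul :=
    Matrix.vecMul_injective_of_isUnit ((Matrix.isUnit_iff_isUnit_det _).2 (isUnit_iff_ne_zero.2 hdet))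
  intro v w hvw
  apply hinj
  funext s
  exact congrFun hvw (f s)

/-! ### The power series attached to `p(κ)` -/

variable {P : Params} {p₀ : ℂ} {pκ : ℂ → ℂ}

/-- The Taylor series of `(p(κ) - p₀) / (p(κ) + p₀*)`. -/
noncomputable def uSer (p₀ : ℂ) (pκ : ℂ → ℂ) : ℂ⟦X⟧ :=
  X * (C (lam p₀ pκ 1 / (p₀ + conj p₀)) * expSer (sCoeff p₀ pκ))

theorem add_conj_ne {p q : ℂ} (hp : p.re = q.re) (hre : q.re ≠ 0) : p + conj q ≠ 0 := by
  intro h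
  have := congrArg Complex.re h
  simp only [Complex.add_re, Complex.conj_re, Complex.zero_re] at this
  exact hre (by linarith)

theorem serOf_lam (hp : IsBranchP P p₀ pκ) : serOf (lam p₀ pκ) = tps pκ - C p₀ := by
  change serOf (taylorCoeff fun κ => pκ κ - p₀) = _
  rw [serOf_taylorCoeff (by simp [hp.2.1]), tps_sub hp.1 analyticAt_const, tps_const]

theorem serOf_beta (hp : IsBranchP P p₀ pκ) : serOf (beta p₀ pκ) = tps pκ ^ 2 - C (p₀ ^ 2) := by
  change serOf (taylorCoeff fun κ => pκ κ ^ 2 - p₀ ^ 2) = _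
  rw [serOf_taylorCoeff (by simp [hp.2.1]), tps_sub (hp.1.fun_pow 2) analyticAt_const, tps_const,
    tps_pow hp.1]

/-- `exp` of the Taylor series of `log F` is the Taylor series of `F`, if `F 0 = 1`. -/
theorem expSer_taylorCoeff_log {F : ℂ → ℂ} (hF : AnalyticAt ℂ F 0) (h0 : F 0 = 1) :
    expSer (taylorCoeff fun κ => Complex.log (F κ)) = tps F := by
  have hl : AnalyticAt ℂ (fun κ => Complex.log (F κ)) 0 := hF.clog (by simp [h0])
  rw [← tps_exp hl (by simp [h0])]
  apply tps_congr
  filter_upwards [hF.continuousAt.eventually_ne (by rw [h0]; exact one_ne_zero)] with κ hκ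
  rw [Complex.exp_log hκ]

theorem expSer_theta (hre : p₀.re ≠ 0) (hp : IsBranchP P p₀ pκ) (k : ℝ) :
    C (p₀ - Complex.I * k) * expSer (theta p₀ pκ k) = tps pκ - C (Complex.I * k) := by
  have h1 := sub_I_mul_ne hre k
  change C _ * expSer (taylorCoeff fun κ =>
    Complex.log ((pκ κ - Complex.I * k) / (p₀ - Complex.I * k))) = _
  have ha := hp.1
  rw [expSer_taylorCoeff_log (by fun_prop (disch := assumption)) (by rw [hp.2.1, div_self h1])]
  rw [← tps_const_mul _ (by fun_prop (disch := assumption)), ← tps_const,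
    ← tps_sub hp.1 analyticAt_const]
  congr 1; funext κ
  field_simp

theorem analyticAt_dslope {f : ℂ → ℂ} {a : ℂ} (hf : AnalyticAt ℂ f a) :
    AnalyticAt ℂ (dslope f a) a := by
  obtain ⟨s, hs⟩ := hf
  exact ⟨_, hs.has_fpower_series_dslope_fslope⟩

/-- Exponentiating the logarithm that defines the s_r recovers the normalized quotient, so `uSer`
really is the Taylor series of (p - p₀)/(p + p₀*). -/
theorem uSer_mul (hre : p₀.re ≠ 0) (hroot : IsSimpleRoot P p₀) (hp : IsBranchP P p₀ pκ) :
    uSer p₀ pκ * (tps pκ + C (conj p₀)) = tps pκ - C p₀ := by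
  have h1 : p₀ + conj p₀ ≠ 0 := add_conj_ne rfl hre
  have hl := lam_one_ne_zero hre hroot hp
  have ha := hp.1
  have hd := analyticAt_dslope ha
  have h2 : AnalyticAt ℂ (fun κ => (p₀ + conj p₀) / lam p₀ pκ 1 *
      (dslope pκ 0 κ / (pκ κ + conj p₀))) 0 := by
    refine analyticAt_const.mul (hd.div (ha.add analyticAt_const) ?_)
    rwa [hp.2.1]
  have h3 : expSer (sCoeff p₀ pκ) = tps fun κ => (p₀ + conj p₀) / lam p₀ pκ 1 *
      (dslope pκ 0 κ / (pκ κ + conj p₀)) := by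
    refine expSer_taylorCoeff_log h2 ?_
    rw [dslope_same, ← lam_one p₀, hp.2.1]
    field_simp
  rw [uSer, h3, ← tps_const_mul _ h2, ← tps_id, ← tps_mul (F := fun z => z) analyticAt_id (analyticAt_const.fun_mul h2),
    ← tps_const, ← tps_add ha analyticAt_const, ← tps_const p₀, ← tps_sub ha analyticAt_const,
    ← tps_mul (AnalyticAt.fun_mul (f := fun z => z) analyticAt_id (analyticAt_const.fun_mul h2))
      (ha.fun_add analyticAt_const)]
  apply tps_congr
  filter_upwards [(ha.add (analyticAt_const (v := conj p₀))).continuousAt.eventually_ne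
    (by simpa [hp.2.1] using h1)] with κ hκ
  have h4 := sub_smul_dslope pκ 0 κ
  rw [sub_zero, smul_eq_mul, hp.2.1] at h4
  have hκ' : pκ κ + conj p₀ ≠ 0 := hκ
  rw [← h4]
  field_simp

theorem constantCoeff_uSer : constantCoeff (uSer p₀ pκ) = 0 := by
  simp [uSer]

theorem coeff_one_uSer : coeff 1 (uSer p₀ pκ) = lam p₀ pκ 1 / (p₀ + conj p₀) := by
  rw [uSer, show (1 : ℕ) = 0 + 1 from rfl, coeff_succ_X_mul, coeff_zero_eq_constantCoeff_apply]
  simp [constantCoeff_expSer]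

theorem uniformizer (hre : p₀.re ≠ 0) (hroot : IsSimpleRoot P p₀) (hp : IsBranchP P p₀ pκ) :
    Uniformizer p₀ (tps pκ) (uSer p₀ pκ) where
  re_ne := hre
  constantCoeff_p := by rw [constantCoeff_tps, hp.2.1]
  constantCoeff_u := constantCoeff_uSer
  u_mul := uSer_mul hre hroot hp

/-- The inverse of `p* + i k` as a power series. -/
noncomputable def invSer (pκ : ℂ → ℂ) (k : ℝ) : ℂ⟦X⟧ :=
  bar (tps fun κ => (pκ κ - Complex.I * k)⁻¹)

theorem mul_invSer (hre : p₀.re ≠ 0) (hp : IsBranchP P p₀ pκ) (k : ℝ) :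
    (bar (tps pκ) + C (Complex.I * k)) * invSer pκ k = 1 := by
  have ha := hp.1
  have h1 : pκ 0 - Complex.I * k ≠ 0 := by rw [hp.2.1]; exact sub_I_mul_ne hre k
  have h2 : (tps pκ - C (Complex.I * k)) * (tps fun κ => (pκ κ - Complex.I * k)⁻¹) = 1 := by
    rw [← tps_const, ← tps_sub ha analyticAt_const,
      ← tps_mul (ha.fun_sub analyticAt_const) ((ha.fun_sub analyticAt_const).fun_inv h1),
      ← map_one C, ← tps_const 1]
    apply tps_congr
    filter_upwards [(ha.sub (analyticAt_const (v := Complex.I * k))).continuousAt.eventually_ne h1]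
      with κ hκ
    exact mul_inv_cancel₀ hκ
  have := congrArg bar h2
  rw [map_mul, map_sub, bar_C, map_one, map_mul, Complex.conj_I, Complex.conj_ofReal] at this
  rw [invSer, ← this]
  congr 1
  rw [neg_mul, map_neg]; ring

/-- The series is that of Q(p(κ)) = Q(p₀) cosh κ, and cosh is even. -/
theorem coeff_odd_Q (hre : p₀.re ≠ 0) (hp : IsBranchP P p₀ pκ) (j : ℕ) :
    coeff (2 * j + 1) (C ((P.δ₁ * P.ρ₁ ^ 2 : ℝ) : ℂ) * bar (invSer pκ P.k₁)
      + C ((P.δ₂ * P.ρ₂ ^ 2 : ℝ) : ℂ) * bar (invSer pκ P.k₂) + C Complex.I * tps pκ ^ 2) = 0 := by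
  have ha := hp.1
  have h1 : pκ 0 - Complex.I * P.k₁ ≠ 0 := by rw [hp.2.1]; exact sub_I_mul_ne hre _
  have h2 : pκ 0 - Complex.I * P.k₂ ≠ 0 := by rw [hp.2.1]; exact sub_I_mul_ne hre _
  have a1 : AnalyticAt ℂ (fun κ => (pκ κ - Complex.I * P.k₁)⁻¹) 0 := by
    fun_prop (disch := assumption)
  have a2 : AnalyticAt ℂ (fun κ => (pκ κ - Complex.I * P.k₂)⁻¹) 0 := by
    fun_prop (disch := assumption)
  rw [invSer, invSer, bar_bar, bar_bar, ← tps_pow ha, ← tps_const_mul _ a1, ← tps_const_mul _ a2,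
    ← tps_const_mul _ (ha.fun_pow 2), ← tps_add (analyticAt_const.fun_mul a1) (analyticAt_const.fun_mul a2),
    ← tps_add ((analyticAt_const.fun_mul a1).fun_add (analyticAt_const.fun_mul a2))
      (analyticAt_const.fun_mul (ha.fun_pow 2))]
  have h3 : (tps fun κ => ((P.δ₁ * P.ρ₁ ^ 2 : ℝ) : ℂ) * (pκ κ - Complex.I * P.k₁)⁻¹
      + ((P.δ₂ * P.ρ₂ ^ 2 : ℝ) : ℂ) * (pκ κ - Complex.I * P.k₂)⁻¹ + Complex.I * pκ κ ^ 2)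
      = tps fun κ => Q P p₀ * Complex.cosh κ := tps_congr hp.2.2
  rw [h3, coeff_tps, taylorCoeff]
  have h4 := iteratedDeriv_comp_neg (2 * j + 1) (fun κ => Q P p₀ * Complex.cosh κ) 0
  simp only [Complex.cosh_neg, neg_zero] at h4
  rw [Odd.neg_one_pow ⟨j, rfl⟩, neg_one_smul] at h4
  rw [self_eq_neg.1 h4, zero_div]

end LSRI

namespace LSRI
open PowerSeries Matrix

/-! ### Schur polynomial entries as coefficients of power series -/

/-- Multiplying by the ν-th power of κ·c·exp(∑ z_rκ^r) lowers the index by ν and adds νz to the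
arguments: the origin of the shifts by ν in the Schur entries. -/
theorem coeff_expSer_mul_pow (c : ℂ) (y z : ℕ → ℂ) {s ν : ℕ} (h : ν ≤ s) :
    coeff s (expSer y * (X * (C c * expSer z)) ^ ν)
      = c ^ ν * schur (s - ν) (fun r => y r + ν * z r) := by
  rw [schur_eq_coeff, expSer_add, expSer_nat_mul, mul_pow, mul_pow, ← map_pow,
    mul_left_comm, coeff_X_pow_mul', if_pos h, mul_left_comm, coeff_C_mul]

theorem bar_X_mul (c : ℂ) (z : ℕ → ℂ) :
    bar (X * (C c * expSer z)) = X * (C (conj c) * expSer fun r => conj (z r)) := by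
  rw [map_mul, map_mul, bar_C, bar_expSer]
  congr 1
  simp [bar]

variable {P : Params} {p₀ : ℂ} {pκ : ℂ → ℂ}

theorem conj_add_conj (p₀ : ℂ) : conj (p₀ + conj p₀) = p₀ + conj p₀ := by
  rw [map_add, Complex.conj_conj, add_comm]

/-- Terms beyond min(s, j) vanish by degree, so all entries of the matrix can share one range of
summation. -/
theorem entrySchur_eq (a : ℕ → ℂ) (n k : ℤ) (x t : ℝ) {s j K : ℕ} (hK : min s j < K) :
    entrySchur P p₀ pκ a n k x t s j = ∑ ν ∈ Finset.range K,
      coeff s (expSer (xPlus P p₀ pκ a n k x t) * uSer p₀ pκ ^ ν)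
        * coeff j (expSer (xMinus P p₀ pκ a n k x t) * bar (uSer p₀ pκ) ^ ν) := by
  rw [entrySchur, ← Finset.sum_subset (Finset.range_mono (Nat.succ_le_of_lt hK))]
  · refine Finset.sum_congr rfl fun ν hν => ?_
    have hν' : ν ≤ min s j := Nat.lt_succ_iff.1 (Finset.mem_range.1 hν)
    rw [uSer, bar_X_mul, coeff_expSer_mul_pow _ _ _ (hν'.trans (min_le_left _ _)),
      coeff_expSer_mul_pow _ _ _ (hν'.trans (min_le_right _ _))]
    have : (((‖lam p₀ pκ 1‖ ^ 2 : ℝ) : ℂ) / (p₀ + conj p₀) ^ 2)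
        = lam p₀ pκ 1 / (p₀ + conj p₀) * conj (lam p₀ pκ 1 / (p₀ + conj p₀)) := by
      rw [map_div₀, conj_add_conj, div_mul_div_comm, Complex.mul_conj, Complex.normSq_eq_norm_sq,
        pow_two (p₀ + _)]
    rw [this, mul_pow]; ring
  · intro ν _ hν
    have hν' : min s j < ν := by rw [Finset.mem_range] at hν; omega
    rcases min_lt_iff.1 hν' with h | h
    · rw [coeff_mul_pow_eq_zero constantCoeff_uSer _ h, zero_mul]
    · rw [coeff_mul_pow_eq_zero (by
        rw [← coeff_zero_eq_constantCoeff_apply, coeff_bar, coeff_zero_eq_constantCoeff_apply,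
          constantCoeff_uSer, map_zero]) _ h, mul_zero]

theorem tauSchur_eq (a : ℕ → ℂ) (N : ℕ) (n k : ℤ) (x t : ℝ) :
    tauSchur P p₀ pκ a N n k x t = (bil N (uSer p₀ pκ) (expSer (xPlus P p₀ pκ a n k x t))
      (expSer (xMinus P p₀ pκ a n k x t))).det := by
  rw [tauSchur]
  congr 1
  ext s j
  rw [of_apply, entrySchur_eq a n k x t (K := 2 * N) (by have := s.2; omega), bil_apply,
    Matrix.sum_apply]
  rfl

/-- The family of power series `exp (∑ x_r⁺(0, 0) κ^r)`. -/
noncomputable def flow (P : Params) (p₀ : ℂ) (pκ : ℂ → ℂ) (a : ℕ → ℂ) (x t : ℝ) : ℂ⟦X⟧ :=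
  expSer (xPlus P p₀ pκ a 0 0 x t)

theorem expSer_xMinus_zero (a : ℕ → ℂ) (x t : ℝ) :
    expSer (xMinus P p₀ pκ a 0 0 x t) = bar (flow P p₀ pκ a x t) := by
  rw [flow, bar_expSer]
  congr 1; funext r
  simp [xPlus, xMinus]

theorem expSer_neg_eq {y : ℕ → ℂ} {F G : ℂ⟦X⟧} {c : ℂ} (h : C c * expSer y = F) (hG : F * G = 1) :
    expSer (fun r => -y r) = C c * G := by
  calc expSer (fun r => -y r) = expSer (fun r => -y r) * (F * G) := by rw [hG, mul_one]
    _ = (expSer (fun r => -y r) * expSer y) * (C c * G) := by rw [← h]; ring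
    _ = C c * G := by rw [expSer_neg_mul, one_mul]

theorem expSer_conj_theta (hre : p₀.re ≠ 0) (hp : IsBranchP P p₀ pκ) (k : ℝ) :
    C (conj p₀ + Complex.I * k) * expSer (fun r => conj (theta p₀ pκ k r))
      = bar (tps pκ) + C (Complex.I * k) := by
  have := congrArg bar (expSer_theta hre hp k)
  rw [map_mul bar, map_sub bar, bar_C, bar_C, bar_expSer, map_sub (starRingEnd ℂ),
    map_mul (starRingEnd ℂ), Complex.conj_I, Complex.conj_ofReal] at this
  simpa using this

open scoped ComplexOrder in
theorem flow_isFlow (hre : p₀.re ≠ 0) (hroot : IsSimpleRoot P p₀) (hp : IsBranchP P p₀ pκ)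
    (a : ℕ → ℂ) (N : ℕ) : IsFlow N p₀ (tps pκ) (uSer p₀ pκ) (flow P p₀ pκ a) where
  deriv_x x t j := by
    have h := hasDerivAt_coeff_expSer (lam p₀ pκ) (fun r => -Complex.I * beta p₀ pκ r * t + a r) x j
    have e : ∀ x : ℝ, (fun r => lam p₀ pκ r * x + (-Complex.I * beta p₀ pκ r * t + a r))
        = xPlus P p₀ pκ a 0 0 x t := by
      intro x; funext r; simp only [xPlus]; push_cast; ring
    simp only [e, serOf_lam hp] at h
    exact h
  deriv_t x t j := by
    have h := hasDerivAt_coeff_expSer (fun r => -Complex.I * beta p₀ pκ r)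
      (fun r => lam p₀ pκ r * x + a r) t j
    have e : ∀ t : ℝ, (fun r => -Complex.I * beta p₀ pκ r * t + (lam p₀ pκ r * x + a r))
        = xPlus P p₀ pκ a 0 0 x t := by
      intro t; funext r; simp only [xPlus]; push_cast; ring
    simp only [e, serOf_smul, serOf_beta hp] at h
    have e2 : C (-Complex.I) * tps pκ ^ 2 - C (-Complex.I * p₀ ^ 2)
        = C (-Complex.I) * (tps pκ ^ 2 - C (p₀ ^ 2)) := by rw [map_mul C]; ring
    rw [e2]
    exact h
  det_ne x t := (bil_det_pos constantCoeff_uSer (by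
    rw [coeff_one_uSer]
    exact div_ne_zero (lam_one_ne_zero hre hroot hp) (add_conj_ne rfl hre)) (by
      rw [flow, constantCoeff_expSer]; exact one_ne_zero) N).ne'

open scoped ComplexOrder in
theorem tauSchur_zero_pos (hre : p₀.re ≠ 0) (hroot : IsSimpleRoot P p₀) (hp : IsBranchP P p₀ pκ)
    (a : ℕ → ℂ) (N : ℕ) (x t : ℝ) : 0 < tauSchur P p₀ pκ a N 0 0 x t := by
  rw [tauSchur_eq, expSer_xMinus_zero]
  exact bil_det_pos constantCoeff_uSer (by
    rw [coeff_one_uSer]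
    exact div_ne_zero (lam_one_ne_zero hre hroot hp) (add_conj_ne rfl hre)) (by
      rw [constantCoeff_expSer]; exact one_ne_zero) N

theorem det_sub_vecMulVec {N : ℕ} {M : Matrix (Fin N) (Fin N) ℂ} (h : M.det ≠ 0)
    (v w : Fin N → ℂ) : (M - vecMulVec v w).det = M.det * (1 - w ⬝ᵥ M⁻¹ *ᵥ v) := by
  have h1 : M - vecMulVec v w
      = M * (1 + replicateCol Unit (-(M⁻¹ *ᵥ v)) * replicateRow Unit w) := by
    rw [← vecMulVec_eq, Matrix.mul_add, Matrix.mul_one, Matrix.mul_vecMulVec, mulVec_neg,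
      mulVec_mulVec, Matrix.mul_nonsing_inv _ (isUnit_iff_ne_zero.2 h), one_mulVec, neg_vecMulVec,
      sub_eq_add_neg]
  rw [h1, det_mul, det_one_add_replicateCol_mul_replicateRow, dotProduct_neg, ← sub_eq_add_neg]

/-- Since (p - a)/(p̄ + a) = -(1 - (p + p̄)/(p̄ + a)), the shifted matrix is minus a rank-one
perturbation of M, and the matrix determinant lemma applies. -/
theorem det_bil_shift {N : ℕ} {p u : ℂ⟦X⟧} (h : Uniformizer p₀ p u) {a : ℂ} {Z E : ℂ⟦X⟧}
    (hZ : (bar p + C a) * Z = 1) (h0 : (bil N u E (bar E)).det ≠ 0) :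
    (bil N u ((p - C a) * E) (Z * bar E)).det
      = (-1) ^ N * ((bil N u E (bar E)).det * (1 - br N p₀ p u E Z 1)) := by
  have q1 : bar p * Z = 1 - C a * Z := by rw [← hZ]; ring
  have h1 : bil N u ((p - C a) * E) (Z * bar E) = -(bil N u E (bar E)
      - vecMulVec (col N ((p + C (conj p₀)) * (1 * E)))
        ((p₀ + conj p₀)⁻¹ • col N ((bar p + C p₀) * (Z * bar E)))) := by
    rw [← h.sylvester_mul, q1]
    simp only [sub_mul, one_mul, mul_one, ← smul_eq_C_mul, map_sub, map_smul,
      LinearMap.sub_apply, LinearMap.smul_apply, smul_mul_assoc]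
    module
  rw [h1, det_neg, Fintype.card_fin, det_sub_vecMulVec h0, br]

theorem div_norm_eq_one (hre : p₀.re ≠ 0) (k : ℝ) :
    ‖-((conj p₀ + Complex.I * k) / (p₀ - Complex.I * k))‖ = 1 := by
  have h : conj p₀ + Complex.I * k = conj (p₀ - Complex.I * k) := by simp
  rw [norm_neg, norm_div, h, Complex.norm_conj, div_self]
  exact norm_ne_zero_iff.2 (sub_I_mul_ne hre k)

theorem bil_C_mul (N : ℕ) (u A B : ℂ⟦X⟧) (c d : ℂ) :
    bil N u (C c * A) (C d * B) = (c * d) • bil N u A B := by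
  rw [← smul_eq_C_mul, ← smul_eq_C_mul, map_smul, map_smul, LinearMap.smul_apply, smul_smul]
  ring_nf

/-- Raising one of the indices n, k by one multiplies E by (p - ik)/(p₀ - ik) and Ē by (p₀* +
ik)/(p̄ + ik), with k here the matching wave number. The constants collect into a unimodular number
to the power N, invisible in |A| and |B|. -/
theorem tau_shift_aux (hre : p₀.re ≠ 0) (hroot : IsSimpleRoot P p₀) (hp : IsBranchP P p₀ pκ)
    (a : ℕ → ℂ) (N : ℕ) (k : ℝ) (x t : ℝ) :
    (bil N (uSer p₀ pκ) (flow P p₀ pκ a x t * expSer (theta p₀ pκ k))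
      (bar (flow P p₀ pκ a x t) * expSer (fun r => -conj (theta p₀ pκ k r)))).det
      = (-((conj p₀ + Complex.I * k) / (p₀ - Complex.I * k))) ^ N * (tauSchur P p₀ pκ a N 0 0 x t
        * (1 - br N p₀ (tps pκ) (uSer p₀ pκ) (flow P p₀ pκ a x t) (invSer pκ k) 1)) := by
  have h1 := sub_I_mul_ne hre k
  have e1 : flow P p₀ pκ a x t * expSer (theta p₀ pκ k)
      = C (p₀ - Complex.I * k)⁻¹ * ((tps pκ - C (Complex.I * k)) * flow P p₀ pκ a x t) := by
    rw [← expSer_theta hre hp k]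
    have : C (p₀ - Complex.I * k)⁻¹ * C (p₀ - Complex.I * k) = (1 : ℂ⟦X⟧) := by
      rw [← map_mul, inv_mul_cancel₀ h1, map_one]
    calc _ = (C (p₀ - Complex.I * k)⁻¹ * C (p₀ - Complex.I * k)) *
        (flow P p₀ pκ a x t * expSer (theta p₀ pκ k)) := by rw [this, one_mul]
      _ = _ := by ring
  have e2 : bar (flow P p₀ pκ a x t) * expSer (fun r => -conj (theta p₀ pκ k r))
      = C (conj p₀ + Complex.I * k) * (invSer pκ k * bar (flow P p₀ pκ a x t)) := by
    rw [expSer_neg_eq (expSer_conj_theta hre hp k) (mul_invSer hre hp k)]; ring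
  rw [e1, e2, bil_C_mul, det_smul, Fintype.card_fin,
    det_bil_shift (uniformizer hre hroot hp) (mul_invSer hre hp k)
      ((flow_isFlow hre hroot hp a N).det_ne x t), tauSchur_eq, expSer_xMinus_zero, ← flow,
    neg_pow (_ / _), div_eq_inv_mul]
  ring

theorem tauSchur_one_zero (hre : p₀.re ≠ 0) (hroot : IsSimpleRoot P p₀) (hp : IsBranchP P p₀ pκ)
    (a : ℕ → ℂ) (N : ℕ) (x t : ℝ) : tauSchur P p₀ pκ a N 1 0 x t
      = (-((conj p₀ + Complex.I * P.k₁) / (p₀ - Complex.I * P.k₁))) ^ N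
        * (tauSchur P p₀ pκ a N 0 0 x t
          * (1 - br N p₀ (tps pκ) (uSer p₀ pκ) (flow P p₀ pκ a x t) (invSer pκ P.k₁) 1)) := by
  have e1 : xPlus P p₀ pκ a 1 0 x t
      = fun r => xPlus P p₀ pκ a 0 0 x t r + theta p₀ pκ P.k₁ r := by
    funext r; simp only [xPlus]; push_cast; ring
  have e2 : xMinus P p₀ pκ a 1 0 x t
      = fun r => xMinus P p₀ pκ a 0 0 x t r + -conj (theta p₀ pκ P.k₁ r) := by
    funext r; simp only [xMinus]; push_cast; ring
  rw [← tau_shift_aux hre hroot hp, tauSchur_eq, ← expSer_xMinus_zero, flow, ← expSer_add,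
    ← expSer_add, e1, e2]

theorem tauSchur_zero_one (hre : p₀.re ≠ 0) (hroot : IsSimpleRoot P p₀) (hp : IsBranchP P p₀ pκ)
    (a : ℕ → ℂ) (N : ℕ) (x t : ℝ) : tauSchur P p₀ pκ a N 0 1 x t
      = (-((conj p₀ + Complex.I * P.k₂) / (p₀ - Complex.I * P.k₂))) ^ N
        * (tauSchur P p₀ pκ a N 0 0 x t
          * (1 - br N p₀ (tps pκ) (uSer p₀ pκ) (flow P p₀ pκ a x t) (invSer pκ P.k₂) 1)) := by
  have e1 : xPlus P p₀ pκ a 0 1 x t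
      = fun r => xPlus P p₀ pκ a 0 0 x t r + theta p₀ pκ P.k₂ r := by
    funext r; simp only [xPlus]; push_cast; ring
  have e2 : xMinus P p₀ pκ a 0 1 x t
      = fun r => xMinus P p₀ pκ a 0 0 x t r + -conj (theta p₀ pκ P.k₂ r) := by
    funext r; simp only [xMinus]; push_cast; ring
  rw [← tau_shift_aux hre hroot hp, tauSchur_eq, ← expSer_xMinus_zero, flow, ← expSer_add,
    ← expSer_add, e1, e2]

end LSRI

namespace LSRI

/-! ### Polynomial functions of `(x, t)` -/

/-- `f` is a polynomial in `x` and `t` with complex coefficients. -/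
def IsPolyFun (f : ℝ → ℝ → ℂ) : Prop :=
  ∃ R : MvPolynomial (Fin 2) ℂ, ∀ x t : ℝ, f x t = MvPolynomial.eval ![(x : ℂ), (t : ℂ)] R

namespace IsPolyFun

theorem const (c : ℂ) : IsPolyFun fun _ _ => c := ⟨MvPolynomial.C c, by simp⟩

theorem fst : IsPolyFun fun x _ => (x : ℂ) := ⟨MvPolynomial.X 0, by simp⟩

theorem snd : IsPolyFun fun _ t => (t : ℂ) := ⟨MvPolynomial.X 1, by simp⟩

theorem add {f g : ℝ → ℝ → ℂ} (hf : IsPolyFun f) (hg : IsPolyFun g) :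
    IsPolyFun fun x t => f x t + g x t := by
  obtain ⟨R, hR⟩ := hf
  obtain ⟨S, hS⟩ := hg
  exact ⟨R + S, fun x t => by simp only [hR, hS, map_add]⟩

theorem mul {f g : ℝ → ℝ → ℂ} (hf : IsPolyFun f) (hg : IsPolyFun g) :
    IsPolyFun fun x t => f x t * g x t := by
  obtain ⟨R, hR⟩ := hf
  obtain ⟨S, hS⟩ := hg
  exact ⟨R * S, fun x t => by simp only [hR, hS, map_mul]⟩

theorem sum {ι : Type*} (s : Finset ι) {f : ι → ℝ → ℝ → ℂ} (hf : ∀ i ∈ s, IsPolyFun (f i)) :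
    IsPolyFun fun x t => ∑ i ∈ s, f i x t := by
  classical
  induction s using Finset.induction_on with
  | empty => simpa using const 0
  | insert i s hi ih =>
    simp only [Finset.sum_insert hi]
    exact (hf i (Finset.mem_insert_self i s)).add
      (ih fun k hk => hf k (Finset.mem_insert_of_mem hk))

theorem prod {ι : Type*} (s : Finset ι) {f : ι → ℝ → ℝ → ℂ} (hf : ∀ i ∈ s, IsPolyFun (f i)) :
    IsPolyFun fun x t => ∏ i ∈ s, f i x t := by
  classical
  induction s using Finset.induction_on with
  | empty => simpa using const 1
  | insert i s hi ih =>
    simp only [Finset.prod_insert hi]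
    exact (hf i (Finset.mem_insert_self i s)).mul
      (ih fun k hk => hf k (Finset.mem_insert_of_mem hk))

theorem det {N : ℕ} {M : ℝ → ℝ → Matrix (Fin N) (Fin N) ℂ}
    (hM : ∀ i j, IsPolyFun fun x t => M x t i j) : IsPolyFun fun x t => (M x t).det := by
  simp only [Matrix.det_apply']
  exact sum _ fun σ _ => (const _).mul (prod _ fun i _ => hM _ _)

theorem schur {y : ℝ → ℝ → ℕ → ℂ} (hy : ∀ r, IsPolyFun fun x t => y x t r) (j : ℕ) :
    IsPolyFun fun x t => LSRI.schur j (y x t) := by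
  simp only [schur_eq_coeff]
  induction j using Nat.strong_induction_on with
  | _ j ih =>
    cases j with
    | zero =>
      simp only [PowerSeries.coeff_zero_eq_constantCoeff_apply, constantCoeff_expSer]
      exact const 1
    | succ j =>
      have hj : ((j : ℂ) + 1) ≠ 0 := by exact_mod_cast Nat.succ_ne_zero j
      have h1 : ∀ x t, PowerSeries.coeff (j + 1) (expSer (y x t)) = ((j : ℂ) + 1)⁻¹ *
          ∑ r ∈ Finset.range (j + 1), ((r : ℂ) + 1) * y x t (r + 1)
            * PowerSeries.coeff (j - r) (expSer (y x t)) := by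
        intro x t
        rw [← coeff_expSer_succ, inv_mul_cancel_left₀ hj]
      simp only [h1]
      exact (const _).mul (sum _ fun r _ => ((const _).mul (hy _)).mul (ih _ (by omega)))

end IsPolyFun

theorem isPolyFun_tauSchur (P : Params) (p₀ : ℂ) (pκ : ℂ → ℂ) (a : ℕ → ℂ) (N : ℕ) (n k : ℤ) :
    IsPolyFun (tauSchur P p₀ pκ a N n k) := by
  have hp : ∀ (ν r : ℕ), IsPolyFun fun x t =>
      xPlus P p₀ pκ a n k x t r + ν * sCoeff p₀ pκ r := by
    intro ν r
    obtain ⟨R, hR⟩ := ((((IsPolyFun.const (lam p₀ pκ r)).mul .fst).add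
      ((IsPolyFun.const (-Complex.I * beta p₀ pκ r)).mul .snd)).add
      (.const (n * theta p₀ pκ P.k₁ r + k * theta p₀ pκ P.k₂ r + a r + ν * sCoeff p₀ pκ r)))
    exact ⟨R, fun x t => by rw [← hR]; simp only [xPlus]; ring⟩
  have hm : ∀ (ν r : ℕ), IsPolyFun fun x t =>
      xMinus P p₀ pκ a n k x t r + ν * conj (sCoeff p₀ pκ r) := by
    intro ν r
    obtain ⟨R, hR⟩ := ((((IsPolyFun.const (conj (lam p₀ pκ r))).mul .fst).add
      ((IsPolyFun.const (Complex.I * conj (beta p₀ pκ r))).mul .snd)).add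
      (.const (- n * conj (theta p₀ pκ P.k₁ r) - k * conj (theta p₀ pκ P.k₂ r) + conj (a r)
        + ν * conj (sCoeff p₀ pκ r))))
    exact ⟨R, fun x t => by rw [← hR]; simp only [xMinus]; ring⟩
  refine IsPolyFun.det fun i j => ?_
  simp only [Matrix.of_apply, entrySchur]
  refine IsPolyFun.sum _ fun ν _ => ?_
  exact ((IsPolyFun.const _).mul (IsPolyFun.schur (hp ν) _)).mul (IsPolyFun.schur (hm ν) _)

/-- A complex polynomial taking real values at real points has real coefficients there. -/
theorem IsPolyFun.exists_real {f : ℝ → ℝ → ℂ} (hf : IsPolyFun f) (him : ∀ x t, (f x t).im = 0) :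
    ∃ F : MvPolynomial (Fin 2) ℝ, ∀ x t, f x t = ((MvPolynomial.eval ![x, t] F : ℝ) : ℂ) := by
  have key : ∀ R : MvPolynomial (Fin 2) ℂ, ∃ A B : MvPolynomial (Fin 2) ℝ, ∀ x t : ℝ,
      MvPolynomial.eval ![(x : ℂ), (t : ℂ)] R
        = (⟨MvPolynomial.eval ![x, t] A, MvPolynomial.eval ![x, t] B⟩ : ℂ) := by
    intro R
    induction R using MvPolynomial.induction_on with
    | C c => exact ⟨.C c.re, .C c.im, fun x t => by simp⟩
    | add R S hR hS =>
      obtain ⟨A, B, h⟩ := hR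
      obtain ⟨A', B', h'⟩ := hS
      exact ⟨A + A', B + B', fun x t => by rw [map_add, h, h']; apply Complex.ext <;> simp⟩
    | mul_X R i hR =>
      obtain ⟨A, B, h⟩ := hR
      refine ⟨A * .X i, B * .X i, fun x t => ?_⟩
      rw [map_mul, h]
      fin_cases i <;> apply Complex.ext <;> simp
  obtain ⟨R, hR⟩ := hf
  obtain ⟨A, B, h⟩ := key R
  refine ⟨A, fun x t => ?_⟩
  have h1 := him x t
  rw [hR, h] at h1 ⊢
  apply Complex.ext
  · simp
  · simpa using h1

/-! ### Calculus of real polynomials -/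

/-- The value of a real polynomial at `(x, t)`. -/
noncomputable def ev (F : MvPolynomial (Fin 2) ℝ) (x t : ℝ) : ℝ := MvPolynomial.eval ![x, t] F

theorem hasDerivAt_ev_x (F : MvPolynomial (Fin 2) ℝ) (x t : ℝ) :
    HasDerivAt (fun x => ev F x t) (ev (MvPolynomial.pderiv 0 F) x t) x := by
  simp only [ev]
  induction F using MvPolynomial.induction_on with
  | C c => simpa using hasDerivAt_const x c
  | add R S hR hS => simpa using! hR.add hS
  | mul_X R i hR =>
    have hX : HasDerivAt (fun x : ℝ => (![x, t] : Fin 2 → ℝ) i) (if i = 0 then 1 else 0) x := by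
      fin_cases i
      · simpa using hasDerivAt_id' x
      · simpa using hasDerivAt_const x t
    simp only [map_mul, MvPolynomial.eval_X, Derivation.leibniz, MvPolynomial.pderiv_X, smul_eq_mul,
      map_add]
    refine (hR.fun_mul hX).congr_deriv ?_
    fin_cases i <;> simp [mul_comm, add_comm]

theorem hasDerivAt_ev_t (F : MvPolynomial (Fin 2) ℝ) (x t : ℝ) :
    HasDerivAt (fun t => ev F x t) (ev (MvPolynomial.pderiv 1 F) x t) t := by
  simp only [ev]
  induction F using MvPolynomial.induction_on with
  | C c => simpa using hasDerivAt_const t c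
  | add R S hR hS => simpa using! hR.add hS
  | mul_X R i hR =>
    have hX : HasDerivAt (fun t : ℝ => (![x, t] : Fin 2 → ℝ) i) (if i = 1 then 1 else 0) t := by
      fin_cases i
      · simpa using hasDerivAt_const t x
      · simpa using hasDerivAt_id' t
    simp only [map_mul, MvPolynomial.eval_X, Derivation.leibniz, MvPolynomial.pderiv_X, smul_eq_mul,
      map_add]
    refine (hR.fun_mul hX).congr_deriv ?_
    fin_cases i <;> simp [mul_comm, add_comm]

theorem pderiv_comm (F : MvPolynomial (Fin 2) ℝ) (i j : Fin 2) :
    MvPolynomial.pderiv i (MvPolynomial.pderiv j F)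
      = MvPolynomial.pderiv j (MvPolynomial.pderiv i F) := by
  induction F using MvPolynomial.induction_on with
  | C c => simp
  | add R S hR hS => simp [hR, hS]
  | mul_X R k hR =>
    have h : ∀ i j : Fin 2, MvPolynomial.pderiv i
        (Pi.single (M := fun _ => MvPolynomial (Fin 2) ℝ) j 1 k) = 0 := by
      intro i j
      rw [Pi.single_apply]
      split_ifs <;> simp
    simp only [Derivation.leibniz, MvPolynomial.pderiv_X, smul_eq_mul, map_add, hR, h]
    ring

theorem contDiff_ev (F : MvPolynomial (Fin 2) ℝ) {n : WithTop ℕ∞} :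
    ContDiff ℝ n (fun z : ℝ × ℝ => ev F z.1 z.2) := by
  simp only [ev]
  induction F using MvPolynomial.induction_on with
  | C c => simpa using contDiff_const
  | add R S hR hS => simpa using! hR.add hS
  | mul_X R i hR =>
    simp only [map_mul, MvPolynomial.eval_X]
    refine hR.mul ?_
    fin_cases i
    · exact contDiff_fst
    · exact contDiff_snd

theorem IsPolyFun.contDiff {f : ℝ → ℝ → ℂ} (hf : IsPolyFun f) {n : WithTop ℕ∞} :
    ContDiff ℝ n (fun z : ℝ × ℝ => f z.1 z.2) := by
  obtain ⟨R, hR⟩ := hf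
  simp only [hR]
  clear hR
  induction R using MvPolynomial.induction_on with
  | C c => simpa using contDiff_const
  | add R S hR hS => simpa using! hR.add hS
  | mul_X R i hR =>
    simp only [map_mul, MvPolynomial.eval_X]
    refine hR.mul ?_
    fin_cases i
    · exact Complex.ofRealCLM.contDiff.comp contDiff_fst
    · exact Complex.ofRealCLM.contDiff.comp contDiff_snd

/-- The second logarithmic derivative in `x`. -/
theorem iteratedDeriv_log_ev {F : MvPolynomial (Fin 2) ℝ} (hF : ∀ x t, ev F x t ≠ 0) (x t : ℝ) :
    iteratedDeriv 2 (fun x => Real.log (ev F x t)) x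
      = (ev (MvPolynomial.pderiv 0 (MvPolynomial.pderiv 0 F)) x t * ev F x t
        - ev (MvPolynomial.pderiv 0 F) x t * ev (MvPolynomial.pderiv 0 F) x t) / ev F x t ^ 2 := by
  rw [iteratedDeriv_succ, iteratedDeriv_one]
  have h1 : deriv (fun x => Real.log (ev F x t))
      = fun x => ev (MvPolynomial.pderiv 0 F) x t / ev F x t := by
    funext x
    exact ((hasDerivAt_ev_x F x t).log (hF x t)).deriv
  rw [h1]
  exact ((hasDerivAt_ev_x _ x t).fun_div (hasDerivAt_ev_x F x t) (hF x t)).deriv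

end LSRI

namespace LSRI

/-! ### The tau functions solve the system -/

theorem hasDerivAt_planeWave_x (ρ k γ x t : ℝ) :
    HasDerivAt (fun x => planeWave ρ k γ x t) (Complex.I * k * planeWave ρ k γ x t) x := by
  have h : HasDerivAt (fun x : ℝ => Complex.I * ((k : ℂ) * x + ((γ : ℂ) + (k : ℂ) ^ 2) * t))
      (Complex.I * (k * 1)) x :=
    (((Complex.ofRealCLM.hasDerivAt (x := x)).const_mul (k : ℂ)).add_const _).const_mul _
  refine (h.cexp.const_mul (ρ : ℂ)).congr_deriv ?_
  rw [planeWave]; ring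

theorem hasDerivAt_planeWave_t (ρ k γ x t : ℝ) :
    HasDerivAt (fun t => planeWave ρ k γ x t)
      (Complex.I * (γ + k ^ 2) * planeWave ρ k γ x t) t := by
  have h : HasDerivAt (fun t : ℝ => Complex.I * ((k : ℂ) * x + ((γ : ℂ) + (k : ℂ) ^ 2) * t))
      (Complex.I * (((γ : ℂ) + (k : ℂ) ^ 2) * 1)) t :=
    (((Complex.ofRealCLM.hasDerivAt (x := t)).const_mul _).const_add _).const_mul _
  refine (h.cexp.const_mul (ρ : ℂ)).congr_deriv ?_
  rw [planeWave]; ring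

theorem contDiff_planeWave (ρ k γ : ℝ) {n : WithTop ℕ∞} :
    ContDiff ℝ n (fun z : ℝ × ℝ => planeWave ρ k γ z.1 z.2) := by
  have h1 : ContDiff ℝ n (fun z : ℝ × ℝ => (z.1 : ℂ)) :=
    Complex.ofRealCLM.contDiff.comp contDiff_fst
  have h2 : ContDiff ℝ n (fun z : ℝ × ℝ => (z.2 : ℂ)) :=
    Complex.ofRealCLM.contDiff.comp contDiff_snd
  unfold planeWave
  exact contDiff_const.mul (contDiff_const.mul ((contDiff_const.mul h1).add
    (contDiff_const.mul h2))).cexp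

theorem norm_planeWave (ρ k γ x t : ℝ) : ‖planeWave ρ k γ x t‖ = |ρ| := by
  have : Complex.I * ((k : ℂ) * x + ((γ : ℂ) + (k : ℂ) ^ 2) * t)
      = ((k * x + (γ + k ^ 2) * t : ℝ) : ℂ) * Complex.I := by push_cast; ring
  rw [planeWave, this, norm_mul, Complex.norm_exp_ofReal_mul_I, mul_one, Complex.norm_real,
    Real.norm_eq_abs]

/-- The plane wave absorbs the background: its frequency γ + k² cancels the terms without
derivatives, and its wave number produces the first-order term 2ikG_x. -/
theorem schroedinger_planeWave {ρ k γ : ℝ} {c : ℂ} {G G₁ G₂ G₃ v : ℝ → ℝ → ℂ} {A : ℝ → ℝ → ℂ}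
    {L : ℝ → ℝ → ℝ} (hA : ∀ x t, A x t = planeWave ρ k γ x t * (c * G x t))
    (hL : ∀ x t, (L x t : ℂ) = γ - 2 * v x t)
    (h1 : ∀ x t, HasDerivAt (fun x => G x t) (G₁ x t) x)
    (h2 : ∀ x t, HasDerivAt (fun x => G₁ x t) (G₂ x t) x)
    (h3 : ∀ x t, HasDerivAt (fun t => G x t) (G₃ x t) t)
    (h : ∀ x t, Complex.I * G₃ x t - 2 * (Complex.I * k) * G₁ x t - G₂ x t
      - 2 * v x t * G x t = 0) (x t : ℝ) :
    Complex.I * deriv (fun t' => A x t') t - iteratedDeriv 2 (fun x' => A x' t) x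
      + (L x t : ℂ) * A x t = 0 := by
  have d3 : deriv (fun t' => A x t') t = planeWave ρ k γ x t * c *
      (Complex.I * (γ + k ^ 2) * G x t + G₃ x t) := by
    simp only [hA]
    rw [((hasDerivAt_planeWave_t ρ k γ x t).fun_mul ((h3 x t).const_mul c)).deriv]
    ring
  have d1 : ∀ x, HasDerivAt (fun x' => A x' t) (planeWave ρ k γ x t *
      (c * (Complex.I * k * G x t + G₁ x t))) x := by
    intro x
    simp only [hA]
    refine ((hasDerivAt_planeWave_x ρ k γ x t).fun_mul ((h1 x t).const_mul c)).congr_deriv ?_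
    ring
  have d2 : iteratedDeriv 2 (fun x' => A x' t) x = planeWave ρ k γ x t * c *
      (Complex.I * k * (Complex.I * k * G x t + G₁ x t)
        + (Complex.I * k * G₁ x t + G₂ x t)) := by
    rw [iteratedDeriv_succ, iteratedDeriv_one, funext fun x => (d1 x).deriv]
    rw [((hasDerivAt_planeWave_x ρ k γ x t).fun_mul ((((h1 x t).const_mul (Complex.I * k)).fun_add
      (h2 x t)).const_mul c)).deriv]
    ring
  rw [d3, d2, hL, hA]
  linear_combination planeWave ρ k γ x t * c * h x t
    + planeWave ρ k γ x t * c * G x t * γ * Complex.I_sq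

variable {P : Params} {p₀ : ℂ} {pκ : ℂ → ℂ}

theorem contDiff_quotient {F : MvPolynomial (Fin 2) ℝ} (hF : ∀ x t, 0 < ev F x t)
    {g : ℝ → ℝ → ℂ} (hg : IsPolyFun g) (ρ k γ : ℝ) {n : WithTop ℕ∞} :
    ContDiff ℝ n (fun z : ℝ × ℝ => planeWave ρ k γ z.1 z.2 * (g z.1 z.2 / (ev F z.1 z.2 : ℂ))) := by
  have h1 : ContDiff ℝ n (fun z : ℝ × ℝ => (ev F z.1 z.2 : ℂ)) :=
    Complex.ofRealCLM.contDiff.comp (contDiff_ev F)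
  simp only [div_eq_mul_inv]
  refine (contDiff_planeWave ρ k γ).mul (hg.contDiff.mul (h1.inv fun z => ?_))
  exact_mod_cast (hF z.1 z.2).ne'

open scoped ComplexOrder in
-- With v = f_x/f + const, L = γ - 2v_x enters the two Schrödinger equations, and the formula for
-- v_t makes δ₁|A|² + δ₂|B|² a constant minus (f_x/f)_t. The third equation is then equality of
-- mixed derivatives of log f.
theorem tauSolves_tauSchur (hre : p₀.re ≠ 0) (hroot : IsSimpleRoot P p₀) (hp : IsBranchP P p₀ pκ)
    (a : ℕ → ℂ) (N : ℕ) : TauSolves P (tauSchur P p₀ pκ a N) := by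
  have hpos := tauSchur_zero_pos hre hroot hp a N
  have hu := uniformizer hre hroot hp
  have hflow := flow_isFlow (P := P) hre hroot hp a N
  set τ := tauSchur P p₀ pκ a N with hτ
  have him : ∀ x t, (τ 0 0 x t).im = 0 := fun x t => (Complex.pos_iff.1 (hpos x t)).2.symm
  have hne : ∀ x t, τ 0 0 x t ≠ 0 := fun x t => (hpos x t).ne'
  obtain ⟨F, hF⟩ : ∃ F, ∀ x t, τ 0 0 x t = (ev F x t : ℂ) :=
    (isPolyFun_tauSchur P p₀ pκ a N 0 0).exists_real him
  have hFpos : ∀ x t, 0 < ev F x t := fun x t => by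
    have := (Complex.pos_iff.1 (hpos x t)).1
    rwa [hF, Complex.ofReal_re] at this
  have hFne : ∀ x t, ev F x t ≠ 0 := fun x t => (hFpos x t).ne'
  set Fx := MvPolynomial.pderiv 0 F with hFx
  set Ft := MvPolynomial.pderiv 1 F with hFt
  set Fxx := MvPolynomial.pderiv 0 Fx with hFxx
  set Fxt := MvPolynomial.pderiv 1 Fx with hFxt
  set b : ℝ → ℝ → PowerSeries ℂ → PowerSeries ℂ → ℂ := fun x t B A =>
    br N p₀ (tps pκ) (uSer p₀ pκ) (flow P p₀ pκ a x t) B A with hb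
  have hV : ∀ x t, b x t 1 1 = ((ev Fx x t / ev F x t : ℝ) : ℂ) + N * (p₀ + conj p₀) := by
    intro x t
    have h1 := hflow.det_x hu x t
    have h2 := (hasDerivAt_ev_x F x t).ofReal_comp
    have h3 : ∀ x, ((bil N (uSer p₀ pκ) (flow P p₀ pκ a x t)) (bar (flow P p₀ pκ a x t))).det
        = (ev F x t : ℂ) := by
      intro x; rw [← hF, hτ, tauSchur_eq, expSer_xMinus_zero, ← flow]
    simp only [h3] at h1
    have h4 := h1.unique h2
    have h5 : (ev F x t : ℂ) ≠ 0 := by exact_mod_cast hFne x t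
    push_cast
    rw [← hFx] at h4
    rw [← h4]
    field_simp
    ring
  obtain ⟨G₁, G₂, G₃, v₁, hG₁, hG₂, hG₃, hv₁, hG⟩ := hflow.exists_schroedinger hu
    (mul_invSer hre hp P.k₁)
  obtain ⟨H₁, H₂, H₃, v₁', hH₁, hH₂, hH₃, hv₁', hH⟩ := hflow.exists_schroedinger hu
    (mul_invSer hre hp P.k₂)
  have hvx : ∀ x t, HasDerivAt (fun x => b x t 1 1)
      (((ev Fxx x t * ev F x t - ev Fx x t * ev Fx x t) / ev F x t ^ 2 : ℝ) : ℂ) x := by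
    intro x t
    simp only [hV]
    exact (((hasDerivAt_ev_x Fx x t).fun_div (hasDerivAt_ev_x F x t) (hFne x t)).ofReal_comp).add_const _
  have hvt : ∀ x t, HasDerivAt (fun t => b x t 1 1)
      (((ev Fxt x t * ev F x t - ev Fx x t * ev Ft x t) / ev F x t ^ 2 : ℝ) : ℂ) t := by
    intro x t
    simp only [hV]
    exact (((hasDerivAt_ev_t Fx x t).fun_div (hasDerivAt_ev_t F x t) (hFne x t)).ofReal_comp).add_const _
  have hLr : ∀ x t, fieldL P τ x t = P.γ - 2 * ((ev Fxx x t * ev F x t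
      - ev Fx x t * ev Fx x t) / ev F x t ^ 2) := by
    intro x t
    rw [fieldL]
    simp only [hF, Complex.ofReal_re]
    rw [iteratedDeriv_log_ev hFne]
  have hL : ∀ x t, (fieldL P τ x t : ℂ) = P.γ - 2 * v₁ x t := by
    intro x t
    rw [hLr, (hv₁ x t).unique (hvx x t)]
    push_cast; ring
  have hL' : ∀ x t, (fieldL P τ x t : ℂ) = P.γ - 2 * v₁' x t := by
    intro x t
    rw [hLr, (hv₁' x t).unique (hvx x t)]
    push_cast; ring
  have hA : ∀ x t, fieldA P τ x t = planeWave P.ρ₁ P.k₁ P.γ x t *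
      ((-((conj p₀ + Complex.I * P.k₁) / (p₀ - Complex.I * P.k₁))) ^ N
        * (1 - b x t (invSer pκ P.k₁) 1)) := by
    intro x t
    have h := tauSchur_one_zero (P := P) hre hroot hp a N x t
    rw [← hτ] at h
    rw [fieldA, h, mul_left_comm, mul_div_cancel_left₀ _ (hne x t)]
  have hB : ∀ x t, fieldB P τ x t = planeWave P.ρ₂ P.k₂ P.γ x t *
      ((-((conj p₀ + Complex.I * P.k₂) / (p₀ - Complex.I * P.k₂))) ^ N
        * (1 - b x t (invSer pκ P.k₂) 1)) := by
    intro x t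
    have h := tauSchur_zero_one (P := P) hre hroot hp a N x t
    rw [← hτ] at h
    rw [fieldB, h, mul_left_comm, mul_div_cancel_left₀ _ (hne x t)]
  have hconj : ∀ x t k, ((‖1 - b x t (invSer pκ k) 1‖ ^ 2 : ℝ) : ℂ)
      = (1 - b x t (invSer pκ k) 1) * (1 - b x t 1 (bar (invSer pκ k))) := by
    intro x t k
    rw [← Complex.normSq_eq_norm_sq, ← Complex.mul_conj, map_sub, map_one, hb]
    simp only
    rw [conj_br, map_one]
  have hnorm : ∀ x t, P.δ₁ * ‖fieldA P τ x t‖ ^ 2 + P.δ₂ * ‖fieldB P τ x t‖ ^ 2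
      = P.δ₁ * P.ρ₁ ^ 2 + P.δ₂ * P.ρ₂ ^ 2
        - (ev Fxt x t * ev F x t - ev Fx x t * ev Ft x t) / ev F x t ^ 2 := by
    intro x t
    have h1 := hflow.br_one_one_t hu (c₁ := P.δ₁ * P.ρ₁ ^ 2) (c₂ := P.δ₂ * P.ρ₂ ^ 2)
      (a₁ := Complex.I * P.k₁) (a₂ := Complex.I * P.k₂) (by simp) (by simp)
      (mul_invSer hre hp P.k₁) (mul_invSer hre hp P.k₂) (coeff_odd_Q hre hp) x t
    have h2 := h1.unique (hvt x t)
    rw [hA, hB]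
    simp only [norm_mul, norm_pow, norm_planeWave, div_norm_eq_one hre, one_pow, one_mul, mul_pow,
      sq_abs]
    have e1 := hconj x t P.k₁
    have e2 := hconj x t P.k₂
    simp only [hb] at e1 e2
    rw [← e1, ← e2] at h2
    simp only [hb]
    rw [← Complex.ofReal_inj]
    push_cast at h2 ⊢
    linear_combination -h2
  refine ⟨him, hne, ?_, ?_, ?_, ?_, ?_, ?_⟩
  · unfold fieldA
    simp only [hF]
    exact contDiff_quotient hFpos (isPolyFun_tauSchur P p₀ pκ a N 1 0) _ _ _
  · unfold fieldB
    simp only [hF]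
    exact contDiff_quotient hFpos (isPolyFun_tauSchur P p₀ pκ a N 0 1) _ _ _
  · simp only [hLr]
    exact contDiff_const.sub (contDiff_const.mul ((((contDiff_ev _).mul (contDiff_ev _)).sub
      ((contDiff_ev _).mul (contDiff_ev _))).div ((contDiff_ev _).pow 2)
        fun z => pow_ne_zero 2 (hFne _ _)))
  · exact schroedinger_planeWave hA hL hG₁ hG₂ hG₃ hG
  · exact schroedinger_planeWave hB hL' hH₁ hH₂ hH₃ hH
  · intro x t
    simp only [hnorm, hLr]
    have d1 := (((((hasDerivAt_ev_t Fxx x t).fun_mul (hasDerivAt_ev_t F x t)).fun_sub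
      ((hasDerivAt_ev_t Fx x t).fun_mul (hasDerivAt_ev_t Fx x t))).fun_div
        ((hasDerivAt_ev_t F x t).fun_pow 2) (pow_ne_zero 2 (hFne x t))).const_mul 2).const_sub P.γ
    have d2 := ((((hasDerivAt_ev_x Fxt x t).fun_mul (hasDerivAt_ev_x F x t)).fun_sub
      ((hasDerivAt_ev_x Fx x t).fun_mul (hasDerivAt_ev_x Ft x t))).fun_div
        ((hasDerivAt_ev_x F x t).fun_pow 2) (pow_ne_zero 2 (hFne x t))).const_sub
          (P.δ₁ * P.ρ₁ ^ 2 + P.δ₂ * P.ρ₂ ^ 2)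
    rw [d1.deriv, d2.deriv]
    have c1 : MvPolynomial.pderiv 0 Fxt = MvPolynomial.pderiv 1 Fxx := pderiv_comm _ _ _
    have c2 : MvPolynomial.pderiv 0 Ft = Fxt := pderiv_comm _ _ _
    rw [c1, c2, ← hFx, ← hFt, ← hFxx, ← hFxt]
    have := hFne x t
    field_simp
    ring

end LSRI

/-! ### Far-field asymptotics of the tau functions -/

namespace LSRI

open Matrix in
/-- Leading behaviour of the determinant of a matrix product `a diag(1, ε, ε², …) bᵀ` as
`ε → 0`. -/
theorem exists_tendsto_det_sum {ι : Type*} {l : Filter ι} {N : ℕ} {a b : ι → Fin N → ℕ → ℂ}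
    {a₀ b₀ : Fin N → ℕ → ℂ} {ε : ι → ℂ} (hε : Tendsto ε l (𝓝 0))
    (ha : ∀ s ν, Tendsto (fun z => a z s ν) l (𝓝 (a₀ s ν)))
    (hb : ∀ s ν, Tendsto (fun z => b z s ν) l (𝓝 (b₀ s ν)))
    (hA : (of fun s ν : Fin N => a₀ s ν).det ≠ 0) (hB : (of fun s ν : Fin N => b₀ s ν).det ≠ 0) :
    ∃ φ : ι → ℂ, Tendsto φ l
        (𝓝 ((of fun s ν : Fin N => a₀ s ν).det * (of fun s ν : Fin N => b₀ s ν).det)) ∧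
      ∀ᶠ z in l, (of fun s j : Fin N => ∑ ν ∈ Finset.range (2 * N),
        ε z ^ ν * a z s ν * b z j ν).det = ε z ^ (∑ ν : Fin N, (ν : ℕ)) * φ z := by
  set A : ι → Matrix (Fin N) (Fin N) ℂ := fun z => of fun s ν => a z s ν with hAdef
  set B : ι → Matrix (Fin N) (Fin N) ℂ := fun z => of fun s ν => b z s ν with hBdef
  set R : ι → Matrix (Fin N) (Fin N) ℂ := fun z => of fun s j => ∑ ν ∈ Finset.range N,
    ε z ^ ν * a z s (N + ν) * b z j (N + ν) with hRdef
  -- The terms with ν ≥ N form ε^N R. As diag(ε^ν) D = ε^N, the retained factor diag(ε^ν) can be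
  -- extracted from them too, and what remains is multiplied by D, which tends to 0.
  set D : ι → Matrix (Fin N) (Fin N) ℂ := fun z => diagonal fun ν => ε z ^ (N - (ν : ℕ)) with hDdef
  have tA : Tendsto A l (𝓝 (of fun s ν : Fin N => a₀ s ν)) :=
    tendsto_pi_nhds.2 fun s => tendsto_pi_nhds.2 fun ν => ha s ν
  have tB : Tendsto B l (𝓝 (of fun s ν : Fin N => b₀ s ν)) :=
    tendsto_pi_nhds.2 fun s => tendsto_pi_nhds.2 fun ν => hb s ν
  have tR : Tendsto R l (𝓝 (of fun s j => ∑ ν ∈ Finset.range N,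
      0 ^ ν * a₀ s (N + ν) * b₀ j (N + ν))) :=
    tendsto_pi_nhds.2 fun s => tendsto_pi_nhds.2 fun j => by
      simp only [hRdef, of_apply]
      exact tendsto_finsetSum _ fun ν _ => ((hε.pow ν).mul (ha s _)).mul (hb j _)
  have tD : Tendsto D l (𝓝 0) := by
    refine tendsto_pi_nhds.2 fun s => tendsto_pi_nhds.2 fun j => ?_
    by_cases h : s = j
    · subst h
      simp only [hDdef, diagonal_apply_eq]
      simpa [zero_pow (show N - (s : ℕ) ≠ 0 by have := s.2; omega)] using hε.pow (N - (s : ℕ))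
    · simp only [hDdef, diagonal_apply_ne _ h]
      exact tendsto_const_nhds
  have tinv : ∀ {X : ι → Matrix (Fin N) (Fin N) ℂ} {X₀ : Matrix (Fin N) (Fin N) ℂ},
      Tendsto X l (𝓝 X₀) → X₀.det ≠ 0 → Tendsto (fun z => (X z)⁻¹) l (𝓝 X₀⁻¹) := by
    intro X X₀ hX hX₀
    simp only [Matrix.inv_def, Ring.inverse_eq_inv']
    refine Tendsto.smul ?_ ?_
    · exact ((continuous_id.matrix_det.tendsto X₀).comp hX).inv₀ hX₀
    · exact (continuous_id.matrix_adjugate.tendsto X₀).comp hX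
  have tdet : ∀ {X : ι → Matrix (Fin N) (Fin N) ℂ} {X₀ : Matrix (Fin N) (Fin N) ℂ},
      Tendsto X l (𝓝 X₀) → Tendsto (fun z => (X z).det) l (𝓝 X₀.det) := fun hX =>
    (continuous_id.matrix_det.tendsto _).comp hX
  have tBt := (continuous_id.matrix_transpose.tendsto _).comp tB
  have tmain := tdet ((tendsto_const_nhds (x := (1 : Matrix (Fin N) (Fin N) ℂ))).add
    (tD.mul (((tinv tA hA).mul tR).mul (tinv tBt (by simpa using hB)))))
  rw [zero_mul, add_zero, det_one] at tmain
  refine ⟨fun z => (A z).det * (1 + D z * ((A z)⁻¹ * R z * ((B z)ᵀ)⁻¹)).det * (B z).det, ?_, ?_⟩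
  · simpa using ((tdet tA).mul tmain).mul (tdet tB)
  · filter_upwards [(tdet tA).eventually_ne hA, (tdet tB).eventually_ne hB] with z hzA hzB
    have hzA' : IsUnit (A z).det := isUnit_iff_ne_zero.2 hzA
    have hzB' : IsUnit ((B z)ᵀ).det := by rwa [det_transpose, isUnit_iff_ne_zero]
    set E : Matrix (Fin N) (Fin N) ℂ := diagonal fun ν : Fin N => ε z ^ (ν : ℕ) with hE
    have hED : E * D z = ε z ^ N • (1 : Matrix (Fin N) (Fin N) ℂ) := by
      rw [hE, hDdef, diagonal_mul_diagonal, ← diagonal_one, ← diagonal_smul]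
      congr 1
      funext ν
      simp only [Pi.smul_apply, smul_eq_mul, mul_one]
      rw [← pow_add, Nat.add_sub_cancel' ν.2.le]
    have key : (of fun s j : Fin N => ∑ ν ∈ Finset.range (2 * N), ε z ^ ν * a z s ν * b z j ν)
        = A z * E * (1 + D z * ((A z)⁻¹ * R z * ((B z)ᵀ)⁻¹)) * (B z)ᵀ := by
      have h1 : A z * E * (1 + D z * ((A z)⁻¹ * R z * ((B z)ᵀ)⁻¹)) * (B z)ᵀ
          = A z * E * (B z)ᵀ
            + A z * (E * D z) * ((A z)⁻¹ * R z * (((B z)ᵀ)⁻¹ * (B z)ᵀ)) := by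
        noncomm_ring
      rw [h1, hED, nonsing_inv_mul _ hzB', mul_one, Matrix.mul_smul, mul_one, Matrix.smul_mul,
        ← Matrix.mul_assoc, mul_nonsing_inv _ hzA', one_mul]
      ext s j
      have hR : R z s j = ∑ ν ∈ Finset.range N,
        ε z ^ ν * a z s (N + ν) * b z j (N + ν) := rfl
      rw [of_apply, two_mul, Finset.sum_range_add, Matrix.add_apply, Matrix.smul_apply, smul_eq_mul,
        hR, Finset.mul_sum, Matrix.mul_apply]
      congr 1
      · rw [← Fin.sum_univ_eq_sum_range (fun ν => ε z ^ ν * a z s ν * b z j ν)]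
        refine Finset.sum_congr rfl fun ν _ => ?_
        rw [hE, mul_diagonal, transpose_apply]
        simp only [hAdef, hBdef, of_apply]
        ring
      · refine Finset.sum_congr rfl fun ν _ => ?_
        rw [pow_add]; ring
    rw [key, det_mul, det_mul, det_mul, det_transpose, hE, det_diagonal,
      Finset.prod_pow_eq_pow_sum]
    ring

/-- The matrix of the numbers `1 / (2 s + 1 - ν)!` is invertible. -/
theorem det_inv_factorial_ne_zero (N : ℕ) :
    (Matrix.of fun s ν : Fin N => if (ν : ℕ) ≤ 2 * (s : ℕ) + 1 then
      (1 : ℂ) / ((2 * (s : ℕ) + 1 - ν).factorial : ℂ) else 0).det ≠ 0 := by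
  -- 1/(m - ν)! is the falling factorial of m of order ν divided by m!. Falling factorials are monic
  -- of degree ν, so up to row factors this is a Vandermonde determinant at the distinct nodes m =
  -- 2s + 1.
  have h : (Matrix.of fun s ν : Fin N => if (ν : ℕ) ≤ 2 * (s : ℕ) + 1 then
      (1 : ℂ) / ((2 * (s : ℕ) + 1 - ν).factorial : ℂ) else 0)
      = Matrix.diagonal (fun s : Fin N => (1 : ℂ) / ((2 * (s : ℕ) + 1).factorial : ℂ))
        * Matrix.of fun s ν : Fin N =>
          (descPochhammer ℂ ν).eval ((2 * (s : ℕ) + 1 : ℕ) : ℂ) := by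
    ext s ν
    rw [Matrix.diagonal_mul, Matrix.of_apply, Matrix.of_apply,
      descPochhammer_eval_eq_descFactorial]
    split_ifs with hν
    · have := Nat.factorial_mul_descFactorial hν
      have h1 : ((2 * (s : ℕ) + 1 - ν).factorial : ℂ) ≠ 0 := by
        exact_mod_cast Nat.factorial_ne_zero _
      have h2 : ((2 * (s : ℕ) + 1).factorial : ℂ) ≠ 0 := by exact_mod_cast Nat.factorial_ne_zero _
      have h3 : ((2 * (s : ℕ) + 1).factorial : ℂ) = ((2 * (s : ℕ) + 1 - ν).factorial : ℂ)
        * ((2 * (s : ℕ) + 1).descFactorial ν : ℂ) := by exact_mod_cast this.symm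
      rw [div_mul_eq_mul_div, one_mul, div_eq_div_iff h1 h2, h3]
      ring
    · rw [Nat.descFactorial_eq_zero_iff_lt.2 (not_le.1 hν)]; simp
  rw [h, Matrix.det_mul, Matrix.det_diagonal]
  refine mul_ne_zero (Finset.prod_ne_zero_iff.2 fun s _ => ?_) ?_
  · exact one_div_ne_zero (by exact_mod_cast Nat.factorial_ne_zero _)
  · have := Matrix.det_eval_matrixOfPolynomials_eq_det_vandermonde
      (fun s : Fin N => ((2 * (s : ℕ) + 1 : ℕ) : ℂ)) (fun ν : Fin N => descPochhammer ℂ ν)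
      (fun ν => descPochhammer_natDegree ℂ ν) (fun ν => monic_descPochhammer ℂ ν)
    rw [← this, Matrix.det_vandermonde_ne_zero_iff]
    intro i j hij
    have : 2 * (i : ℕ) + 1 = 2 * (j : ℕ) + 1 := Nat.cast_injective (R := ℂ) hij
    exact Fin.ext (by omega)

/-- Schur polynomials of arguments dominated by the first one. -/
theorem tendsto_schur_div_pow {ι : Type*} {l : Filter ι} {w : ι → ℂ} {y : ι → ℕ → ℂ}
    (hw : ∀ᶠ z in l, w z ≠ 0) (h1 : Tendsto (fun z => y z 1 / w z) l (𝓝 1))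
    (h2 : ∀ r, 2 ≤ r → Tendsto (fun z => y z r / w z ^ r) l (𝓝 0)) (j : ℕ) :
    Tendsto (fun z => schur j (y z) / w z ^ j) l (𝓝 (1 / (j.factorial : ℂ))) := by
  induction j using Nat.strong_induction_on with
  | _ j ih =>
    cases j with
    | zero =>
      simp only [schur_eq_coeff, PowerSeries.coeff_zero_eq_constantCoeff, constantCoeff_expSer]
      simpa using tendsto_const_nhds
    | succ j =>
      -- After division of the recursion by w^(j+1) only the summand r = 0 survives in the limit.
      have h3 : Tendsto (fun z => 1 / ((j : ℂ) + 1) * ∑ r ∈ Finset.range (j + 1),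
          ((r : ℂ) + 1) * (y z (r + 1) / w z ^ (r + 1)) * (schur (j - r) (y z) / w z ^ (j - r))) l
          (𝓝 (1 / ((j : ℂ) + 1) * ∑ r ∈ Finset.range (j + 1),
            ((r : ℂ) + 1) * (if r = 0 then 1 else 0) * (1 / ((j - r).factorial : ℂ)))) := by
        refine tendsto_const_nhds.mul (tendsto_finsetSum _ fun r _ => ?_)
        refine (tendsto_const_nhds.mul ?_).mul (ih _ (by omega))
        split_ifs with hr
        · subst hr; simpa using h1
        · exact h2 _ (by omega)
      have hj : (j : ℂ) + 1 ≠ 0 := by exact_mod_cast Nat.succ_ne_zero j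
      have h4 : 1 / ((j : ℂ) + 1) * ∑ r ∈ Finset.range (j + 1),
            ((r : ℂ) + 1) * (if r = 0 then 1 else 0) * (1 / ((j - r).factorial : ℂ))
          = 1 / ((j + 1).factorial : ℂ) := by
        rw [Finset.sum_eq_single 0 (fun r _ hr => by simp [hr]) (by simp), Nat.factorial_succ]
        have : (j.factorial : ℂ) ≠ 0 := by exact_mod_cast Nat.factorial_ne_zero _
        push_cast
        simp [mul_comm]
      rw [h4] at h3
      refine h3.congr' ?_
      filter_upwards [hw] with z hz
      have h5 := coeff_expSer_succ (y z) j
      rw [schur_eq_coeff, eq_div_iff (pow_ne_zero _ hz), mul_assoc, one_div, inv_mul_eq_iff_eq_mul₀ hj,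
        h5, Finset.sum_mul]
      refine Finset.sum_congr rfl fun r hr => ?_
      have hr' : r ≤ j := Nat.lt_succ_iff.1 (Finset.mem_range.1 hr)
      rw [show w z ^ (j + 1) = w z ^ (r + 1) * w z ^ (j - r) by
        rw [← pow_add]; congr 1; omega, schur_eq_coeff]
      field_simp

variable {P : Params} {p₀ : ℂ} {pκ : ℂ → ℂ}

/-- The leading linear form `x - 2 i p₀ t`. -/
noncomputable def linForm (p₀ : ℂ) (z : ℝ × ℝ) : ℂ := z.1 - 2 * Complex.I * p₀ * z.2

theorem norm_sq_linForm (p₀ : ℂ) (z : ℝ × ℝ) :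
    ‖linForm p₀ z‖ ^ 2 = (z.1 + 2 * p₀.im * z.2) ^ 2 + (-2 * p₀.re * z.2) ^ 2 := by
  rw [← Complex.normSq_eq_norm_sq, Complex.normSq_apply, linForm]
  simp
  ring

/-- The imaginary part of ℓ is -2(Re p₀)t, which controls t because Re p₀ ≠ 0; the real part then
controls x. -/
theorem exists_norm_le_linForm (hre : p₀.re ≠ 0) :
    ∃ K : ℝ, ∀ z : ℝ × ℝ, ‖z‖ ≤ K * ‖linForm p₀ z‖ := by
  refine ⟨1 + 2 * |p₀.im| * (1 / (2 * |p₀.re|)) + 1 / (2 * |p₀.re|), fun z => ?_⟩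
  have hpos : 0 < |p₀.re| := abs_pos.2 hre
  have h0 := norm_nonneg (linForm p₀ z)
  have h1 : |z.2| ≤ 1 / (2 * |p₀.re|) * ‖linForm p₀ z‖ := by
    have := Complex.abs_im_le_norm (linForm p₀ z)
    have e : (linForm p₀ z).im = -(2 * p₀.re * z.2) := by simp [linForm]
    rw [e, abs_neg, abs_mul, abs_mul, abs_two] at this
    rw [one_div, ← div_eq_inv_mul, le_div_iff₀ (by positivity)]
    linarith
  have h2 : |z.1| ≤ ‖linForm p₀ z‖ + 2 * |p₀.im| * |z.2| := by
    have := Complex.abs_re_le_norm (linForm p₀ z)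
    have e : z.1 = (linForm p₀ z).re - 2 * p₀.im * z.2 := by simp [linForm]
    calc |z.1| = |(linForm p₀ z).re - 2 * p₀.im * z.2| := by rw [← e]
      _ ≤ |(linForm p₀ z).re| + |2 * p₀.im * z.2| := abs_sub _ _
      _ = |(linForm p₀ z).re| + 2 * |p₀.im| * |z.2| := by rw [abs_mul, abs_mul, abs_two]
      _ ≤ _ := by gcongr
  have h3 : 2 * |p₀.im| * |z.2| ≤ 2 * |p₀.im| * (1 / (2 * |p₀.re|) * ‖linForm p₀ z‖) := by
    gcongr
  have h4 : 0 ≤ 1 / (2 * |p₀.re|) * ‖linForm p₀ z‖ := by positivity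
  have h5 : 0 ≤ 2 * |p₀.im| * (1 / (2 * |p₀.re|) * ‖linForm p₀ z‖) := by positivity
  rw [Prod.norm_def, Real.norm_eq_abs, Real.norm_eq_abs, add_mul, add_mul, one_mul, mul_assoc]
  refine max_le ?_ ?_
  · linarith
  · linarith

theorem tendsto_norm_linForm (hre : p₀.re ≠ 0) :
    Tendsto (fun z => ‖linForm p₀ z‖) (cocompact (ℝ × ℝ)) atTop := by
  obtain ⟨K, hK⟩ := exists_norm_le_linForm hre
  have hK0 : 0 < max K 1 := by positivity
  have h := (tendsto_norm_cocompact_atTop (E := ℝ × ℝ)).const_mul_atTop (inv_pos.2 hK0)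
  refine tendsto_atTop_mono (fun z => ?_) h
  rw [inv_mul_le_iff₀ hK0]
  exact (hK z).trans (by gcongr; exact le_max_left _ _)

/-- Schur polynomials of linear functions of `x` and `t`, in the far field. -/
theorem tendsto_schur_linear (hre : p₀.re ≠ 0) {w : ℝ × ℝ → ℂ} {m : ℝ} (hm : 0 < m)
    (hw : ∀ z, ‖w z‖ = m * ‖linForm p₀ z‖) {α β c : ℕ → ℂ}
    (h1 : ∀ z, w z = α 1 * z.1 + β 1 * z.2) (j : ℕ) :
    Tendsto (fun z : ℝ × ℝ => schur j (fun r => α r * z.1 + β r * z.2 + c r) / w z ^ j)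
      (cocompact (ℝ × ℝ)) (𝓝 (1 / (j.factorial : ℂ))) := by
  have ht : Tendsto (fun z => ‖w z‖) (cocompact (ℝ × ℝ)) atTop := by
    simp only [hw]
    exact (tendsto_norm_linForm hre).const_mul_atTop hm
  have hne : ∀ᶠ z in cocompact (ℝ × ℝ), w z ≠ 0 := by
    filter_upwards [ht.eventually_gt_atTop 0] with z hz
    exact norm_pos_iff.1 hz
  have hinv : Tendsto (fun z => (w z)⁻¹) (cocompact (ℝ × ℝ)) (𝓝 0) :=
    tendsto_inv₀_cobounded.comp (tendsto_norm_atTop_iff_cobounded.1 ht)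
  obtain ⟨K, hK⟩ := exists_norm_le_linForm hre
  refine tendsto_schur_div_pow hne ?_ (fun r hr => ?_) j
  · have := (tendsto_const_nhds (x := (1 : ℂ))).add (hinv.const_mul (c 1))
    rw [mul_zero, add_zero] at this
    refine this.congr' ?_
    filter_upwards [hne] with z hz
    rw [← h1]
    field_simp
  · have hb : ∀ᶠ z in cocompact (ℝ × ℝ),
        ‖(α r * z.1 + β r * z.2 + c r) * (w z)⁻¹‖ ≤ (‖α r‖ + ‖β r‖) * K / m + ‖c r‖ := by
      filter_upwards [ht.eventually_ge_atTop 1] with z hz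
      have hw0 : 0 < ‖w z‖ := by linarith
      have hz' : ‖z‖ ≤ K / m * ‖w z‖ := by
        rw [hw, div_mul_eq_mul_div, ← mul_assoc, mul_comm K m, mul_assoc, mul_div_cancel_left₀ _ hm.ne']
        exact hK z
      have e1 : ‖(z.1 : ℂ)‖ ≤ ‖z‖ := by rw [Complex.norm_real]; exact norm_fst_le z
      have e2 : ‖(z.2 : ℂ)‖ ≤ ‖z‖ := by rw [Complex.norm_real]; exact norm_snd_le z
      rw [norm_mul, norm_inv, ← div_eq_mul_inv, div_le_iff₀ hw0]
      calc ‖α r * z.1 + β r * z.2 + c r‖ ≤ ‖α r‖ * ‖(z.1 : ℂ)‖ + ‖β r‖ * ‖(z.2 : ℂ)‖ + ‖c r‖ := by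
            rw [← norm_mul, ← norm_mul]
            exact (norm_add_le _ _).trans (by gcongr; exact norm_add_le _ _)
        _ ≤ ‖α r‖ * (K / m * ‖w z‖) + ‖β r‖ * (K / m * ‖w z‖) + ‖c r‖ * ‖w z‖ := by
            gcongr
            · exact e1.trans hz'
            · exact e2.trans hz'
            · exact le_mul_of_one_le_right (norm_nonneg _) hz
        _ = _ := by ring
    have hz : Tendsto (fun z => (w z)⁻¹ ^ (r - 1)) (cocompact (ℝ × ℝ)) (𝓝 0) := by
      simpa [zero_pow (show r - 1 ≠ 0 by omega)] using hinv.pow (r - 1)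
    have := isBoundedUnder_le_mul_tendsto_zero (isBoundedUnder_of_eventually_le hb) hz
    refine this.congr fun z => ?_
    obtain ⟨r, rfl⟩ : ∃ i, r = i + 1 := ⟨r - 1, by omega⟩
    rw [Nat.add_sub_cancel, div_eq_mul_inv, ← inv_pow, pow_succ']
    ring

/-- This makes the first argument of both Schur families a multiple of x - 2ip₀t or of its
conjugate, up to a constant. -/
theorem beta_one (hp : IsBranchP P p₀ pκ) : beta p₀ pκ 1 = 2 * p₀ * lam p₀ pκ 1 := by
  have h1 := congrArg (PowerSeries.coeff 1) (serOf_beta hp)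
  have h2 := serOf_lam hp
  have h3 : tps pκ = serOf (lam p₀ pκ) + PowerSeries.C p₀ := by rw [h2]; ring
  have h4 : tps pκ ^ 2 - PowerSeries.C (p₀ ^ 2)
      = serOf (lam p₀ pκ) ^ 2 + PowerSeries.C (2 * p₀) * serOf (lam p₀ pκ) := by
    rw [h3, map_pow, map_mul, map_ofNat]; ring
  rw [h4, map_add, PowerSeries.coeff_C_mul, coeff_serOf_succ _ 0, coeff_serOf_succ _ 0, pow_two,
    PowerSeries.coeff_mul, Finset.Nat.antidiagonal_succ] at h1
  simpa [constantCoeff_serOf] using h1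

theorem fundamentalTau_eq (p₀ : ℂ) (z : ℝ × ℝ) :
    fundamentalTau p₀ z.1 z.2 = ‖linForm p₀ z‖ ^ 2 + 1 / (4 * p₀.re ^ 2) := by
  rw [norm_sq_linForm, fundamentalTau]

theorem fundamentalTau_pos (hre : p₀.re ≠ 0) (z : ℝ × ℝ) : 0 < fundamentalTau p₀ z.1 z.2 := by
  rw [fundamentalTau_eq]
  positivity

theorem tendsto_fundamentalTau (hre : p₀.re ≠ 0) :
    Tendsto (fun z : ℝ × ℝ => fundamentalTau p₀ z.1 z.2) (cocompact (ℝ × ℝ)) atTop := by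
  simp only [fundamentalTau_eq]
  exact tendsto_atTop_add_const_right _ _
    ((tendsto_pow_atTop two_ne_zero).comp (tendsto_norm_linForm hre))

theorem tendsto_norm_sq_div_fundamentalTau (hre : p₀.re ≠ 0) :
    Tendsto (fun z : ℝ × ℝ => ‖linForm p₀ z‖ ^ 2 / fundamentalTau p₀ z.1 z.2)
      (cocompact (ℝ × ℝ)) (𝓝 1) := by
  have h := (((tendsto_fundamentalTau hre).const_div_atTop (1 / (4 * p₀.re ^ 2)))).const_sub 1
  rw [sub_zero] at h
  refine h.congr fun z => ?_
  have := (fundamentalTau_pos hre z).ne'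
  have e : ‖linForm p₀ z‖ ^ 2 = fundamentalTau p₀ z.1 z.2 - 1 / (4 * p₀.re ^ 2) := by
    rw [fundamentalTau_eq]; ring
  rw [e, sub_div, div_self this]

theorem sum_fin_val_add (N : ℕ) : ∑ ν : Fin N, (ν : ℕ) + N = N * (N + 1) / 2 := by
  rw [Fin.sum_univ_eq_sum_range (fun i => i) N, ← Finset.sum_range_succ (fun i => i),
    Finset.sum_range_id, Nat.add_sub_cancel, mul_comm]

/-- In the far field the tau functions are asymptotic to a constant times a power of the tau
function of the fundamental rogue wave. -/
theorem exists_tendsto_tauSchur (hre : p₀.re ≠ 0) (hroot : IsSimpleRoot P p₀)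
    (hp : IsBranchP P p₀ pκ) (a : ℕ → ℂ) (N : ℕ) : ∃ c : ℝ, 0 < c ∧ ∀ n k : ℤ,
      Tendsto (fun z : ℝ × ℝ => tauSchur P p₀ pκ a N n k z.1 z.2
        / (fundamentalTau p₀ z.1 z.2 : ℂ) ^ (N * (N + 1) / 2)) (cocompact (ℝ × ℝ)) (𝓝 (c : ℂ)) := by
  have hlam := lam_one_ne_zero hre hroot hp
  have hlam' : 0 < ‖lam p₀ pκ 1‖ := norm_pos_iff.2 hlam
  set a₀ : Fin N → ℕ → ℝ := fun s ν => if ν ≤ 2 * (s : ℕ) + 1 then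
      1 / ((2 * (s : ℕ) + 1 - ν).factorial : ℝ) else 0 with ha₀
  have hmap : (Matrix.of fun s ν : Fin N => (a₀ s ν : ℂ)).det
      = ((Matrix.of fun s ν : Fin N => a₀ s ν).det : ℂ) :=
    (RingHom.map_det Complex.ofRealHom _).symm
  have hdet : (Matrix.of fun s ν : Fin N => (a₀ s ν : ℂ)).det ≠ 0 := by
    have := det_inv_factorial_ne_zero N
    convert this using 5 with s ν
    simp only [ha₀]
    split_ifs <;> simp
  set d : ℝ := (Matrix.of fun s ν : Fin N => a₀ s ν).det with hd
  have hd0 : d ≠ 0 := by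
    intro h; rw [hmap, h] at hdet; simp at hdet
  set m := ∑ ν : Fin N, (ν : ℕ) with hm
  set C : ℝ := ‖lam p₀ pκ 1‖ ^ 2 / (2 * p₀.re) ^ 2 with hC
  have hCC : (((‖lam p₀ pκ 1‖ ^ 2 : ℝ) : ℂ) / (p₀ + conj p₀) ^ 2) = (C : ℂ) := by
    rw [Complex.add_conj, hC]; push_cast; ring
  have hC0 : 0 < C := by positivity
  -- The constant is fixed before n and k: they enter the arguments only through bounded terms, so
  -- all τ_{n,k} share the limit. This gives |A| → |ρ₁| and |B| → |ρ₂|.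
  refine ⟨(‖lam p₀ pκ 1‖ ^ 2) ^ (m + N) * C ^ m * (d * d),
    mul_pos (by positivity) (mul_self_pos.2 hd0), fun n k => ?_⟩
  set w : ℝ × ℝ → ℂ := fun z => lam p₀ pκ 1 * linForm p₀ z with hw
  have hwn : ∀ z, ‖w z‖ = ‖lam p₀ pκ 1‖ * ‖linForm p₀ z‖ := fun z => norm_mul _ _
  have hww : ∀ z, w z * conj (w z)
      = ((‖lam p₀ pκ 1‖ ^ 2 * ‖linForm p₀ z‖ ^ 2 : ℝ) : ℂ) := fun z => by
    rw [Complex.mul_conj, Complex.normSq_eq_norm_sq, hwn, mul_pow]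
  have hne : ∀ᶠ z in cocompact (ℝ × ℝ), w z ≠ 0 := by
    filter_upwards [(tendsto_norm_linForm hre).eventually_gt_atTop 0] with z hz
    exact mul_ne_zero hlam (norm_pos_iff.1 hz)
  have hw1 : ∀ z, w z = lam p₀ pκ 1 * z.1 + (-Complex.I * beta p₀ pκ 1) * z.2 := fun z => by
    simp only [hw, linForm, beta_one hp]; ring
  have hw2 : ∀ z, conj (w z)
      = conj (lam p₀ pκ 1) * z.1 + (Complex.I * conj (beta p₀ pκ 1)) * z.2 := fun z => by
    rw [hw1]; simp
  clear_value w
  set A : ℝ × ℝ → Fin N → ℕ → ℂ := fun z s ν => if ν ≤ 2 * (s : ℕ) + 1 then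
    schur (2 * (s : ℕ) + 1 - ν) (fun r => xPlus P p₀ pκ a n k z.1 z.2 r + ν * sCoeff p₀ pκ r)
      / w z ^ (2 * (s : ℕ) + 1 - ν) else 0 with hA
  set B : ℝ × ℝ → Fin N → ℕ → ℂ := fun z s ν => if ν ≤ 2 * (s : ℕ) + 1 then
    schur (2 * (s : ℕ) + 1 - ν)
      (fun r => xMinus P p₀ pκ a n k z.1 z.2 r + ν * conj (sCoeff p₀ pκ r))
      / conj (w z) ^ (2 * (s : ℕ) + 1 - ν) else 0 with hB
  have tA : ∀ s ν, Tendsto (fun z => A z s ν) (cocompact (ℝ × ℝ)) (𝓝 (a₀ s ν : ℂ)) := by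
    intro s ν
    simp only [hA, ha₀]
    split_ifs
    · have := tendsto_schur_linear hre hlam' hwn (α := lam p₀ pκ)
        (β := fun r => -Complex.I * beta p₀ pκ r)
        (c := fun r => n * theta p₀ pκ P.k₁ r + k * theta p₀ pκ P.k₂ r + a r + ν * sCoeff p₀ pκ r)
        hw1 (2 * (s : ℕ) + 1 - ν)
      push_cast
      refine this.congr fun z => ?_
      congr 2
      funext r
      simp only [xPlus]; ring
    · simp
  have tB : ∀ s ν, Tendsto (fun z => B z s ν) (cocompact (ℝ × ℝ)) (𝓝 (a₀ s ν : ℂ)) := by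
    intro s ν
    simp only [hB, ha₀]
    split_ifs
    · have := tendsto_schur_linear hre hlam' (w := fun z => conj (w z))
        (fun z => by rw [Complex.norm_conj, hwn]) (α := fun r => conj (lam p₀ pκ r))
        (β := fun r => Complex.I * conj (beta p₀ pκ r))
        (c := fun r => -(n * conj (theta p₀ pκ P.k₁ r)) - k * conj (theta p₀ pκ P.k₂ r)
          + conj (a r) + ν * conj (sCoeff p₀ pκ r)) hw2 (2 * (s : ℕ) + 1 - ν)
      push_cast
      refine this.congr fun z => ?_
      congr 2
      funext r
      simp only [xMinus]; ring
    · simp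
  -- Taking w^(2s+1) out of the rows and w̄^(2j+1) out of the columns leaves w^(-ν) w̄^(-ν) in each
  -- term, which joins C^ν to form ε^ν.
  set ε : ℝ × ℝ → ℂ := fun z => C / (w z * conj (w z)) with hε
  have tε : Tendsto ε (cocompact (ℝ × ℝ)) (𝓝 0) := by
    have h := ((tendsto_pow_atTop two_ne_zero).comp (tendsto_norm_linForm hre)).const_mul_atTop
      (show 0 < ‖lam p₀ pκ 1‖ ^ 2 by positivity)
    have := (Complex.continuous_ofReal.tendsto 0).comp (h.const_div_atTop C)
    rw [Complex.ofReal_zero] at this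
    refine this.congr fun z => ?_
    simp only [hε, hww, Function.comp_apply]
    push_cast; rfl
  obtain ⟨φ, tφ, hφ⟩ := exists_tendsto_det_sum tε tA tB hdet hdet
  have hlim := ((Complex.continuous_ofReal.tendsto _).comp
    (((tendsto_norm_sq_div_fundamentalTau hre).const_mul (‖lam p₀ pκ 1‖ ^ 2)).pow (m + N))).mul
      (tφ.const_mul ((C : ℂ) ^ m))
  rw [hmap] at hlim
  have e1 : (((‖lam p₀ pκ 1‖ ^ 2 * 1) ^ (m + N) : ℝ) : ℂ) * ((C : ℂ) ^ m * ((d : ℂ) * d))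
      = (((‖lam p₀ pκ 1‖ ^ 2) ^ (m + N) * C ^ m * (d * d) : ℝ) : ℂ) := by push_cast; ring
  rw [e1] at hlim
  refine hlim.congr' ?_
  filter_upwards [hφ, hne] with z hz hwz
  have hwz' : conj (w z) ≠ 0 := by simpa using hwz
  have hent : ∀ s j : Fin N,
      entrySchur P p₀ pκ a n k z.1 z.2 (2 * (s : ℕ) + 1) (2 * (j : ℕ) + 1)
      = w z ^ (2 * (s : ℕ) + 1) * (conj (w z) ^ (2 * (j : ℕ) + 1)
        * ∑ ν ∈ Finset.range (2 * N), ε z ^ ν * A z s ν * B z j ν) := by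
    intro s j
    rw [entrySchur, hCC, Finset.mul_sum, Finset.mul_sum]
    refine Finset.sum_subset_zero_on_sdiff (Finset.range_mono (by have := s.2; omega))
      (fun ν hν => ?_) fun ν hν => ?_
    · rw [Finset.mem_sdiff, Finset.mem_range, Finset.mem_range] at hν
      simp only [hA, hB]
      by_cases h : ν ≤ 2 * (s : ℕ) + 1
      · rw [if_neg (show ¬ ν ≤ 2 * (j : ℕ) + 1 by omega)]; ring
      · rw [if_neg h]; ring
    · rw [Finset.mem_range] at hν
      have h1 : ν ≤ 2 * (s : ℕ) + 1 := by omega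
      have h2 : ν ≤ 2 * (j : ℕ) + 1 := by omega
      simp only [hA, hB, hε, if_pos h1, if_pos h2]
      have g1 : w z ^ (2 * (s : ℕ) + 1) = w z ^ (2 * (s : ℕ) + 1 - ν) * w z ^ ν := by
        rw [← pow_add, Nat.sub_add_cancel h1]
      have g2 : conj (w z) ^ (2 * (j : ℕ) + 1)
          = conj (w z) ^ (2 * (j : ℕ) + 1 - ν) * conj (w z) ^ ν := by
        rw [← pow_add, Nat.sub_add_cancel h2]
      rw [g1, g2, div_pow, mul_pow]
      field_simp [hwz, hwz']
  have hτ : tauSchur P p₀ pκ a N n k z.1 z.2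
      = (w z * conj (w z)) ^ (m + N) * ((C : ℂ) ^ m * φ z) := by
    -- Rows and columns give |w|² to the power m + (m + N), and the determinant in ε takes back m,
    -- with m = N(N - 1)/2. The remaining exponent is m + N = N(N + 1)/2.
    have hs : ∑ s : Fin N, (2 * (s : ℕ) + 1) = m + (m + N) := by
      rw [Finset.sum_add_distrib, ← Finset.mul_sum, ← hm]; simp; ring
    rw [tauSchur]
    simp only [hent]
    have r1 := Matrix.det_mul_column (fun s : Fin N => w z ^ (2 * (s : ℕ) + 1))
      (Matrix.of fun s j : Fin N => conj (w z) ^ (2 * (j : ℕ) + 1)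
        * ∑ ν ∈ Finset.range (2 * N), ε z ^ ν * A z s ν * B z j ν)
    have r2 := Matrix.det_mul_row (fun j : Fin N => conj (w z) ^ (2 * (j : ℕ) + 1))
      (Matrix.of fun s j : Fin N => ∑ ν ∈ Finset.range (2 * N), ε z ^ ν * A z s ν * B z j ν)
    simp only [Matrix.of_apply] at r1 r2
    rw [r1, r2, hz, Finset.prod_pow_eq_pow_sum, Finset.prod_pow_eq_pow_sum, hs, ← mul_assoc,
      ← mul_pow, pow_add, ← hm]
    simp only [hε]
    rw [div_pow]
    have : (w z * conj (w z)) ^ m ≠ 0 := pow_ne_zero _ (mul_ne_zero hwz hwz')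
    field_simp
  rw [hτ, hww, ← sum_fin_val_add, ← hm, Function.comp_apply]
  push_cast
  rw [← mul_div_assoc, div_pow, div_mul_eq_mul_div]

end LSRI

namespace LSRI

/-! ### Degrees of polynomials from their growth -/

theorem tendsto_eval_div_pow {p : Polynomial ℂ} {d : ℕ} (hd : p.natDegree ≤ d) :
    Tendsto (fun s : ℝ => p.eval (s : ℂ) / (s : ℂ) ^ d) atTop (𝓝 (p.coeff d)) := by
  have hinv : Tendsto (fun s : ℝ => (s : ℂ)⁻¹) atTop (𝓝 0) := by
    have := (Complex.continuous_ofReal.tendsto 0).comp tendsto_inv_atTop_zero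
    rw [Complex.ofReal_zero] at this
    exact this.congr fun s => Complex.ofReal_inv s
  have h : Tendsto (fun s : ℝ => ∑ i ∈ Finset.range (d + 1), p.coeff i * ((s : ℂ)⁻¹) ^ (d - i))
      atTop (𝓝 (∑ i ∈ Finset.range (d + 1), p.coeff i * 0 ^ (d - i))) :=
    tendsto_finsetSum _ fun i _ => (hinv.pow _).const_mul _
  rw [Finset.sum_range_succ, Finset.sum_eq_zero, zero_add, Nat.sub_self, pow_zero, mul_one] at h
  · refine h.congr' ?_
    filter_upwards [eventually_ne_atTop 0] with s hs
    have hs' : (s : ℂ) ≠ 0 := by exact_mod_cast hs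
    rw [p.eval_eq_sum_range' (Nat.lt_succ_of_le hd), Finset.sum_div]
    refine Finset.sum_congr rfl fun i hi => ?_
    have hi' : i ≤ d := Nat.lt_succ_iff.1 (Finset.mem_range.1 hi)
    have : (s : ℂ) ^ d = (s : ℂ) ^ (d - i) * (s : ℂ) ^ i := by
      rw [← pow_add, Nat.sub_add_cancel hi']
    rw [this, inv_pow]
    field_simp
  · intro i hi
    have := Finset.mem_range.1 hi
    rw [zero_pow (by omega), mul_zero]

theorem natDegree_eq_of_tendsto {p : Polynomial ℂ} {d : ℕ} {c : ℂ} (hc : c ≠ 0)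
    (h : Tendsto (fun s : ℝ => p.eval (s : ℂ) / (s : ℂ) ^ d) atTop (𝓝 c)) : p.natDegree = d := by
  rcases le_or_gt p.natDegree d with hd | hd
  · have := tendsto_nhds_unique (tendsto_eval_div_pow hd) h
    exact le_antisymm hd (Polynomial.le_natDegree_of_ne_zero (this ▸ hc))
  · exfalso
    have hinv : Tendsto (fun s : ℝ => (s : ℂ)⁻¹) atTop (𝓝 0) := by
      have := (Complex.continuous_ofReal.tendsto 0).comp tendsto_inv_atTop_zero
      rw [Complex.ofReal_zero] at this
      exact this.congr fun s => Complex.ofReal_inv s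
    have h1 := h.mul (hinv.pow (p.natDegree - d))
    rw [zero_pow (by omega), mul_zero] at h1
    have h2 := tendsto_nhds_unique ((tendsto_eval_div_pow (le_refl p.natDegree)).congr' ?_) h1
    · rw [Polynomial.coeff_natDegree, Polynomial.leadingCoeff_eq_zero] at h2
      rw [h2] at hd
      simp at hd
    · filter_upwards [eventually_ne_atTop 0] with s hs
      have hs' : (s : ℂ) ≠ 0 := by exact_mod_cast hs
      have : (s : ℂ) ^ p.natDegree = (s : ℂ) ^ (p.natDegree - d) * (s : ℂ) ^ d := by
        rw [← pow_add, Nat.sub_add_cancel hd.le]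
      rw [this, inv_pow]
      field_simp

/-- The restriction of a polynomial to the line spanned by `(u, v)`. -/
noncomputable def rayPoly (R : MvPolynomial (Fin 2) ℂ) (u v : ℂ) : Polynomial ℂ :=
  ∑ m ∈ R.support, Polynomial.monomial (m 0 + m 1) (R.coeff m * (u ^ m 0 * v ^ m 1))

theorem eval_rayPoly (R : MvPolynomial (Fin 2) ℂ) (u v s : ℂ) :
    (rayPoly R u v).eval s = MvPolynomial.eval ![s * u, s * v] R := by
  rw [rayPoly, Polynomial.eval_finsetSum, MvPolynomial.eval_eq']
  refine Finset.sum_congr rfl fun m _ => ?_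
  rw [Polynomial.eval_monomial, Fin.prod_univ_two]
  simp
  ring

theorem totalDegree_eq_sup_fin_two {R : Type*} [CommSemiring R] (F : MvPolynomial (Fin 2) R) :
    F.totalDegree = F.support.sup fun m => m 0 + m 1 := by
  rw [MvPolynomial.totalDegree]
  congr 1
  funext m
  rw [Finsupp.sum_fintype _ _ (fun _ => rfl), Fin.sum_univ_two]

/-- The top homogeneous part is a nonzero polynomial, so it is nonzero at some real point; being
homogeneous of positive degree, it vanishes at the origin. -/
theorem exists_coeff_rayPoly_ne_zero {R : MvPolynomial (Fin 2) ℂ} (h : 0 < R.totalDegree) :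
    ∃ u v : ℝ, (rayPoly R u v).coeff R.totalDegree ≠ 0 ∧ (u, v) ≠ 0 := by
  set D := R.totalDegree with hD
  by_contra! hcon
  set T : MvPolynomial (Fin 2) ℂ := ∑ m ∈ R.support with m 0 + m 1 = D,
    MvPolynomial.monomial m (R.coeff m) with hT
  have heval : ∀ u v : ℂ, MvPolynomial.eval ![u, v] T = (rayPoly R u v).coeff D := by
    intro u v
    rw [hT, map_sum, rayPoly, Polynomial.finsetSum_coeff, Finset.sum_filter]
    refine Finset.sum_congr rfl fun m _ => ?_
    rw [Polynomial.coeff_monomial, MvPolynomial.eval_monomial,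
      Finsupp.prod_fintype _ _ (fun _ => pow_zero _), Fin.prod_univ_two]
    rfl
  have hT0 : T = 0 := by
    refine MvPolynomial.funext_set (fun _ => Set.range Complex.ofReal)
      (fun _ => Set.infinite_range_of_injective Complex.ofReal_injective) fun z hz => ?_
    obtain ⟨u, hu⟩ := hz 0 trivial
    obtain ⟨v, hv⟩ := hz 1 trivial
    have hz' : z = ![(u : ℂ), (v : ℂ)] := by
      funext i; fin_cases i
      · exact hu.symm
      · exact hv.symm
    rw [hz', heval, map_zero]
    by_contra hne
    have h0 := hcon u v hne
    rw [Prod.mk_eq_zero] at h0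
    rw [h0.1, h0.2, rayPoly, Polynomial.finsetSum_coeff] at hne
    refine hne (Finset.sum_eq_zero fun m _ => ?_)
    rw [Polynomial.coeff_monomial]
    split_ifs with hm
    · rcases Nat.eq_zero_or_pos (m 0) with h1 | h1
      · rw [Complex.ofReal_zero, zero_pow (show m 1 ≠ 0 by omega), mul_zero, mul_zero]
      · rw [Complex.ofReal_zero, zero_pow (show m 0 ≠ 0 by omega), zero_mul, mul_zero]
    · rfl
  obtain ⟨m, hm, hmD⟩ := Finset.exists_mem_eq_sup R.support
    (by
      rw [Finset.nonempty_iff_ne_empty]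
      intro he
      rw [totalDegree_eq_sup_fin_two, he] at hD
      simp at hD
      omega) fun m => m 0 + m 1
  rw [← totalDegree_eq_sup_fin_two, ← hD] at hmD
  have := congrArg (MvPolynomial.coeff m) hT0
  rw [hT, MvPolynomial.coeff_sum] at this
  simp only [MvPolynomial.coeff_monomial, MvPolynomial.coeff_zero] at this
  rw [Finset.sum_ite_eq', if_pos (Finset.mem_filter.2 ⟨hm, hmD.symm⟩)] at this
  exact MvPolynomial.mem_support_iff.1 hm this

variable {P : Params} {p₀ : ℂ} {pκ : ℂ → ℂ}

theorem linForm_smul (p₀ : ℂ) (s u v : ℝ) :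
    linForm p₀ (s * u, s * v) = s * linForm p₀ (u, v) := by
  simp only [linForm]; push_cast; ring

theorem linForm_ne_zero (hre : p₀.re ≠ 0) {z : ℝ × ℝ} (hz : z ≠ 0) : linForm p₀ z ≠ 0 := by
  obtain ⟨K, hK⟩ := exists_norm_le_linForm hre
  intro h
  have := hK z
  rw [h, norm_zero, mul_zero, norm_le_zero_iff] at this
  exact hz this

theorem tendsto_ray {u v : ℝ} (h : (u, v) ≠ (0 : ℝ × ℝ)) :
    Tendsto (fun s : ℝ => (s * u, s * v)) atTop (cocompact (ℝ × ℝ)) := by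
  have h1 : 0 < ‖((u, v) : ℝ × ℝ)‖ := norm_pos_iff.2 h
  rw [← Metric.cobounded_eq_cocompact, ← tendsto_norm_atTop_iff_cobounded]
  refine (tendsto_id.atTop_mul_const h1).congr' ?_
  filter_upwards [eventually_ge_atTop 0] with s hs
  rw [show ((s * u, s * v) : ℝ × ℝ) = s • (u, v) from rfl, norm_smul, Real.norm_of_nonneg hs]
  rfl

/-- Along a ray `fundamentalTau` grows like s² times a positive constant, as ℓ vanishes only at the
origin. -/
theorem natDegree_rayPoly (hre : p₀.re ≠ 0) {R : MvPolynomial (Fin 2) ℂ} {M : ℕ} {c : ℂ}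
    (hc : c ≠ 0) (h : Tendsto (fun z : ℝ × ℝ => MvPolynomial.eval ![(z.1 : ℂ), (z.2 : ℂ)] R
      / (fundamentalTau p₀ z.1 z.2 : ℂ) ^ M) (cocompact (ℝ × ℝ)) (𝓝 c)) {u v : ℝ}
    (huv : (u, v) ≠ (0 : ℝ × ℝ)) : (rayPoly R u v).natDegree = 2 * M := by
  have hq : (‖linForm p₀ (u, v)‖ : ℂ) ≠ 0 := by
    exact_mod_cast (norm_pos_iff.2 (linForm_ne_zero hre huv)).ne'
  have hray := tendsto_ray huv
  have h1 := h.comp hray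
  have h2 := ((Complex.continuous_ofReal.tendsto _).comp
    ((tendsto_norm_sq_div_fundamentalTau hre).comp hray))
  rw [Complex.ofReal_one] at h2
  have h3 := (h1.div (h2.pow M) (by simp)).mul_const ((‖linForm p₀ (u, v)‖ : ℂ) ^ (2 * M))
  rw [one_pow, div_one] at h3
  refine natDegree_eq_of_tendsto (mul_ne_zero hc (pow_ne_zero _ hq)) (h3.congr' ?_)
  filter_upwards [eventually_gt_atTop 0] with s hs
  have hs' : (s : ℂ) ≠ 0 := by exact_mod_cast hs.ne'
  have hf : (fundamentalTau p₀ (s * u) (s * v) : ℂ) ≠ 0 := by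
    exact_mod_cast (fundamentalTau_pos hre (s * u, s * v)).ne'
  have hn : ‖linForm p₀ (s * u, s * v)‖ = s * ‖linForm p₀ (u, v)‖ := by
    rw [linForm_smul, norm_mul, Complex.norm_real, Real.norm_of_nonneg hs.le]
  simp only [Function.comp_apply, Pi.div_apply, hn, eval_rayPoly]
  generalize fundamentalTau p₀ (s * u) (s * v) = f at hf
  push_cast
  rw [pow_mul, pow_mul, div_pow, mul_pow, mul_pow]
  field_simp

/-- A ray on which the top form is nonzero bounds the total degree by 2M. The two coordinate axes
bound the partial degrees below by 2M, so all three agree. -/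
theorem hasDegree_of_tendsto (hre : p₀.re ≠ 0) {R : MvPolynomial (Fin 2) ℂ} {M : ℕ} {c : ℂ}
    (hc : c ≠ 0) (h : Tendsto (fun z : ℝ × ℝ => MvPolynomial.eval ![(z.1 : ℂ), (z.2 : ℂ)] R
      / (fundamentalTau p₀ z.1 z.2 : ℂ) ^ M) (cocompact (ℝ × ℝ)) (𝓝 c)) : HasDegree R (2 * M) := by
  have htot : R.totalDegree ≤ 2 * M := by
    rcases Nat.eq_zero_or_pos R.totalDegree with h0 | h0
    · omega
    · obtain ⟨u, v, hne, huv⟩ := exists_coeff_rayPoly_ne_zero h0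
      exact (Polynomial.le_natDegree_of_ne_zero hne).trans (natDegree_rayPoly hre hc h huv).le
  have h0 : 2 * M ≤ R.degreeOf 0 := by
    rw [← natDegree_rayPoly hre hc h (u := 1) (v := 0) (by simp)]
    refine Polynomial.natDegree_sum_le_of_forall_le _ _ fun m hm => ?_
    rcases Nat.eq_zero_or_pos (m 1) with h1 | h1
    · exact (Polynomial.natDegree_monomial_le _).trans
        (by rw [h1, add_zero]; exact MvPolynomial.monomial_le_degreeOf 0 hm)
    · rw [Complex.ofReal_zero, zero_pow h1.ne', mul_zero, mul_zero, map_zero]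
      simp
  have h1 : 2 * M ≤ R.degreeOf 1 := by
    rw [← natDegree_rayPoly hre hc h (u := 0) (v := 1) (by simp)]
    refine Polynomial.natDegree_sum_le_of_forall_le _ _ fun m hm => ?_
    rcases Nat.eq_zero_or_pos (m 0) with h1 | h1
    · exact (Polynomial.natDegree_monomial_le _).trans
        (by rw [h1, zero_add]; exact MvPolynomial.monomial_le_degreeOf 1 hm)
    · rw [Complex.ofReal_zero, zero_pow h1.ne', zero_mul, mul_zero, map_zero]
      simp
  have d0 := MvPolynomial.degreeOf_le_totalDegree R 0
  have d1 := MvPolynomial.degreeOf_le_totalDegree R 1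
  exact ⟨by omega, by omega, by omega⟩

theorem HasDegree.of_map {F : MvPolynomial (Fin 2) ℝ} {d : ℕ}
    (h : HasDegree (MvPolynomial.map Complex.ofRealHom F) d) : HasDegree F d := by
  have hs := MvPolynomial.support_map_of_injective F (f := Complex.ofRealHom)
    Complex.ofReal_injective
  rw [HasDegree, MvPolynomial.degreeOf_eq_sup, MvPolynomial.degreeOf_eq_sup,
    MvPolynomial.totalDegree, hs] at h
  rwa [HasDegree, MvPolynomial.degreeOf_eq_sup, MvPolynomial.degreeOf_eq_sup,
    MvPolynomial.totalDegree]

theorem totalDegree_pderiv_le (F : MvPolynomial (Fin 2) ℝ) (i : Fin 2) :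
    (MvPolynomial.pderiv i F).totalDegree ≤ F.totalDegree - 1 := by
  conv_lhs => rw [F.as_sum, map_sum]
  refine MvPolynomial.totalDegree_finsetSum_le fun m hm => ?_
  rw [MvPolynomial.pderiv_monomial]
  rcases Nat.eq_zero_or_pos (m i) with h | h
  · rw [h]; simp
  · refine (MvPolynomial.totalDegree_monomial_le _ _).trans ?_
    have h1 := MvPolynomial.le_totalDegree hm
    rw [Finsupp.sum_fintype _ _ (fun _ => rfl), Fin.sum_univ_two] at h1 ⊢
    simp only [Finsupp.coe_tsub, Pi.sub_apply]
    fin_cases i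
    · simp at h ⊢; omega
    · simp at h ⊢; omega

/-- Monomials of degree below 2M are o(|ℓ|^(2M)), because |x| and |t| are O(|ℓ|). -/
theorem tendsto_ev_div_zero (hre : p₀.re ≠ 0) {F : MvPolynomial (Fin 2) ℝ} {M : ℕ}
    (hF : F.totalDegree < 2 * M) : Tendsto (fun z : ℝ × ℝ => ev F z.1 z.2
      / fundamentalTau p₀ z.1 z.2 ^ M) (cocompact (ℝ × ℝ)) (𝓝 0) := by
  simp only [ev, MvPolynomial.eval_eq', Finset.sum_div]
  rw [show (0 : ℝ) = ∑ m ∈ F.support, 0 by simp]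
  refine tendsto_finsetSum _ fun m hm => ?_
  have hm' : m 0 + m 1 < 2 * M := by
    have h1 := MvPolynomial.le_totalDegree hm
    rw [Finsupp.sum_fintype _ _ (fun _ => rfl), Fin.sum_univ_two] at h1
    omega
  obtain ⟨K, hK⟩ := exists_norm_le_linForm hre
  have ht : Tendsto (fun z => |F.coeff m| * K ^ (m 0 + m 1)
      * (‖linForm p₀ z‖⁻¹) ^ (2 * M - (m 0 + m 1))) (cocompact (ℝ × ℝ)) (𝓝 0) := by
    have := ((tendsto_inv_atTop_zero.comp (tendsto_norm_linForm hre)).pow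
      (2 * M - (m 0 + m 1))).const_mul (|F.coeff m| * K ^ (m 0 + m 1))
    rwa [zero_pow (by omega), mul_zero] at this
  refine squeeze_zero_norm' ?_ ht
  filter_upwards [(tendsto_norm_linForm hre).eventually_gt_atTop 0] with z hz
  have hf := fundamentalTau_pos hre z
  have hle : ‖linForm p₀ z‖ ^ (2 * M) ≤ fundamentalTau p₀ z.1 z.2 ^ M := by
    rw [pow_mul, fundamentalTau_eq]
    gcongr
    have : 0 ≤ 1 / (4 * p₀.re ^ 2) := by positivity
    linarith
  rw [Fin.prod_univ_two, norm_div, norm_mul, norm_mul, norm_pow, norm_pow, norm_pow,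
    Real.norm_of_nonneg hf.le, Real.norm_eq_abs]
  have h1 : ‖z.1‖ ≤ K * ‖linForm p₀ z‖ := (norm_fst_le z).trans (hK z)
  have h2 : ‖z.2‖ ≤ K * ‖linForm p₀ z‖ := (norm_snd_le z).trans (hK z)
  rw [div_le_iff₀ (by positivity)]
  have hKz : 0 ≤ K * ‖linForm p₀ z‖ := (norm_nonneg _).trans h1
  have hK0 : 0 ≤ K := nonneg_of_mul_nonneg_left hKz hz
  calc |F.coeff m| * (‖z.1‖ ^ m 0 * ‖z.2‖ ^ m 1)
      ≤ |F.coeff m| * ((K * ‖linForm p₀ z‖) ^ m 0 * (K * ‖linForm p₀ z‖) ^ m 1) := by gcongr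
    _ = |F.coeff m| * K ^ (m 0 + m 1) * (‖linForm p₀ z‖⁻¹) ^ (2 * M - (m 0 + m 1))
        * ‖linForm p₀ z‖ ^ (2 * M) := by
      have : ‖linForm p₀ z‖ ^ (2 * M)
          = ‖linForm p₀ z‖ ^ (2 * M - (m 0 + m 1)) * ‖linForm p₀ z‖ ^ (m 0 + m 1) := by
        rw [← pow_add, Nat.sub_add_cancel hm'.le]
      rw [this, ← pow_add, mul_pow, inv_pow]
      field_simp
    _ ≤ _ := by gcongr

/-! ### Rational rogue waves -/

/-- In (F_xx F - F_x²)/F² each differentiation lowers the degree, while F keeps a nonzero limit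
after division by the M-th power of `fundamentalTau`. -/
theorem tendsto_fieldL (hre : p₀.re ≠ 0) {F : MvPolynomial (Fin 2) ℝ} {M : ℕ} {c : ℝ} (hc : c ≠ 0)
    (hM : 0 < M) (hd : HasDegree F (2 * M)) (hF : ∀ x t, ev F x t ≠ 0)
    (h : Tendsto (fun z : ℝ × ℝ => ev F z.1 z.2 / fundamentalTau p₀ z.1 z.2 ^ M)
      (cocompact (ℝ × ℝ)) (𝓝 c)) (γ : ℝ) :
    Tendsto (fun z : ℝ × ℝ => γ - 2 * iteratedDeriv 2 (fun x => Real.log (ev F x z.2)) z.1)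
      (cocompact (ℝ × ℝ)) (𝓝 γ) := by
  have h1 := tendsto_ev_div_zero hre (F := MvPolynomial.pderiv 0 F) (M := M) (by
    have := totalDegree_pderiv_le F 0
    rw [hd.2.2] at this
    omega)
  have h2 := tendsto_ev_div_zero hre (F := MvPolynomial.pderiv 0 (MvPolynomial.pderiv 0 F))
    (M := M) (by
      have := totalDegree_pderiv_le F 0
      have := totalDegree_pderiv_le (MvPolynomial.pderiv 0 F) 0
      rw [hd.2.2] at *
      omega)
  have h3 := (((h2.mul h).sub (h1.mul h1)).div (h.pow 2) (pow_ne_zero 2 hc)).const_mul 2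
  have h4 := h3.const_sub γ
  simp only [zero_mul, sub_zero, zero_div, mul_zero] at h4
  refine h4.congr fun z => ?_
  rw [iteratedDeriv_log_ev hF]
  have := (fundamentalTau_pos hre z).ne'
  have := hF z.1 z.2
  simp only [Pi.div_apply]
  field_simp

theorem tendsto_norm_planeWave_mul_div {F₀ : ℝ × ℝ → ℝ} {f g : ℝ × ℝ → ℂ} {M : ℕ} {c : ℂ}
    (hc : c ≠ 0) (hF₀ : ∀ z, F₀ z ≠ 0) {l : Filter (ℝ × ℝ)}
    (hf : Tendsto (fun z => f z / (F₀ z : ℂ) ^ M) l (𝓝 c))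
    (hg : Tendsto (fun z => g z / (F₀ z : ℂ) ^ M) l (𝓝 c)) (ρ k γ : ℝ) :
    Tendsto (fun z : ℝ × ℝ => ‖planeWave ρ k γ z.1 z.2 * (g z / f z)‖) l (𝓝 |ρ|) := by
  have h := ((hg.div hf hc).norm).const_mul |ρ|
  rw [div_self hc, norm_one, mul_one] at h
  refine h.congr fun z => ?_
  have : (F₀ z : ℂ) ^ M ≠ 0 := pow_ne_zero _ (by exact_mod_cast hF₀ z)
  rw [norm_mul, norm_planeWave, Pi.div_apply, div_div_div_cancel_right₀ this]

theorem exists_hasDegree_tauSchur (hre : p₀.re ≠ 0) (hroot : IsSimpleRoot P p₀)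
    (hp : IsBranchP P p₀ pκ) (a : ℕ → ℂ) (N : ℕ) (n k : ℤ) :
    ∃ R : MvPolynomial (Fin 2) ℂ, HasDegree R (2 * (N * (N + 1) / 2)) ∧
      ∀ x t : ℝ, tauSchur P p₀ pκ a N n k x t = MvPolynomial.eval ![(x : ℂ), (t : ℂ)] R := by
  obtain ⟨R, hR⟩ := isPolyFun_tauSchur P p₀ pκ a N n k
  obtain ⟨c, hc, h⟩ := exists_tendsto_tauSchur hre hroot hp a N
  refine ⟨R, hasDegree_of_tendsto hre (c := c) (by exact_mod_cast hc.ne') ?_, hR⟩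
  have := h n k
  simpa only [hR] using this

open scoped ComplexOrder in
theorem isRationalRogueWave_tauSchur (hre : p₀.re ≠ 0) (hroot : IsSimpleRoot P p₀)
    (hp : IsBranchP P p₀ pκ) (a : ℕ → ℂ) {N : ℕ} (hN : 0 < N) :
    IsRationalRogueWave P p₀ (N * (N + 1) / 2) (fieldA P (tauSchur P p₀ pκ a N))
      (fieldB P (tauSchur P p₀ pκ a N)) (fieldL P (tauSchur P p₀ pκ a N)) := by
  have hM : 0 < N * (N + 1) / 2 := Nat.div_pos (by nlinarith) two_pos
  have hpos := tauSchur_zero_pos hre hroot hp a N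
  obtain ⟨c, hc, h⟩ := exists_tendsto_tauSchur hre hroot hp a N
  obtain ⟨G, hG, hGτ⟩ := exists_hasDegree_tauSchur hre hroot hp a N 1 0
  obtain ⟨H, hH, hHτ⟩ := exists_hasDegree_tauSchur hre hroot hp a N 0 1
  set τ := tauSchur P p₀ pκ a N with hτ
  set M := N * (N + 1) / 2 with hMdef
  have hc' : (c : ℂ) ≠ 0 := by exact_mod_cast hc.ne'
  obtain ⟨F, hF⟩ : ∃ F, ∀ x t, τ 0 0 x t = (ev F x t : ℂ) :=
    (isPolyFun_tauSchur P p₀ pκ a N 0 0).exists_real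
      fun x t => (Complex.pos_iff.1 (hpos x t)).2.symm
  have hFpos : ∀ x t, 0 < ev F x t := fun x t => by
    have := (Complex.pos_iff.1 (hpos x t)).1
    rwa [hF, Complex.ofReal_re] at this
  have hFc : Tendsto (fun z : ℝ × ℝ => ev F z.1 z.2 / fundamentalTau p₀ z.1 z.2 ^ M)
      (cocompact (ℝ × ℝ)) (𝓝 c) := by
    have := (Complex.continuous_re.tendsto _).comp (h 0 0)
    rw [Complex.ofReal_re] at this
    refine this.congr fun z => ?_
    rw [Function.comp_apply, hF, ← Complex.ofReal_pow, ← Complex.ofReal_div, Complex.ofReal_re]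
  have hFd : HasDegree F (2 * M) := by
    refine HasDegree.of_map (hasDegree_of_tendsto hre hc' ((h 0 0).congr fun z => ?_))
    have e : (![(z.1 : ℂ), (z.2 : ℂ)] : Fin 2 → ℂ) = Complex.ofRealHom ∘ ![z.1, z.2] := by
      funext i
      fin_cases i <;> rfl
    rw [hF, ev, MvPolynomial.eval_map, e, ← MvPolynomial.eval₂_comp]
    rfl
  refine ⟨⟨F, G, H, hFd, hG, hH, hFpos, fun x t => ?_, fun x t => ?_, fun x t => ?_, c, hc, hFc⟩,
    ?_, ?_, ?_⟩
  · rw [fieldA, hGτ, hF]; rfl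
  · rw [fieldB, hHτ, hF]; rfl
  · rw [fieldL]
    simp only [hF, Complex.ofReal_re]
    rfl
  · exact tendsto_norm_planeWave_mul_div (F₀ := fun z => fundamentalTau p₀ z.1 z.2) hc'
      (fun z => (fundamentalTau_pos hre z).ne') (h 0 0) (h 1 0) _ _ _
  · exact tendsto_norm_planeWave_mul_div (F₀ := fun z => fundamentalTau p₀ z.1 z.2) hc'
      (fun z => (fundamentalTau_pos hre z).ne') (h 0 0) (h 0 1) _ _ _
  · have := tendsto_fieldL hre hc.ne' hM hFd (fun x t => (hFpos x t).ne') hFc P.γ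
    refine this.congr fun z => ?_
    rw [fieldL]
    simp only [hF, Complex.ofReal_re]

end LSRI

namespace LSRI

/-! ### The auxiliary local functions -/

theorem exists_analytic_local_inverse {f : ℂ → ℂ} {x : ℂ} (hf : AnalyticAt ℂ f x)
    (hf' : deriv f x ≠ 0) : ∃ g : ℂ → ℂ, AnalyticAt ℂ g (f x) ∧ g (f x) = x ∧
      (∀ᶠ z in 𝓝 x, g (f z) = z) ∧ ∀ᶠ w in 𝓝 (f x), f (g w) = w := by
  have hl := HasStrictDerivAt.eventually_left_inverse (hf := hf.hasStrictDerivAt) (hf' := hf')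
  exact ⟨_, hf.analyticAt_localInverse hf', hl.self_of_nhds, hl,
    HasStrictDerivAt.eventually_right_inverse (hf := hf.hasStrictDerivAt) (hf' := hf')⟩

/-- An analytic function with a double zero has an analytic square root. -/
theorem exists_analytic_sqrt {h : ℂ → ℂ} {x : ℂ} (hh : AnalyticAt ℂ h x) (h0 : h x = 0)
    (h1 : deriv h x = 0) (h2 : deriv (deriv h) x ≠ 0) :
    ∃ r : ℂ → ℂ, AnalyticAt ℂ r x ∧ ∀ᶠ z in 𝓝 x, r z ^ 2 = h z := by
  set d := dslope (dslope h x) x with hd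
  have hda : AnalyticAt ℂ d x := analyticAt_dslope (analyticAt_dslope hh)
  have hfac : ∀ z, h z = (z - x) ^ 2 * d z := by
    intro z
    have e1 := sub_smul_dslope h x z
    have e2 := sub_smul_dslope (dslope h x) x z
    rw [dslope_same, h1, sub_zero, smul_eq_mul] at e2
    rw [h0, sub_zero, smul_eq_mul, ← e2] at e1
    rw [← e1]; ring
  have hd0 : d x ≠ 0 := by
    intro hdx
    apply h2
    have e1 : ∀ᶠ z in 𝓝 x, deriv h z = 2 * (z - x) * d z + (z - x) ^ 2 * deriv d z := by
      filter_upwards [hda.eventually_analyticAt] with z hz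
      have := ((((hasDerivAt_id z).sub_const x).fun_pow 2).mul hz.differentiableAt.hasDerivAt)
      have e : h = (fun y => (id y - x) ^ 2) * d := funext fun y => hfac y
      rw [e, this.deriv]
      simp
    rw [EventuallyEq.deriv_eq e1]
    have e2 := ((((hasDerivAt_id x).sub_const x).const_mul 2).mul
      hda.differentiableAt.hasDerivAt).add ((((hasDerivAt_id x).sub_const x).fun_pow 2).mul
        hda.deriv.differentiableAt.hasDerivAt)
    refine (e2.deriv).trans ?_
    simp [hdx]
  have hq : AnalyticAt ℂ (fun z => d z / d x) x := hda.div_const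
  -- Normalizing to d(z)/d(x) puts the argument near 1, where the principal logarithm is analytic;
  -- the square root of the constant d(x) is taken separately.
  refine ⟨fun z => (z - x) * (Complex.exp (Complex.log (d x) / 2)
    * Complex.exp (Complex.log (d z / d x) / 2)), ?_, ?_⟩
  · refine (analyticAt_id.sub analyticAt_const).mul (analyticAt_const.mul ?_)
    refine ((hq.clog ?_).div_const).cexp
    rw [div_self hd0]
    exact Complex.one_mem_slitPlane
  · filter_upwards [hda.continuousAt.eventually_ne hd0] with z hz
    rw [hfac, mul_pow, mul_pow, ← Complex.exp_nat_mul, ← Complex.exp_nat_mul]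
    push_cast
    rw [mul_div_cancel₀ _ (two_ne_zero), mul_div_cancel₀ _ (two_ne_zero), Complex.exp_log hd0,
      Complex.exp_log (div_ne_zero hz hd0), mul_div_cancel₀ _ hd0]

variable {P : Params} {p₀ : ℂ}

/-- Q² - Q(p₀)² has a zero of order exactly two at p₀: its derivative 2QQ' vanishes there and its
second derivative is 2Q(p₀)Q''(p₀) ≠ 0. So its square root has an analytic branch. -/
theorem exists_isBranchW (hre : p₀.re ≠ 0) (hroot : IsSimpleRoot P p₀) :
    ∃ W, IsBranchW P p₀ W := by
  have hQ := analyticAt_Q P hre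
  have hQ0 := Q_ne_zero hre hroot
  have hd : ∀ᶠ p in 𝓝 p₀, deriv (fun p => Q P p ^ 2 - Q P p₀ ^ 2) p = 2 * Q P p * deriv (Q P) p := by
    filter_upwards [hQ.eventually_analyticAt] with p hp
    have := (hp.differentiableAt.hasDerivAt.fun_pow 2).sub_const (Q P p₀ ^ 2)
    rw [this.deriv]; simp
  obtain ⟨r, hr, hrh⟩ := exists_analytic_sqrt (h := fun p => Q P p ^ 2 - Q P p₀ ^ 2) (x := p₀)
    ((hQ.fun_pow 2).sub analyticAt_const) (by simp) (by
      rw [hd.self_of_nhds, hroot.1, mul_zero]) (by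
      rw [EventuallyEq.deriv_eq hd]
      have := (hQ.differentiableAt.hasDerivAt.const_mul 2).mul
        hQ.deriv.differentiableAt.hasDerivAt
      have e := this.deriv
      rw [hroot.1, mul_zero, zero_add] at e
      refine ne_of_eq_of_ne e ?_
      exact mul_ne_zero (mul_ne_zero two_ne_zero hQ0) hroot.2)
  exact ⟨fun p => (Q P p + r p) / Q P p₀, (hQ.add hr).div_const,
    hrh.mono fun p hp => ⟨r p, hp, rfl⟩⟩

section

variable {W : ℂ → ℂ}

/-- Eliminating the square root gives W + 1/W = 2Q/Q(p₀), that is, cosh(ln W) = Q/Q(p₀). This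
sign-free form is what later arguments use. -/
theorem IsBranchW.quadratic (hre : p₀.re ≠ 0) (hroot : IsSimpleRoot P p₀) (hW : IsBranchW P p₀ W) :
    ∀ᶠ p in 𝓝 p₀, Q P p₀ * (W p ^ 2 + 1) = 2 * Q P p * W p := by
  have hQ0 := Q_ne_zero hre hroot
  filter_upwards [hW.2] with p ⟨w, hw, hWp⟩
  have h1 : w = Q P p₀ * W p - Q P p := by rw [hWp]; field_simp; ring
  rw [h1] at hw
  have : Q P p₀ * (Q P p₀ * (W p ^ 2 + 1) - 2 * Q P p * W p) = 0 := by linear_combination hw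
  exact sub_eq_zero.1 ((mul_eq_zero.1 this).resolve_left hQ0)

theorem IsBranchW.of_quadratic (hre : p₀.re ≠ 0) (hroot : IsSimpleRoot P p₀)
    (hW : AnalyticAt ℂ W p₀)
    (h : ∀ᶠ p in 𝓝 p₀, Q P p₀ * (W p ^ 2 + 1) = 2 * Q P p * W p) : IsBranchW P p₀ W := by
  have hQ0 := Q_ne_zero hre hroot
  refine ⟨hW, h.mono fun p hp => ⟨Q P p₀ * W p - Q P p, ?_, ?_⟩⟩
  · linear_combination Q P p₀ * hp
  · field_simp; ring

theorem IsBranchW.apply_self (hre : p₀.re ≠ 0) (hroot : IsSimpleRoot P p₀) (hW : IsBranchW P p₀ W) :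
    W p₀ = 1 := by
  have h := (hW.quadratic hre hroot).self_of_nhds
  have hQ0 := Q_ne_zero hre hroot
  have : Q P p₀ * (W p₀ - 1) ^ 2 = 0 := by linear_combination h
  exact sub_eq_zero.1 (pow_eq_zero_iff two_ne_zero |>.1 ((mul_eq_zero.1 this).resolve_left hQ0))

theorem IsBranchW.eventually_ne_zero (hre : p₀.re ≠ 0) (hroot : IsSimpleRoot P p₀)
    (hW : IsBranchW P p₀ W) : ∀ᶠ p in 𝓝 p₀, W p ≠ 0 :=
  hW.1.continuousAt.eventually_ne (by rw [hW.apply_self hre hroot]; exact one_ne_zero)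

theorem IsBranchW.deriv_quadratic (hre : p₀.re ≠ 0) (hroot : IsSimpleRoot P p₀)
    (hW : IsBranchW P p₀ W) : ∀ᶠ p in 𝓝 p₀,
      Q P p₀ * (2 * W p * deriv W p) = 2 * deriv (Q P) p * W p + 2 * Q P p * deriv W p := by
  have hQ := analyticAt_Q P hre
  filter_upwards [(hW.quadratic hre hroot).eventually_nhds, hW.1.eventually_analyticAt,
    hQ.eventually_analyticAt] with p hp h1 h2
  have d1 := (((h1.differentiableAt.hasDerivAt).fun_pow 2).add_const 1).const_mul (Q P p₀)
  have d2 := ((h2.differentiableAt.hasDerivAt).const_mul 2).mul h1.differentiableAt.hasDerivAt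
  have := (d1.congr_of_eventuallyEq (EventuallyEq.symm hp)).unique d2
  simpa using this

/-- Differentiating the quadratic relation twice at p₀ gives Q(p₀)W'(p₀)² = Q''(p₀), so ln W is a
local coordinate. -/
theorem IsBranchW.deriv_ne_zero (hre : p₀.re ≠ 0) (hroot : IsSimpleRoot P p₀)
    (hW : IsBranchW P p₀ W) : deriv W p₀ ≠ 0 := by
  have hQ := analyticAt_Q P hre
  have hQ' := hQ.deriv.differentiableAt.hasDerivAt
  have hQ0 := hQ.differentiableAt.hasDerivAt
  have hW0 := hW.1.differentiableAt.hasDerivAt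
  have hW' := hW.1.deriv.differentiableAt.hasDerivAt
  have d1 := ((hW0.const_mul 2).mul hW').const_mul (Q P p₀)
  have d2 := ((hQ'.const_mul 2).mul hW0).add ((hQ0.const_mul 2).mul hW')
  have := (d1.congr_of_eventuallyEq (EventuallyEq.symm (hW.deriv_quadratic hre hroot))).unique d2
  rw [hW.apply_self hre hroot, hroot.1] at this
  intro h
  rw [h] at this
  exact hroot.2 (by linear_combination -(1 / 2 : ℂ) * this)

/-- From the relation, WQ' = (Q(p₀)W - Q)W', and the square of Q(p₀)W - Q is Q² - Q(p₀)². -/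
theorem IsBranchW.isBranchT (hre : p₀.re ≠ 0) (hroot : IsSimpleRoot P p₀) (hW : IsBranchW P p₀ W) :
    IsBranchT P p₀ (fun p => W p / deriv W p) ∧
      ∀ᶠ p in 𝓝 p₀, W p / deriv W p * deriv W p = W p := by
  have hd := hW.deriv_ne_zero hre hroot
  have hdn := hW.1.deriv.continuousAt.eventually_ne hd
  refine ⟨⟨hW.1.fun_div hW.1.deriv hd, ?_⟩, hdn.mono fun p hp => div_mul_cancel₀ _ hp⟩
  filter_upwards [hW.quadratic hre hroot, hW.deriv_quadratic hre hroot, hdn,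
    hW.eventually_ne_zero hre hroot] with p h1 h2 h3 h4
  have h5 : W p * deriv (Q P) p = (Q P p₀ * W p - Q P p) * deriv W p := by
    linear_combination (-1 / 2 : ℂ) * h2
  rw [div_pow, div_mul_eq_mul_div, ← mul_pow, h5, div_eq_iff (pow_ne_zero 2 h3)]
  linear_combination Q P p₀ * deriv W p ^ 2 * h1

/-- The inverse is the branch with the other sign of the root; it corresponds to κ ↦ -κ and T ↦ -T.
-/
theorem IsBranchW.inv (hre : p₀.re ≠ 0) (hroot : IsSimpleRoot P p₀) (hW : IsBranchW P p₀ W) :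
    IsBranchW P p₀ (fun p => (W p)⁻¹) := by
  have hne := hW.eventually_ne_zero hre hroot
  refine .of_quadratic hre hroot (hW.1.fun_inv hne.self_of_nhds) ?_
  filter_upwards [hne, hW.quadratic hre hroot] with p h1 h2
  field_simp
  linear_combination h2

/-- The logarithm of a branch `W` is a local coordinate at `p₀`, whose inverse is a matching
`p(κ)`. -/
theorem IsBranchW.exists_isBranchP (hre : p₀.re ≠ 0) (hroot : IsSimpleRoot P p₀)
    (hW : IsBranchW P p₀ W) :
    ∃ pκ, IsBranchP P p₀ pκ ∧ ∀ᶠ κ in 𝓝 (0 : ℂ), W (pκ κ) = Complex.exp κ := by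
  have hW1 := hW.apply_self hre hroot
  have hlog : AnalyticAt ℂ (fun p => Complex.log (W p)) p₀ :=
    hW.1.clog (by rw [hW1]; exact Complex.one_mem_slitPlane)
  have h0 : Complex.log (W p₀) = 0 := by rw [hW1, Complex.log_one]
  have hd : deriv (fun p => Complex.log (W p)) p₀ ≠ 0 := by
    have := hW.1.differentiableAt.hasDerivAt.clog (by rw [hW1]; exact Complex.one_mem_slitPlane)
    rw [this.deriv, hW1, div_one]
    exact hW.deriv_ne_zero hre hroot
  obtain ⟨g, hg, hg0, -, hfg⟩ := exists_analytic_local_inverse hlog hd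
  rw [h0] at hg hg0 hfg
  have htend : Tendsto g (𝓝 0) (𝓝 p₀) := by
    have := hg.continuousAt.tendsto
    rwa [hg0] at this
  have hexp : ∀ᶠ κ in 𝓝 (0 : ℂ), W (g κ) = Complex.exp κ := by
    filter_upwards [hfg, htend.eventually (hW.eventually_ne_zero hre hroot)] with κ h1 h2
    rw [← h1, Complex.exp_log h2, h1]
  refine ⟨g, ⟨hg, hg0, ?_⟩, hexp⟩
  filter_upwards [hexp, htend.eventually (hW.quadratic hre hroot)] with κ h1 h2
  rw [h1] at h2
  rw [Complex.cosh, Complex.exp_neg]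
  have := Complex.exp_ne_zero κ
  field_simp
  linear_combination -h2

end

theorem IsBranchP.exists_isBranchW (hre : p₀.re ≠ 0) (hroot : IsSimpleRoot P p₀) {pκ : ℂ → ℂ}
    (hp : IsBranchP P p₀ pκ) :
    ∃ W, IsBranchW P p₀ W ∧ ∀ᶠ κ in 𝓝 (0 : ℂ), W (pκ κ) = Complex.exp κ := by
  have hd : deriv pκ 0 ≠ 0 := by
    rw [← lam_one p₀]; exact lam_one_ne_zero hre hroot hp
  obtain ⟨g, hg, hg0, hgf, hfg⟩ := exists_analytic_local_inverse hp.1 hd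
  rw [hp.2.1] at hg hg0 hfg
  have htend : Tendsto g (𝓝 p₀) (𝓝 0) := by
    have := hg.continuousAt.tendsto
    rwa [hg0] at this
  refine ⟨fun p => Complex.exp (g p), .of_quadratic hre hroot hg.cexp' ?_, ?_⟩
  · filter_upwards [hfg, htend.eventually hp.2.2] with p h1 h2
    rw [h1, Complex.cosh, Complex.exp_neg] at h2
    rw [h2]
    have := Complex.exp_ne_zero (g p)
    field_simp
  · filter_upwards [hgf] with κ h1
    rw [h1]

/-- (T - T')(T + T') vanishes wherever Q' ≠ 0, hence on a punctured neighbourhood, and germs of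
analytic functions have no zero divisors. -/
theorem IsBranchT.eq_or_eq_neg (hre : p₀.re ≠ 0) (hroot : IsSimpleRoot P p₀) {T T' : ℂ → ℂ}
    (hT : IsBranchT P p₀ T) (hT' : IsBranchT P p₀ T') :
    (∀ᶠ p in 𝓝 p₀, T p = T' p) ∨ ∀ᶠ p in 𝓝 p₀, T p = -T' p := by
  have hQ' := (analyticAt_Q P hre).deriv.differentiableAt.hasDerivAt
  have h1 : ∀ᶠ p in 𝓝[≠] p₀, (T p - T' p) * (T p + T' p) = 0 := by
    filter_upwards [hQ'.eventually_ne (c := 0) hroot.2, hT.2.filter_mono nhdsWithin_le_nhds,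
      hT'.2.filter_mono nhdsWithin_le_nhds] with p h2 h3 h4
    have : ((T p - T' p) * (T p + T' p)) * deriv (Q P) p ^ 2 = 0 := by linear_combination h3 - h4
    exact (mul_eq_zero.1 this).resolve_right (pow_ne_zero 2 h2)
  rcases (hT.1.fun_sub hT'.1).eventually_eq_zero_or_eventually_ne_zero with h2 | h2
  · exact .inl (h2.mono fun p hp => sub_eq_zero.1 hp)
  · right
    have h3 : ∀ᶠ p in 𝓝[≠] p₀, T p + T' p = 0 := by
      filter_upwards [h1, h2] with p h3 h4
      exact (mul_eq_zero.1 h3).resolve_left h4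
    exact ((hT.1.fun_add hT'.1).frequently_zero_iff_eventually_zero.1 h3.frequently).mono
      fun p hp => eq_neg_of_add_eq_zero_left hp

theorem IsBranchT.exists_isBranchW (hre : p₀.re ≠ 0) (hroot : IsSimpleRoot P p₀) {T : ℂ → ℂ}
    (hT : IsBranchT P p₀ T) :
    ∃ W, IsBranchW P p₀ W ∧ ∀ᶠ p in 𝓝 p₀, T p * deriv W p = W p := by
  obtain ⟨W, hW⟩ := LSRI.exists_isBranchW hre hroot
  obtain ⟨hT', hTW⟩ := hW.isBranchT hre hroot
  rcases hT.eq_or_eq_neg hre hroot hT' with h | h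
  · refine ⟨W, hW, ?_⟩
    filter_upwards [h, hTW] with p h1 h2
    rw [h1, h2]
  · refine ⟨_, hW.inv hre hroot, ?_⟩
    filter_upwards [h, hTW, hW.eventually_ne_zero hre hroot, hW.1.eventually_analyticAt]
      with p h1 h2 h3 h4
    rw [h1, deriv_fun_inv'' h4.differentiableAt h3]
    rw [neg_mul, mul_div_assoc', mul_neg, h2]
    field_simp

theorem exists_branches (hre : p₀.re ≠ 0) (hroot : IsSimpleRoot P p₀) :
    (∃ T W pκ : ℂ → ℂ, IsBranchT P p₀ T ∧ IsBranchW P p₀ W ∧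
        IsBranchP P p₀ pκ ∧ Compatible p₀ T W pκ) ∧
      (∀ T : ℂ → ℂ, IsBranchT P p₀ T → ∃ W pκ : ℂ → ℂ,
        IsBranchW P p₀ W ∧ IsBranchP P p₀ pκ ∧ Compatible p₀ T W pκ) ∧
      (∀ W : ℂ → ℂ, IsBranchW P p₀ W → ∃ T pκ : ℂ → ℂ,
        IsBranchT P p₀ T ∧ IsBranchP P p₀ pκ ∧ Compatible p₀ T W pκ) ∧
      (∀ pκ : ℂ → ℂ, IsBranchP P p₀ pκ → ∃ T W : ℂ → ℂ,
        IsBranchT P p₀ T ∧ IsBranchW P p₀ W ∧ Compatible p₀ T W pκ) := by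
  have hWT : ∀ W : ℂ → ℂ, IsBranchW P p₀ W → ∃ T pκ : ℂ → ℂ,
      IsBranchT P p₀ T ∧ IsBranchP P p₀ pκ ∧ Compatible p₀ T W pκ := by
    intro W hW
    obtain ⟨pκ, hp, hWp⟩ := hW.exists_isBranchP hre hroot
    obtain ⟨hT, hTW⟩ := hW.isBranchT hre hroot
    exact ⟨_, pκ, hT, hp, hTW, hWp⟩
  refine ⟨?_, ?_, hWT, ?_⟩
  · obtain ⟨W, hW⟩ := exists_isBranchW hre hroot
    obtain ⟨T, pκ, hT, hp, hc⟩ := hWT W hW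
    exact ⟨T, W, pκ, hT, hW, hp, hc⟩
  · intro T hT
    obtain ⟨W, hW, hTW⟩ := hT.exists_isBranchW hre hroot
    obtain ⟨pκ, hp, hWp⟩ := hW.exists_isBranchP hre hroot
    exact ⟨W, pκ, hW, hp, hTW, hWp⟩
  · intro pκ hp
    obtain ⟨W, hW, hWp⟩ := hp.exists_isBranchW hre hroot
    obtain ⟨hT, hTW⟩ := hW.isBranchT hre hroot
    exact ⟨_, W, hT, hW, hTW, hWp⟩

end LSRI

namespace LSRI
open PowerSeries

/-! ### The differential operators in the coordinate `κ` -/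

theorem dOp_analyticAt {T F : ℂ → ℂ} {p₀ : ℂ} (hT : AnalyticAt ℂ T p₀) (hF : AnalyticAt ℂ F p₀)
    (s : ℕ) : AnalyticAt ℂ ((dOp T)^[s] F) p₀ := by
  induction s with
  | zero => exact hF
  | succ s ih => rw [Function.iterate_succ_apply']; exact hT.mul ih.deriv

/-- When T(p(κ)) = p'(κ), the chain rule turns T∂_p into d/dκ. -/
theorem dOp_iterate_comp {T F pκ : ℂ → ℂ} {p₀ : ℂ} (hT : AnalyticAt ℂ T p₀)
    (hF : AnalyticAt ℂ F p₀) (hp : AnalyticAt ℂ pκ 0) (h0 : pκ 0 = p₀)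
    (hTp : ∀ᶠ κ in 𝓝 (0 : ℂ), T (pκ κ) = deriv pκ κ) (s : ℕ) :
    ∀ᶠ κ in 𝓝 (0 : ℂ), (dOp T)^[s] F (pκ κ) = iteratedDeriv s (fun κ => F (pκ κ)) κ := by
  induction s with
  | zero => simp
  | succ s ih =>
    have htend : Tendsto pκ (𝓝 0) (𝓝 p₀) := by
      have := hp.continuousAt.tendsto
      rwa [h0] at this
    filter_upwards [ih.eventually_nhds, hTp, hp.eventually_analyticAt,
      htend.eventually (dOp_analyticAt hT hF s).eventually_analyticAt] with κ h1 h2 h3 h4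
    rw [iteratedDeriv_succ, Function.iterate_succ_apply', ← EventuallyEq.deriv_eq h1, dOp, h2]
    have := h4.differentiableAt.hasDerivAt.comp κ h3.differentiableAt.hasDerivAt
    rw [mul_comm]
    exact this.deriv.symm

theorem dOp_iterate_div_factorial {T F pκ : ℂ → ℂ} {p₀ : ℂ} (hT : AnalyticAt ℂ T p₀)
    (hF : AnalyticAt ℂ F p₀) (hp : AnalyticAt ℂ pκ 0) (h0 : pκ 0 = p₀)
    (hTp : ∀ᶠ κ in 𝓝 (0 : ℂ), T (pκ κ) = deriv pκ κ) (s : ℕ) :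
    (dOp T)^[s] F p₀ = s.factorial * taylorCoeff (fun κ => F (pκ κ)) s := by
  have := (dOp_iterate_comp hT hF hp h0 hTp s).self_of_nhds
  rw [h0] at this
  rw [this, taylorCoeff, mul_div_cancel₀]
  exact_mod_cast Nat.factorial_ne_zero s

theorem dOp_iterate_congr {T T' F F' : ℂ → ℂ} {p₀ c ε : ℂ} (hT : ∀ᶠ p in 𝓝 p₀, T p = ε * T' p)
    (hF : ∀ᶠ p in 𝓝 p₀, F p = c * F' p) (s : ℕ) :
    ∀ᶠ p in 𝓝 p₀, (dOp T)^[s] F p = c * ε ^ s * (dOp T')^[s] F' p := by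
  induction s with
  | zero => simpa using hF
  | succ s ih =>
    filter_upwards [ih.eventually_nhds, hT] with p h1 h2
    rw [Function.iterate_succ_apply', Function.iterate_succ_apply', dOp, dOp,
      EventuallyEq.deriv_eq h1, deriv_const_mul_field, h2]
    ring

variable {P : Params} {p₀ : ℂ} {T W pκ : ℂ → ℂ}

/-- Changing the sign of `T` multiplies the matrix entries by signs. -/
theorem entryDiff_congr {T' : ℂ → ℂ} {ε : ℝ} (hT : ∀ᶠ p in 𝓝 p₀, T p = ε * T' p) (a : ℕ → ℂ)
    (n k : ℤ) (x t : ℝ) (s j : ℕ) :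
    entryDiff P p₀ T W a n k x t s j = ε ^ (s + j) * entryDiff P p₀ T' W a n k x t s j := by
  have hT' : ∀ᶠ q in 𝓝 (conj p₀), conj (T (conj q)) = ε * conj (T' (conj q)) := by
    have := (Complex.continuous_conj.tendsto (conj p₀))
    rw [Complex.conj_conj] at this
    filter_upwards [this.eventually hT] with q hq
    rw [hq, map_mul, Complex.conj_ofReal]
  have h := (dOp_iterate_congr hT (.of_forall fun p => (dOp_iterate_congr (c := 1)
    (F := fun q => kernel P W a n k x t p q) (F' := fun q => kernel P W a n k x t p q) hT'
      (by simp) j).self_of_nhds) s).self_of_nhds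
  rw [entryDiff, entryDiff, h, pow_add]
  ring

theorem tauDiff_congr {T' : ℂ → ℂ} {ε : ℝ} (hε : ε ^ 2 = 1)
    (hT : ∀ᶠ p in 𝓝 p₀, T p = ε * T' p) (a : ℕ → ℂ) (N : ℕ) :
    tauDiff P p₀ T W a N = tauDiff P p₀ T' W a N := by
  funext n k x t
  have hε' : (ε : ℂ) ^ 2 = 1 := by exact_mod_cast hε
  rw [tauDiff, tauDiff]
  congr 1
  ext s j
  -- A change of sign of T multiplies an entry by (-1)^(s+j), and the sum of two odd indices is
  -- even.
  rw [Matrix.of_apply, Matrix.of_apply, entryDiff_congr hT,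
    show 2 * (s : ℕ) + 1 + (2 * (j : ℕ) + 1) = 2 * ((s : ℕ) + j + 1) by ring, pow_mul, hε', one_pow,
    one_mul]

/-! ### Factorization of the kernel -/

/-- The factor of the kernel that depends on `p`, normalized at `p₀`. -/
noncomputable def kernelFactor (P : Params) (p₀ : ℂ) (W : ℂ → ℂ) (a : ℕ → ℂ) (n k : ℤ) (x t : ℝ)
    (p : ℂ) : ℂ :=
  (p₀ + conj p₀) / (p + conj p₀) * ((p - Complex.I * P.k₁) / (p₀ - Complex.I * P.k₁)) ^ n
    * ((p - Complex.I * P.k₂) / (p₀ - Complex.I * P.k₂)) ^ k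
    * Complex.exp (xi W a x t p - xi W a x t p₀)

/-- The Cayley-type coordinate `(p - p₀) / (p + p₀*)`. -/
noncomputable def cayley (p₀ p : ℂ) : ℂ := (p - p₀) / (p + conj p₀)

theorem add_conj_ne_zero_of_mul_pos {p q : ℂ} (hp : 0 < p.re * p₀.re) (hq : 0 < q.re * p₀.re) :
    p + conj q ≠ 0 := by
  intro h
  have := congrArg Complex.re h
  simp only [Complex.add_re, Complex.conj_re, Complex.zero_re] at this
  have h2 : 0 < (p.re + q.re) * p₀.re := by rw [add_mul]; exact add_pos hp hq
  rw [this, zero_mul] at h2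
  exact lt_irrefl _ h2

theorem re_ne_zero_of_mul_pos {p : ℂ} (hp : 0 < p.re * p₀.re) : p.re ≠ 0 :=
  left_ne_zero_of_mul hp.ne'

theorem one_sub_cayley_ne_zero (hre : p₀.re ≠ 0) {p q : ℂ} (hp : 0 < p.re * p₀.re)
    (hq : 0 < q.re * p₀.re) : 1 - cayley p₀ p * conj (cayley p₀ q)
      = (p + conj q) * (p₀ + conj p₀) / ((p + conj p₀) * conj (q + conj p₀)) ∧
    1 - cayley p₀ p * conj (cayley p₀ q) ≠ 0 := by
  have h0 : 0 < p₀.re * p₀.re := mul_self_pos.2 hre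
  have h1 := add_conj_ne_zero_of_mul_pos hp h0
  have h2 := add_conj_ne_zero_of_mul_pos hq h0
  have h2' : conj (q + conj p₀) ≠ 0 := (_root_.map_ne_zero _).2 h2
  have h3 := add_conj_ne_zero_of_mul_pos hp hq
  have h4 := add_conj_ne_zero_of_mul_pos h0 h0
  have e : 1 - cayley p₀ p * conj (cayley p₀ q)
      = (p + conj q) * (p₀ + conj p₀) / ((p + conj p₀) * conj (q + conj p₀)) := by
    rw [cayley, cayley, map_div₀, div_mul_div_comm, eq_div_iff (mul_ne_zero h1 h2'), sub_mul,
      div_mul_cancel₀ _ (mul_ne_zero h1 h2')]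
    simp only [map_sub, map_add, Complex.conj_conj]
    ring
  exact ⟨e, e ▸ div_ne_zero (mul_ne_zero h3 h4) (mul_ne_zero h1 h2')⟩

/-- The part depending on β is a conjugated power with exponent -n; hence the factor in p* is
`kernelFactor` at (-n, -k). -/
theorem zpow_split {α α₀ β : ℂ} (h0 : α₀ ≠ 0) (n : ℤ) :
    (-(α / conj β)) ^ n = (-(α₀ / conj α₀)) ^ n * (α / α₀) ^ n * conj ((β / α₀) ^ (-n)) := by
  have h0' : conj α₀ ≠ 0 := by simpa using h0
  rw [map_zpow₀, map_div₀, zpow_neg, ← inv_zpow, inv_div, ← mul_zpow, ← mul_zpow]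
  congr 1
  field_simp

/-- Each factor is divided by its value at p₀. Only 1/(p + p*) couples the variables, and it
contributes (1 - cayley · conj cayley)⁻¹. The half-plane conditions keep all denominators nonzero.
-/
theorem kernel_eq (hre : p₀.re ≠ 0) (a : ℕ → ℂ) (n k : ℤ) (x t : ℝ) {p q : ℂ}
    (hp : 0 < p.re * p₀.re) (hq : 0 < q.re * p₀.re) :
    kernel P W a n k x t p (conj q) = kernel P W a n k x t p₀ (conj p₀)
      * (kernelFactor P p₀ W a n k x t p * conj (kernelFactor P p₀ W a (-n) (-k) x t q)
        * (1 - cayley p₀ p * conj (cayley p₀ q))⁻¹) := by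
  have h0 : 0 < p₀.re * p₀.re := mul_self_pos.2 hre
  have h1 := add_conj_ne_zero_of_mul_pos hp h0
  have h2 := add_conj_ne_zero_of_mul_pos hq h0
  have h2' : conj (q + conj p₀) ≠ 0 := (_root_.map_ne_zero _).2 h2
  have h3 := add_conj_ne_zero_of_mul_pos hp hq
  have h4 := add_conj_ne_zero_of_mul_pos h0 h0
  have hc : ∀ (r : ℂ) (m : ℝ), conj r + Complex.I * m = conj (r - Complex.I * m) := by
    intro r m; simp
  have hr : 1 / (p + conj q) = 1 / (p₀ + conj p₀) * ((p₀ + conj p₀) / (p + conj p₀))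
      * conj ((p₀ + conj p₀) / (q + conj p₀)) * (1 - cayley p₀ p * conj (cayley p₀ q))⁻¹ := by
    rw [(one_sub_cayley_ne_zero hre hp hq).1, map_div₀, conj_add_conj]
    field_simp
  have hE : Complex.exp (xi W a x t p + conj (xi W a x t q))
      = Complex.exp (xi W a x t p₀ + conj (xi W a x t p₀))
        * Complex.exp (xi W a x t p - xi W a x t p₀)
        * conj (Complex.exp (xi W a x t q - xi W a x t p₀)) := by
    rw [← Complex.exp_conj, ← Complex.exp_add, ← Complex.exp_add, map_sub]
    congr 1; ring
  rw [kernel, kernel, kernelFactor, kernelFactor, hc, hc, hc, hc, Complex.conj_conj,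
    Complex.conj_conj, hr, hE, zpow_split (sub_I_mul_ne hre P.k₁) n,
    zpow_split (sub_I_mul_ne hre P.k₂) k]
  simp only [map_mul]
  ring

theorem kernel_self_ne_zero (hre : p₀.re ≠ 0) (a : ℕ → ℂ) (n k : ℤ) (x t : ℝ) :
    kernel P W a n k x t p₀ (conj p₀) ≠ 0 := by
  have hc : ∀ m : ℝ, conj p₀ + Complex.I * m = conj (p₀ - Complex.I * m) := by intro m; simp
  have hk : ∀ m : ℝ, -((p₀ - Complex.I * m) / conj (p₀ - Complex.I * m)) ≠ 0 := fun m =>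
    neg_ne_zero.2 (div_ne_zero (sub_I_mul_ne hre m)
      ((_root_.map_ne_zero _).2 (sub_I_mul_ne hre m)))
  rw [kernel, hc, hc]
  exact mul_ne_zero (mul_ne_zero (mul_ne_zero (one_div_ne_zero (add_conj_ne rfl hre))
    (zpow_ne_zero _ (hk _))) (zpow_ne_zero _ (hk _))) (Complex.exp_ne_zero _)

theorem analyticAt_xi {a : ℕ → ℂ} (ha : ConvergesNearZero a) (hW : AnalyticAt ℂ W p₀)
    (hW1 : W p₀ = 1) (x t : ℝ) : AnalyticAt ℂ (xi W a x t) p₀ := by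
  have hlog : AnalyticAt ℂ (fun p => Complex.log (W p)) p₀ :=
    hW.clog (by rw [hW1]; exact Complex.one_mem_slitPlane)
  have hs := analyticAt_of_convergesNearZero ha
  have h0 : Complex.log (W p₀) = 0 := by rw [hW1, Complex.log_one]
  have hs' : AnalyticAt ℂ (fun p => ∑' r : ℕ, a (r + 1) * Complex.log (W p) ^ (r + 1)) p₀ :=
    AnalyticAt.fun_comp (f := fun p => Complex.log (W p)) (by rw [h0]; exact hs) hlog
  exact ((analyticAt_id.mul analyticAt_const).sub
    ((analyticAt_const.mul (analyticAt_id.pow 2)).mul analyticAt_const)).add hs'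

theorem xi_self (a : ℕ → ℂ) (hW1 : W p₀ = 1) (x t : ℝ) :
    xi W a x t p₀ = p₀ * x - Complex.I * p₀ ^ 2 * t := by
  simp [xi, hW1]

theorem analyticAt_kernelFactor (hre : p₀.re ≠ 0) {a : ℕ → ℂ} (ha : ConvergesNearZero a)
    (hW : AnalyticAt ℂ W p₀) (hW1 : W p₀ = 1) (n k : ℤ) (x t : ℝ) :
    AnalyticAt ℂ (kernelFactor P p₀ W a n k x t) p₀ := by
  have h4 : p₀ + conj p₀ ≠ 0 := add_conj_ne rfl hre
  have hz : ∀ (m : ℝ) (n : ℤ), AnalyticAt ℂ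
      (fun p => ((p - Complex.I * m) / (p₀ - Complex.I * m)) ^ n) p₀ := fun m n =>
    ((analyticAt_id.sub analyticAt_const).div_const).fun_zpow
      (div_ne_zero (sub_I_mul_ne hre m) (sub_I_mul_ne hre m))
  exact (((analyticAt_const.fun_div (analyticAt_id.add analyticAt_const) h4).mul (hz _ _)).mul
    (hz _ _)).mul ((analyticAt_xi ha hW hW1 x t).sub analyticAt_const).cexp

theorem analyticAt_cayley (hre : p₀.re ≠ 0) : AnalyticAt ℂ (cayley p₀) p₀ :=
  (analyticAt_id.sub analyticAt_const).fun_div (analyticAt_id.add analyticAt_const)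
    (add_conj_ne rfl hre)

theorem expSer_congr {y z : ℕ → ℂ} (h : ∀ r, 1 ≤ r → y r = z r) : expSer y = expSer z := by
  have : serOf y = serOf z := by
    ext j
    cases j with
    | zero => simp [serOf]
    | succ j => rw [coeff_serOf_succ, coeff_serOf_succ, h _ (by omega)]
  rw [expSer, expSer, this]

theorem tps_cayley (hre : p₀.re ≠ 0) (hroot : IsSimpleRoot P p₀) (hp : IsBranchP P p₀ pκ) :
    tps (fun κ => cayley p₀ (pκ κ)) = uSer p₀ pκ := by
  have h4 : p₀ + conj p₀ ≠ 0 := add_conj_ne rfl hre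
  have hne : ∀ᶠ κ in 𝓝 (0 : ℂ), pκ κ + conj p₀ ≠ 0 :=
    (hp.1.add analyticAt_const).continuousAt.eventually_ne (by rwa [Pi.add_apply, hp.2.1])
  have hc : AnalyticAt ℂ (fun κ => cayley p₀ (pκ κ)) 0 :=
    (analyticAt_cayley hre).comp_of_eq hp.1 hp.2.1
  have h1 : tps (fun κ => cayley p₀ (pκ κ)) * (tps pκ + C (conj p₀)) = tps pκ - C p₀ := by
    rw [← tps_const, ← tps_const, ← tps_add hp.1 analyticAt_const, ← tps_sub hp.1 analyticAt_const,
      ← tps_mul hc (hp.1.fun_add analyticAt_const)]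
    refine tps_congr ?_
    filter_upwards [hne] with κ hκ
    rw [cayley, div_mul_cancel₀ _ hκ]
  have h2 : tps pκ + C (conj p₀) ≠ 0 := by
    intro h
    have := congrArg constantCoeff h
    rw [map_add, constantCoeff_tps, hp.2.1, constantCoeff_C, map_zero] at this
    exact h4 this
  exact mul_right_cancel₀ h2 (h1.trans (uSer_mul hre hroot hp).symm)

/-- Along p(κ) one has ln W = κ, so the series in ξ contributes ∑ a'_rκ^r, while (p₀ + p₀*)/(p +
p₀*) contributes -∑ b_rκ^r: the reason for the shift a = a' - b. -/
theorem tps_kernelFactor (hre : p₀.re ≠ 0) (hp : IsBranchP P p₀ pκ)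
    (hWp : ∀ᶠ κ in 𝓝 (0 : ℂ), W (pκ κ) = Complex.exp κ) {a' a : ℕ → ℂ} (ha : ConvergesNearZero a')
    (haa : ∀ r : ℕ, 1 ≤ r → a r = a' r - bCoeff p₀ pκ r) (n k : ℤ) (x t : ℝ) :
    tps (fun κ => kernelFactor P p₀ W a' n k x t (pκ κ)) = expSer (xPlus P p₀ pκ a n k x t) := by
  have h4 : p₀ + conj p₀ ≠ 0 := add_conj_ne rfl hre
  have hpa := hp.1
  have hp0 := hp.2.1
  have hW1 : W p₀ = 1 := by
    have := hWp.self_of_nhds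
    rwa [hp0, Complex.exp_zero] at this
  have hre' : ∀ᶠ κ in 𝓝 (0 : ℂ), 0 < (pκ κ).re * p₀.re := by
    have : ContinuousAt (fun κ => (pκ κ).re * p₀.re) 0 :=
      (Complex.continuous_re.continuousAt.comp hpa.continuousAt).mul continuousAt_const
    exact this.eventually_const_lt (by simp only [hp0]; exact mul_self_pos.2 hre)
  have hlog : ∀ m : ℝ, AnalyticAt ℂ
      (fun κ => Complex.log ((pκ κ - Complex.I * m) / (p₀ - Complex.I * m))) 0 := fun m =>
    ((hpa.fun_sub analyticAt_const).div_const).clog (by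
      rw [hp0, div_self (sub_I_mul_ne hre m)]; exact Complex.one_mem_slitPlane)
  have hlogb : AnalyticAt ℂ (fun κ => Complex.log ((pκ κ + conj p₀) / (p₀ + conj p₀))) 0 :=
    ((hpa.fun_add analyticAt_const).div_const).clog (by
      rw [hp0, div_self h4]; exact Complex.one_mem_slitPlane)
  have hser := analyticAt_of_convergesNearZero ha
  have hl : AnalyticAt ℂ (fun κ => pκ κ - p₀) 0 := hpa.fun_sub analyticAt_const
  have hβ : AnalyticAt ℂ (fun κ => pκ κ ^ 2 - p₀ ^ 2) 0 := (hpa.fun_pow 2).fun_sub analyticAt_const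
  have e1 : AnalyticAt ℂ (fun κ => (x : ℂ) * (pκ κ - p₀)) 0 := analyticAt_const.fun_mul hl
  have e2 : AnalyticAt ℂ (fun κ => (-(Complex.I * t)) * (pκ κ ^ 2 - p₀ ^ 2)) 0 :=
    analyticAt_const.fun_mul hβ
  have e3 : AnalyticAt ℂ (fun κ => (n : ℂ)
      * Complex.log ((pκ κ - Complex.I * P.k₁) / (p₀ - Complex.I * P.k₁))) 0 :=
    analyticAt_const.fun_mul (hlog _)
  have e4 : AnalyticAt ℂ (fun κ => (k : ℂ)
      * Complex.log ((pκ κ - Complex.I * P.k₂) / (p₀ - Complex.I * P.k₂))) 0 :=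
    analyticAt_const.fun_mul (hlog _)
  set X : ℂ → ℂ := fun κ => (x : ℂ) * (pκ κ - p₀) + (-(Complex.I * t)) * (pκ κ ^ 2 - p₀ ^ 2)
    + (n : ℂ) * Complex.log ((pκ κ - Complex.I * P.k₁) / (p₀ - Complex.I * P.k₁))
    + (k : ℂ) * Complex.log ((pκ κ - Complex.I * P.k₂) / (p₀ - Complex.I * P.k₂))
    + ∑' r : ℕ, a' (r + 1) * κ ^ (r + 1)
    - Complex.log ((pκ κ + conj p₀) / (p₀ + conj p₀)) with hX
  have hXa : AnalyticAt ℂ X 0 := ((((e1.fun_add e2).fun_add e3).fun_add e4).fun_add hser).fun_sub hlogb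
  have hX0 : X 0 = 0 := by
    simp [hX, hp0, div_self h4, div_self (sub_I_mul_ne hre P.k₁), div_self (sub_I_mul_ne hre P.k₂)]
  have hcoef : ∀ r, 1 ≤ r → taylorCoeff X r = xPlus P p₀ pκ a n k x t r := by
    intro r hr
    have : tps X = C (x : ℂ) * tps (fun κ => pκ κ - p₀)
        + C (-(Complex.I * t)) * tps (fun κ => pκ κ ^ 2 - p₀ ^ 2)
        + C (n : ℂ) * tps (fun κ => Complex.log ((pκ κ - Complex.I * P.k₁) / (p₀ - Complex.I * P.k₁)))
        + C (k : ℂ) * tps (fun κ => Complex.log ((pκ κ - Complex.I * P.k₂) / (p₀ - Complex.I * P.k₂)))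
        + serOf a' - tps (fun κ => Complex.log ((pκ κ + conj p₀) / (p₀ + conj p₀))) := by
      rw [hX, tps_sub ((((e1.fun_add e2).fun_add e3).fun_add e4).fun_add hser) hlogb,
        tps_add (((e1.fun_add e2).fun_add e3).fun_add e4) hser,
        tps_add ((e1.fun_add e2).fun_add e3) e4, tps_add (e1.fun_add e2) e3, tps_add e1 e2,
        tps_const_mul _ hl, tps_const_mul _ hβ, tps_const_mul _ (hlog _), tps_const_mul _ (hlog _),
        tps_of_convergesNearZero ha]
    obtain ⟨r, rfl⟩ : ∃ i, r = i + 1 := ⟨r - 1, by omega⟩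
    rw [← coeff_tps, this]
    simp only [map_add, map_sub, coeff_C_mul, coeff_serOf_succ, coeff_tps]
    rw [xPlus, haa _ hr, lam, beta, theta, theta, bCoeff]
    ring
  rw [← expSer_congr hcoef, ← tps_exp hXa hX0]
  refine tps_congr ?_
  -- Within this strip the principal logarithm inverts exp, so log W(p(κ)) is exactly κ.
  have him : ∀ᶠ κ in 𝓝 (0 : ℂ), |κ.im| < Real.pi := by
    have : ContinuousAt (fun κ : ℂ => |κ.im|) 0 := (Complex.continuous_im.abs).continuousAt
    exact this.eventually_lt_const (by simpa using Real.pi_pos)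
  filter_upwards [hre', hWp, him] with κ h1 h2 h3
  have hlogκ : Complex.log (W (pκ κ)) = κ := by
    rw [h2, Complex.log_exp (abs_lt.1 h3).1 (abs_lt.1 h3).2.le]
  have hb := add_conj_ne_zero_of_mul_pos h1 (mul_self_pos.2 hre)
  have hk : ∀ m : ℝ, (pκ κ - Complex.I * m) / (p₀ - Complex.I * m) ≠ 0 := fun m =>
    div_ne_zero (sub_I_mul_ne (re_ne_zero_of_mul_pos h1) m) (sub_I_mul_ne hre m)
  simp only [hX]
  rw [Complex.exp_sub, Complex.exp_log (div_ne_zero hb h4), kernelFactor, xi_self a' hW1, xi, hlogκ]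
  have e : (x : ℂ) * (pκ κ - p₀) + (-(Complex.I * t)) * (pκ κ ^ 2 - p₀ ^ 2)
    + (n : ℂ) * Complex.log ((pκ κ - Complex.I * P.k₁) / (p₀ - Complex.I * P.k₁))
    + (k : ℂ) * Complex.log ((pκ κ - Complex.I * P.k₂) / (p₀ - Complex.I * P.k₂))
    + ∑' r : ℕ, a' (r + 1) * κ ^ (r + 1)
    = (n : ℂ) * Complex.log ((pκ κ - Complex.I * P.k₁) / (p₀ - Complex.I * P.k₁))
    + (k : ℂ) * Complex.log ((pκ κ - Complex.I * P.k₂) / (p₀ - Complex.I * P.k₂))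
    + (pκ κ * x - Complex.I * pκ κ ^ 2 * t + ∑' r : ℕ, a' (r + 1) * κ ^ (r + 1)
      - (p₀ * x - Complex.I * p₀ ^ 2 * t)) := by ring
  rw [e, Complex.exp_add, Complex.exp_add, Complex.exp_int_mul, Complex.exp_int_mul,
    Complex.exp_log (hk _), Complex.exp_log (hk _)]
  field_simp

end LSRI

namespace LSRI
open PowerSeries

/-! ### Equivalence of the two forms -/

theorem tps_sum {ι : Type*} (s : Finset ι) {F : ι → ℂ → ℂ} (hF : ∀ i ∈ s, AnalyticAt ℂ (F i) 0) :
    tps (fun z => ∑ i ∈ s, F i z) = ∑ i ∈ s, tps (F i) := by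
  classical
  induction s using Finset.induction_on with
  | empty => simpa using tps_const 0
  | insert i s hi ih =>
    simp only [Finset.sum_insert hi]
    rw [tps_add (hF i (Finset.mem_insert_self i s))
      (Finset.analyticAt_fun_sum _ fun j hj => hF j (Finset.mem_insert_of_mem hj)),
      ih fun j hj => hF j (Finset.mem_insert_of_mem hj)]

/-- As B vanishes at 0, B^ν affects only degrees at least ν and coefficient j sees finitely many
terms. The expansion is formal in σ, so u need not be small. -/
theorem taylorCoeff_mul_geometric {V B : ℂ → ℂ} (hV : AnalyticAt ℂ V 0) (hB : AnalyticAt ℂ B 0)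
    (hB0 : B 0 = 0) (u : ℂ) (j : ℕ) :
    taylorCoeff (fun σ => V σ * (1 - u * B σ)⁻¹) j
      = ∑ ν ∈ Finset.range (j + 1), u ^ ν * coeff j (tps V * tps B ^ ν) := by
  have h1 : AnalyticAt ℂ (fun σ => 1 - u * B σ) 0 :=
    analyticAt_const.fun_sub (analyticAt_const.fun_mul hB)
  have h10 : 1 - u * B 0 ≠ 0 := by rw [hB0]; simp
  set G := tps (fun σ => V σ * (1 - u * B σ)⁻¹) with hG
  have hGV : G * (1 - C u * tps B) = tps V := by
    rw [← tps_const_mul u hB, ← map_one (C (R := ℂ)), ← tps_const,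
      ← tps_sub analyticAt_const (analyticAt_const.fun_mul hB), hG,
      ← tps_mul (hV.fun_mul (h1.fun_inv h10)) h1]
    refine tps_congr ?_
    filter_upwards [h1.continuousAt.eventually_ne h10] with σ hσ
    rw [mul_assoc, inv_mul_cancel₀ hσ, mul_one]
  have hX : X ∣ tps B := X_dvd_iff.2 (by rw [constantCoeff_tps, hB0])
  have h2 : G = ∑ ν ∈ Finset.range (j + 1), tps V * (C u * tps B) ^ ν
      + G * (C u * tps B) ^ (j + 1) := by
    rw [← Finset.mul_sum, ← hGV, mul_assoc, mul_neg_geom_sum]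
    ring
  have h3 : coeff j (G * (C u * tps B) ^ (j + 1)) = 0 := by
    have : X ^ (j + 1) ∣ G * (C u * tps B) ^ (j + 1) :=
      Dvd.dvd.mul_left (pow_dvd_pow_of_dvd (Dvd.dvd.mul_left hX _) _) _
    exact X_pow_dvd_iff.1 this j (Nat.lt_succ_self j)
  rw [← coeff_tps, ← hG, h2, map_add, h3, add_zero, map_sum]
  refine Finset.sum_congr rfl fun ν _ => ?_
  rw [mul_pow, ← map_pow, mul_left_comm, coeff_C_mul]

variable {P : Params} {p₀ : ℂ} {T W pκ : ℂ → ℂ}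

theorem Compatible.apply_self (hc : Compatible p₀ T W pκ) (h0 : pκ 0 = p₀) : W p₀ = 1 := by
  have := hc.2.self_of_nhds
  rwa [h0, Complex.exp_zero] at this

/-- Differentiating W(p(κ)) = e^κ gives W'(p)p' = W(p) = T(p)W'(p), with W'(p) ≠ 0. -/
theorem Compatible.eventually_eq_deriv (hc : Compatible p₀ T W pκ) (hW : AnalyticAt ℂ W p₀)
    (hp : AnalyticAt ℂ pκ 0) (h0 : pκ 0 = p₀) : ∀ᶠ κ in 𝓝 (0 : ℂ), T (pκ κ) = deriv pκ κ := by
  have htend : Tendsto pκ (𝓝 0) (𝓝 p₀) := by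
    have := hp.continuousAt.tendsto
    rwa [h0] at this
  filter_upwards [hc.2.eventually_nhds, htend.eventually hc.1, hp.eventually_analyticAt,
    htend.eventually hW.eventually_analyticAt] with κ h1 h2 h3 h4
  have h5 := h4.differentiableAt.hasDerivAt.comp κ h3.differentiableAt.hasDerivAt
  have h6 := (h5.congr_of_eventuallyEq (EventuallyEq.symm h1)).unique (Complex.hasDerivAt_exp κ)
  rw [h1.self_of_nhds] at h2
  have h7 : deriv W (pκ κ) ≠ 0 := by
    intro h
    rw [h, mul_zero] at h2
    exact Complex.exp_ne_zero κ h2.symm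
  refine mul_right_cancel₀ h7 ?_
  rw [h2, ← h6, mul_comm]

theorem eventually_mul_re_pos (hre : p₀.re ≠ 0) : ∀ᶠ p in 𝓝 p₀, 0 < p.re * p₀.re := by
  have : ContinuousAt (fun p : ℂ => p.re * p₀.re) p₀ :=
    Complex.continuous_re.continuousAt.mul continuousAt_const
  exact this.eventually_const_lt (mul_self_pos.2 hre)

theorem conj_expSer_xPlus_neg (a : ℕ → ℂ) (n k : ℤ) (x t : ℝ) :
    bar (expSer (xPlus P p₀ pκ a (-n) (-k) x t)) = expSer (xMinus P p₀ pκ a n k x t) := by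
  rw [bar_expSer]
  congr 1
  funext r
  simp [xPlus, xMinus]
  ring

/-- Iterated application of the operator in `p*`. -/
theorem dOp_iterate_kernel (hre : p₀.re ≠ 0) (hroot : IsSimpleRoot P p₀) (hT : AnalyticAt ℂ T p₀)
    (hW : AnalyticAt ℂ W p₀) (hp : IsBranchP P p₀ pκ) (hc : Compatible p₀ T W pκ) {a' a : ℕ → ℂ}
    (ha : ConvergesNearZero a') (haa : ∀ r : ℕ, 1 ≤ r → a r = a' r - bCoeff p₀ pκ r) (n k : ℤ)
    (x t : ℝ) (j : ℕ) {p : ℂ} (hpp : 0 < p.re * p₀.re) :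
    (dOp fun q => conj (T (conj q)))^[j] (fun q => kernel P W a' n k x t p q) (conj p₀)
      = j.factorial * (kernel P W a' n k x t p₀ (conj p₀) * (kernelFactor P p₀ W a' n k x t p
        * ∑ ν ∈ Finset.range (j + 1), cayley p₀ p ^ ν
          * coeff j (expSer (xMinus P p₀ pκ a n k x t) * bar (uSer p₀ pκ) ^ ν))) := by
  have hW1 := hc.apply_self hp.2.1
  have hconj : Tendsto (fun q : ℂ => conj q) (𝓝 (conj p₀)) (𝓝 p₀) := by
    have := Complex.continuous_conj.tendsto (conj p₀)
    rwa [Complex.conj_conj] at this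
  have hconj0 : Tendsto (fun q : ℂ => conj q) (𝓝 0) (𝓝 0) := by
    have := Complex.continuous_conj.tendsto 0
    rwa [map_zero] at this
  have hkf := analyticAt_kernelFactor (P := P) hre ha hW hW1 (-n) (-k) x t
  have hca := analyticAt_cayley (p₀ := p₀) hre
  have han : ∀ {F : ℂ → ℂ}, AnalyticAt ℂ F p₀ → AnalyticAt ℂ (fun q => conj (F (conj q))) (conj p₀) :=
    fun {F} hF => AnalyticAt.conj_conj' (by rwa [Complex.conj_conj])
  have hcay0 : cayley p₀ p₀ = 0 := by simp [cayley]
  have hF : AnalyticAt ℂ (fun q => kernel P W a' n k x t p q) (conj p₀) := by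
    have h1 : AnalyticAt ℂ (fun q => kernel P W a' n k x t p₀ (conj p₀)
        * (kernelFactor P p₀ W a' n k x t p * conj (kernelFactor P p₀ W a' (-n) (-k) x t (conj q))
          * (1 - cayley p₀ p * conj (cayley p₀ (conj q)))⁻¹)) (conj p₀) := by
      refine analyticAt_const.fun_mul ((analyticAt_const.fun_mul (han hkf)).fun_mul
        ((analyticAt_const.fun_sub (analyticAt_const.fun_mul (han hca))).fun_inv ?_))
      rw [Complex.conj_conj, hcay0]; simp
    refine h1.congr ?_
    filter_upwards [hconj.eventually (eventually_mul_re_pos hre)] with q hq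
    have := kernel_eq (P := P) (W := W) hre a' n k x t hpp hq
    rw [Complex.conj_conj] at this
    exact this.symm
  have hpc : AnalyticAt ℂ (fun σ => conj (pκ (conj σ))) 0 :=
    AnalyticAt.conj_conj' (by rw [map_zero]; exact hp.1)
  have hTc : ∀ᶠ σ in 𝓝 (0 : ℂ), conj (T (conj (conj (pκ (conj σ)))))
      = deriv (fun σ => conj (pκ (conj σ))) σ := by
    filter_upwards [hconj0.eventually (hc.eventually_eq_deriv hW hp.1 hp.2.1)] with σ hσ
    have := congrFun (iteratedDeriv_conj_conj pκ 1) σ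
    rw [iteratedDeriv_one, iteratedDeriv_one] at this
    rw [this, Complex.conj_conj, hσ]
  rw [dOp_iterate_div_factorial (han hT) hF hpc (by rw [map_zero, hp.2.1]) hTc]
  congr 1
  have htend : Tendsto pκ (𝓝 0) (𝓝 p₀) := by
    have := hp.1.continuousAt.tendsto
    rwa [hp.2.1] at this
  have hV : AnalyticAt ℂ (fun σ => conj (kernelFactor P p₀ W a' (-n) (-k) x t (pκ (conj σ)))) 0 :=
    AnalyticAt.conj_conj' (F := fun κ => kernelFactor P p₀ W a' (-n) (-k) x t (pκ κ))
      (by rw [map_zero]; exact hkf.comp_of_eq hp.1 hp.2.1)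
  have hB : AnalyticAt ℂ (fun σ => conj (cayley p₀ (pκ (conj σ)))) 0 :=
    AnalyticAt.conj_conj' (F := fun κ => cayley p₀ (pκ κ))
      (by rw [map_zero]; exact hca.comp_of_eq hp.1 hp.2.1)
  have hB0 : conj (cayley p₀ (pκ (conj 0))) = 0 := by
    rw [map_zero, hp.2.1, hcay0, map_zero]
  have hg := taylorCoeff_mul_geometric hV hB hB0 (cayley p₀ p) j
  rw [tps_conj (fun κ => kernelFactor P p₀ W a' (-n) (-k) x t (pκ κ)),
    tps_conj (fun κ => cayley p₀ (pκ κ)), tps_cayley hre hroot hp,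
    tps_kernelFactor hre hp hc.2 ha haa, conj_expSer_xPlus_neg] at hg
  rw [← hg, ← mul_assoc, ← coeff_tps, ← coeff_tps, ← coeff_C_mul, ← tps_const_mul]
  · congr 1
    refine tps_congr ?_
    filter_upwards [hconj0.eventually (htend.eventually (eventually_mul_re_pos hre))] with σ hσ
    rw [kernel_eq (P := P) (W := W) hre a' n k x t hpp hσ]
    ring
  · refine hV.fun_mul ((analyticAt_const.fun_sub (analyticAt_const.fun_mul hB)).fun_inv ?_)
    rw [hB0]; simp

/-- The operator in p* is applied first, for every p near p₀; it leaves a finite sum of powers of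
the Cayley coordinate of p. The operator in p then extracts coefficient s. -/
theorem entryDiff_eq (hre : p₀.re ≠ 0) (hroot : IsSimpleRoot P p₀) (hT : AnalyticAt ℂ T p₀)
    (hW : AnalyticAt ℂ W p₀) (hp : IsBranchP P p₀ pκ) (hc : Compatible p₀ T W pκ) {a' a : ℕ → ℂ}
    (ha : ConvergesNearZero a') (haa : ∀ r : ℕ, 1 ≤ r → a r = a' r - bCoeff p₀ pκ r) (n k : ℤ)
    (x t : ℝ) (s j : ℕ) : entryDiff P p₀ T W a' n k x t s j
      = kernel P W a' n k x t p₀ (conj p₀) * entrySchur P p₀ pκ a n k x t s j := by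
  have hW1 := hc.apply_self hp.2.1
  set c : ℕ → ℂ := fun ν => coeff j (expSer (xMinus P p₀ pκ a n k x t) * bar (uSer p₀ pκ) ^ ν)
    with hcdef
  set K := kernel P W a' n k x t p₀ (conj p₀) with hK
  have hkf := analyticAt_kernelFactor (P := P) hre ha hW hW1 n k x t
  have hca := analyticAt_cayley (p₀ := p₀) hre
  have h1 : ∀ᶠ p in 𝓝 p₀,
      (dOp fun q => conj (T (conj q)))^[j] (fun q => kernel P W a' n k x t p q) (conj p₀)
      = (j.factorial * K) * ∑ ν ∈ Finset.range (j + 1),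
        kernelFactor P p₀ W a' n k x t p * cayley p₀ p ^ ν * c ν := by
    filter_upwards [eventually_mul_re_pos hre] with p hpp
    rw [dOp_iterate_kernel hre hroot hT hW hp hc ha haa n k x t j hpp, Finset.mul_sum, mul_assoc]
    simp only [mul_assoc, hcdef]
    rfl
  have h2 := (dOp_iterate_congr (T := T) (T' := T) (ε := 1) (by simp) h1 s).self_of_nhds
  have h3 : AnalyticAt ℂ (fun p => ∑ ν ∈ Finset.range (j + 1),
      kernelFactor P p₀ W a' n k x t p * cayley p₀ p ^ ν * c ν) p₀ :=
    Finset.analyticAt_fun_sum _ fun ν _ => (hkf.fun_mul (hca.fun_pow ν)).fun_mul analyticAt_const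
  rw [dOp_iterate_div_factorial hT h3 hp.1 hp.2.1 (hc.eventually_eq_deriv hW hp.1 hp.2.1)] at h2
  rw [entryDiff, h2, one_pow, mul_one]
  have hs : (s.factorial : ℂ) ≠ 0 := by exact_mod_cast Nat.factorial_ne_zero s
  have hj : (j.factorial : ℂ) ≠ 0 := by exact_mod_cast Nat.factorial_ne_zero j
  rw [show ∀ y : ℂ, (j.factorial : ℂ) * K * (s.factorial * y) / (s.factorial * j.factorial)
    = K * y from fun y => by field_simp]
  congr 1
  have hkf' : AnalyticAt ℂ (fun κ => kernelFactor P p₀ W a' n k x t (pκ κ)) 0 :=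
    hkf.comp_of_eq hp.1 hp.2.1
  have hca' : AnalyticAt ℂ (fun κ => cayley p₀ (pκ κ)) 0 := hca.comp_of_eq hp.1 hp.2.1
  rw [entrySchur_eq a n k x t (K := j + 1) (by omega), ← coeff_tps, tps_sum, map_sum]
  · refine Finset.sum_congr rfl fun ν _ => ?_
    rw [show (fun κ => kernelFactor P p₀ W a' n k x t (pκ κ) * cayley p₀ (pκ κ) ^ ν * c ν)
      = fun κ => c ν * (kernelFactor P p₀ W a' n k x t (pκ κ) * cayley p₀ (pκ κ) ^ ν) from
        funext fun κ => mul_comm _ _]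
    rw [tps_const_mul _ (hkf'.fun_mul (hca'.fun_pow ν)),
      tps_mul hkf' (hca'.fun_pow ν),
      tps_pow hca', tps_cayley hre hroot hp, tps_kernelFactor hre hp hc.2 ha haa, coeff_C_mul,
      mul_comm]
  · exact fun ν _ => (hkf'.fun_mul (hca'.fun_pow ν)).fun_mul analyticAt_const

theorem tauDiff_eq (hre : p₀.re ≠ 0) (hroot : IsSimpleRoot P p₀) (hT : AnalyticAt ℂ T p₀)
    (hW : AnalyticAt ℂ W p₀) (hp : IsBranchP P p₀ pκ) (hc : Compatible p₀ T W pκ) {a' a : ℕ → ℂ}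
    (ha : ConvergesNearZero a') (haa : ∀ r : ℕ, 1 ≤ r → a r = a' r - bCoeff p₀ pκ r) (N : ℕ)
    (n k : ℤ) (x t : ℝ) : tauDiff P p₀ T W a' N n k x t
      = kernel P W a' n k x t p₀ (conj p₀) ^ N * tauSchur P p₀ pκ a N n k x t := by
  have h := Matrix.det_smul (Matrix.of fun s j : Fin N =>
    entrySchur P p₀ pκ a n k x t (2 * (s : ℕ) + 1) (2 * (j : ℕ) + 1))
    (kernel P W a' n k x t p₀ (conj p₀))
  rw [Fintype.card_fin] at h
  rw [tauSchur, ← h, tauDiff]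
  congr 1
  ext s j
  rw [Matrix.of_apply, entryDiff_eq hre hroot hT hW hp hc ha haa]
  rfl

end LSRI

namespace LSRI

/-! ### Transfer between proportional families of tau functions -/

variable {P : Params} {p₀ : ℂ} {T W pκ : ℂ → ℂ}

/-- The kernels at the base point differ by constant phases. -/
theorem kernel_self_eq (a : ℕ → ℂ) (n k : ℤ) (x t : ℝ) :
    kernel P W a n k x t p₀ (conj p₀)
      = (-((p₀ - Complex.I * P.k₁) / (conj p₀ + Complex.I * P.k₁))) ^ n
        * (-((p₀ - Complex.I * P.k₂) / (conj p₀ + Complex.I * P.k₂))) ^ k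
        * kernel P W a 0 0 x t p₀ (conj p₀) := by
  simp only [kernel, zpow_zero]
  ring

theorem norm_phase (hre : p₀.re ≠ 0) (k : ℝ) :
    ‖-((p₀ - Complex.I * k) / (conj p₀ + Complex.I * k))‖ = 1 := by
  have := div_norm_eq_one hre k
  rwa [norm_neg, norm_div, div_eq_one_iff_eq, eq_comm, ← div_eq_one_iff_eq, ← norm_div,
    ← norm_neg] at this
  · rw [show conj p₀ + Complex.I * k = conj (p₀ - Complex.I * k) by simp, Complex.norm_conj]
    exact norm_ne_zero_iff.2 (sub_I_mul_ne hre k)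
  · exact norm_ne_zero_iff.2 (sub_I_mul_ne hre k)

/-- The series in ξ vanishes at p₀ since ln W(p₀) = 0, and ξ + ξ* is real and affine in (x, t). -/
theorem kernel_zero_zero_eq (a : ℕ → ℂ) (hW1 : W p₀ = 1) (x t : ℝ) :
    kernel P W a 0 0 x t p₀ (conj p₀)
      = ((Real.exp (2 * p₀.re * x + 4 * (p₀.re * p₀.im) * t) / (2 * p₀.re) : ℝ) : ℂ) := by
  have hs : (p₀ * x - Complex.I * p₀ ^ 2 * t) + conj (p₀ * x - Complex.I * p₀ ^ 2 * t)
      = ((2 * p₀.re * x + 4 * (p₀.re * p₀.im) * t : ℝ) : ℂ) := by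
    rw [Complex.add_conj]
    congr 1
    simp [pow_two]
    ring
  rw [kernel, Complex.conj_conj, xi_self a hW1, hs, zpow_zero, zpow_zero, mul_one, mul_one,
    ← Complex.ofReal_exp, Complex.add_conj, one_div, ← div_eq_inv_mul]
  push_cast
  rfl

theorem iteratedDeriv_two_eq {E : Type*} [NormedAddCommGroup E] [NormedSpace ℝ E] (f : ℝ → E) :
    iteratedDeriv 2 f = deriv (deriv f) := by
  rw [iteratedDeriv_succ, iteratedDeriv_one]

theorem iteratedDeriv_two_affine_add {f : ℝ → ℝ} (hf : Differentiable ℝ f) (b c x : ℝ) :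
    iteratedDeriv 2 (fun x => b * x + c + f x) x = iteratedDeriv 2 f x := by
  rw [iteratedDeriv_two_eq, iteratedDeriv_two_eq]
  have : deriv (fun x => b * x + c + f x) = fun x => b + deriv f x := by
    funext y
    have := ((((hasDerivAt_id y).const_mul b).add_const c).fun_add (hf y).hasDerivAt).deriv
    simpa using this
  rw [this, deriv_const_add]

open scoped ComplexOrder in
theorem fieldL_eq_of_real_smul (hre : p₀.re ≠ 0) (hroot : IsSimpleRoot P p₀)
    (hp : IsBranchP P p₀ pκ) (a : ℕ → ℂ) (N : ℕ) {τ : ℤ → ℤ → ℝ → ℝ → ℂ} {b c d : ℝ} (hd : d ≠ 0)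
    (h : ∀ x t, τ 0 0 x t
      = ((Real.exp (b * x + c * t) / d : ℝ) : ℂ) ^ N * tauSchur P p₀ pκ a N 0 0 x t) (x t : ℝ) :
    fieldL P τ x t = fieldL P (tauSchur P p₀ pκ a N) x t := by
  have hpos := tauSchur_zero_pos hre hroot hp a N
  obtain ⟨F, hF⟩ : ∃ F, ∀ x t, tauSchur P p₀ pκ a N 0 0 x t = (ev F x t : ℂ) :=
    (isPolyFun_tauSchur P p₀ pκ a N 0 0).exists_real
      fun x t => (Complex.pos_iff.1 (hpos x t)).2.symm
  have hFpos : ∀ x t, 0 < ev F x t := fun x t => by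
    have := (Complex.pos_iff.1 (hpos x t)).1
    rwa [hF, Complex.ofReal_re] at this
  have h1 : ∀ x', Real.log (τ 0 0 x' t).re
      = N * b * x' + N * (c * t - Real.log d) + Real.log (ev F x' t) := by
    intro x'
    -- The constant d may be negative; `Real.log d` is log |d|, and the rules for quotients and
    -- powers still hold. The prefactor thus adds an affine function of x, killed by the second
    -- derivative.
    rw [h, hF, ← Complex.ofReal_pow, ← Complex.ofReal_mul, Complex.ofReal_re,
      Real.log_mul (pow_ne_zero _ (div_ne_zero (Real.exp_pos _).ne' hd)) (hFpos _ _).ne',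
      Real.log_pow, Real.log_div (Real.exp_pos _).ne' hd, Real.log_exp]
    ring
  rw [fieldL, fieldL]
  simp only [h1, hF, Complex.ofReal_re]
  rw [iteratedDeriv_two_affine_add]
  exact fun y => ((hasDerivAt_ev_x F y t).log (hFpos y t).ne').differentiableAt

theorem hasDegree_C_mul {R : MvPolynomial (Fin 2) ℂ} {d : ℕ} (h : HasDegree R d) {u : ℂ}
    (hu : u ≠ 0) : HasDegree (MvPolynomial.C u * R) d := by
  have hs : (MvPolynomial.C u * R).support = R.support := by
    rw [MvPolynomial.C_mul', MvPolynomial.support_smul_eq hu]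
  rw [HasDegree, MvPolynomial.degreeOf_eq_sup, MvPolynomial.degreeOf_eq_sup,
    MvPolynomial.totalDegree] at h
  rwa [HasDegree, MvPolynomial.degreeOf_eq_sup, MvPolynomial.degreeOf_eq_sup,
    MvPolynomial.totalDegree, hs]

theorem IsSolution.const_mul {A B : ℝ → ℝ → ℂ} {L : ℝ → ℝ → ℝ} (h : IsSolution P A B L) {u v : ℂ}
    (hu : ‖u‖ = 1) (hv : ‖v‖ = 1) :
    IsSolution P (fun x t => u * A x t) (fun x t => v * B x t) L where
  smooth_A := contDiff_const.mul h.smooth_A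
  smooth_B := contDiff_const.mul h.smooth_B
  smooth_L := h.smooth_L
  eq_A x t := by
    have e : deriv (fun x' => u * A x' t) = fun x' => u * deriv (fun x' => A x' t) x' :=
      funext fun x' => deriv_const_mul_field _
    have := h.eq_A x t
    rw [iteratedDeriv_two_eq] at this ⊢
    rw [e, deriv_const_mul_field, deriv_const_mul_field]
    linear_combination u * this
  eq_B x t := by
    have e : deriv (fun x' => v * B x' t) = fun x' => v * deriv (fun x' => B x' t) x' :=
      funext fun x' => deriv_const_mul_field _
    have := h.eq_B x t
    rw [iteratedDeriv_two_eq] at this ⊢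
    rw [e, deriv_const_mul_field, deriv_const_mul_field]
    linear_combination v * this
  eq_L x t := by
    simp only [norm_mul, hu, hv, one_mul]
    exact h.eq_L x t

theorem IsRationalRogueWave.const_mul {A B : ℝ → ℝ → ℂ} {L : ℝ → ℝ → ℝ} {M : ℕ}
    (h : IsRationalRogueWave P p₀ M A B L) {u v : ℂ} (hu : ‖u‖ = 1) (hv : ‖v‖ = 1) :
    IsRationalRogueWave P p₀ M (fun x t => u * A x t) (fun x t => v * B x t) L where
  rational := by
    obtain ⟨F, G, H, hF, hG, hH, hpos, hA, hB, hL, hc⟩ := h.rational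
    refine ⟨F, MvPolynomial.C u * G, MvPolynomial.C v * H, hF,
      hasDegree_C_mul hG (norm_ne_zero_iff.1 (by rw [hu]; exact one_ne_zero)),
      hasDegree_C_mul hH (norm_ne_zero_iff.1 (by rw [hv]; exact one_ne_zero)), hpos,
      fun x t => ?_, fun x t => ?_, hL, hc⟩
    · rw [hA, map_mul, MvPolynomial.eval_C]; ring
    · rw [hB, map_mul, MvPolynomial.eval_C]; ring
  tendsto_A := by simpa only [norm_mul, hu, one_mul] using h.tendsto_A
  tendsto_B := by simpa only [norm_mul, hv, one_mul] using h.tendsto_B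
  tendsto_L := h.tendsto_L

/-- The N-th power of the kernel at p₀ multiplies each tau function. Its exponential part is
independent of n and k and cancels in the quotients, leaving powers of the unimodular numbers -(p₀ -
ik_l)/(p₀* + ik_l). -/
theorem exists_phases (hre : p₀.re ≠ 0) (hroot : IsSimpleRoot P p₀) (hT : AnalyticAt ℂ T p₀)
    (hW : AnalyticAt ℂ W p₀) (hp : IsBranchP P p₀ pκ) (hc : Compatible p₀ T W pκ) {a' a : ℕ → ℂ}
    (ha : ConvergesNearZero a') (haa : ∀ r : ℕ, 1 ≤ r → a r = a' r - bCoeff p₀ pκ r) (N : ℕ) :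
    ∃ u v : ℂ, ‖u‖ = 1 ∧ ‖v‖ = 1 ∧ ∀ x t : ℝ,
      fieldA P (tauDiff P p₀ T W a' N) x t = u * fieldA P (tauSchur P p₀ pκ a N) x t ∧
      fieldB P (tauDiff P p₀ T W a' N) x t = v * fieldB P (tauSchur P p₀ pκ a N) x t ∧
      fieldL P (tauDiff P p₀ T W a' N) x t = fieldL P (tauSchur P p₀ pκ a N) x t := by
  have hW1 := hc.apply_self hp.2.1
  have hτ := tauDiff_eq hre hroot hT hW hp hc ha haa N
  refine ⟨(-((p₀ - Complex.I * P.k₁) / (conj p₀ + Complex.I * P.k₁))) ^ N,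
    (-((p₀ - Complex.I * P.k₂) / (conj p₀ + Complex.I * P.k₂))) ^ N, ?_, ?_, fun x t => ⟨?_, ?_, ?_⟩⟩
  · rw [norm_pow, norm_phase hre, one_pow]
  · rw [norm_pow, norm_phase hre, one_pow]
  · have h0 := pow_ne_zero N (kernel_self_ne_zero (P := P) (W := W) hre a' 0 0 x t)
    rw [fieldA, fieldA, hτ, hτ, kernel_self_eq a' 1 0, zpow_one, zpow_zero, mul_one, mul_pow,
      mul_assoc, mul_div_assoc, mul_div_mul_left _ _ h0]
    ring
  · have h0 := pow_ne_zero N (kernel_self_ne_zero (P := P) (W := W) hre a' 0 0 x t)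
    rw [fieldB, fieldB, hτ, hτ, kernel_self_eq a' 0 1, zpow_one, zpow_zero, one_mul, mul_pow,
      mul_assoc, mul_div_assoc, mul_div_mul_left _ _ h0]
    ring
  · exact fieldL_eq_of_real_smul hre hroot hp a N (b := 2 * p₀.re) (c := 4 * (p₀.re * p₀.im))
      (d := 2 * p₀.re) (mul_ne_zero two_ne_zero hre)
      (fun x t => by rw [hτ, kernel_zero_zero_eq a' hW1]) x t

theorem tauDiff_solves (hre : p₀.re ≠ 0) (hroot : IsSimpleRoot P p₀) (hT : IsBranchT P p₀ T)
    (hW : IsBranchW P p₀ W) {a' : ℕ → ℂ} (ha : ConvergesNearZero a') {N : ℕ} (hN : 0 < N) :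
    TauSolves P (tauDiff P p₀ T W a' N) ∧
      IsRationalRogueWave P p₀ (N * (N + 1) / 2) (fieldA P (tauDiff P p₀ T W a' N))
        (fieldB P (tauDiff P p₀ T W a' N)) (fieldL P (tauDiff P p₀ T W a' N)) := by
  obtain ⟨hT₁, hTW⟩ := hW.isBranchT hre hroot
  obtain ⟨pκ, hp, hWp⟩ := hW.exists_isBranchP hre hroot
  -- T and W are not assumed to match, but T agrees with W/W' up to sign, and the determinant does
  -- not see the sign.
  obtain ⟨ε, hε, hTε⟩ : ∃ ε : ℝ, ε ^ 2 = 1 ∧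
      ∀ᶠ p in 𝓝 p₀, T p = ε * (fun p => W p / deriv W p) p := by
    rcases hT.eq_or_eq_neg hre hroot hT₁ with h | h
    · exact ⟨1, by norm_num, h.mono fun p hp => by rw [hp]; simp⟩
    · exact ⟨-1, by norm_num, h.mono fun p hp => by rw [hp]; simp⟩
  rw [tauDiff_congr hε hTε]
  have hc : Compatible p₀ (fun p => W p / deriv W p) W pκ := ⟨hTW, hWp⟩
  set a : ℕ → ℂ := fun r => a' r - bCoeff p₀ pκ r with hadef
  have haa : ∀ r : ℕ, 1 ≤ r → a r = a' r - bCoeff p₀ pκ r := fun r _ => rfl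
  obtain ⟨u, v, hu, hv, h⟩ := exists_phases hre hroot hT₁.1 hW.1 hp hc ha haa N
  have hτ := tauDiff_eq hre hroot hT₁.1 hW.1 hp hc ha haa N
  have hS := tauSolves_tauSchur hre hroot hp a N
  have hR := isRationalRogueWave_tauSchur hre hroot hp a hN
  have eA : fieldA P (tauDiff P p₀ (fun p => W p / deriv W p) W a' N)
      = fun x t => u * fieldA P (tauSchur P p₀ pκ a N) x t :=
    funext fun x => funext fun t => (h x t).1
  have eB : fieldB P (tauDiff P p₀ (fun p => W p / deriv W p) W a' N)
      = fun x t => v * fieldB P (tauSchur P p₀ pκ a N) x t :=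
    funext fun x => funext fun t => (h x t).2.1
  have eL : fieldL P (tauDiff P p₀ (fun p => W p / deriv W p) W a' N)
      = fieldL P (tauSchur P p₀ pκ a N) := funext fun x => funext fun t => (h x t).2.2
  refine ⟨⟨fun x t => ?_, fun x t => ?_, ?_⟩, ?_⟩
  · rw [hτ, kernel_zero_zero_eq a' (hW.apply_self hre hroot), ← Complex.ofReal_pow,
      Complex.im_ofReal_mul, hS.real_f, mul_zero]
  · rw [hτ]
    exact mul_ne_zero (pow_ne_zero _ (kernel_self_ne_zero hre _ _ _ _ _)) (hS.f_ne_zero x t)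
  · rw [eA, eB, eL]; exact hS.solution.const_mul hu hv
  · rw [eA, eB, eL]; exact hR.const_mul hu hv

end LSRI

/-! ### The main theorem -/

theorem theorem2 (P : LSRI.Params) (p₀ : ℂ) (hre : p₀.re ≠ 0) (hroot : LSRI.IsSimpleRoot P p₀)
    (N : ℕ) (hN : 0 < N) :
    -- the auxiliary functions exist, and every choice of sign in one of them can be matched
    ((∃ T W pκ : ℂ → ℂ, LSRI.IsBranchT P p₀ T ∧ LSRI.IsBranchW P p₀ W ∧
        LSRI.IsBranchP P p₀ pκ ∧ LSRI.Compatible p₀ T W pκ) ∧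
      (∀ T : ℂ → ℂ, LSRI.IsBranchT P p₀ T → ∃ W pκ : ℂ → ℂ,
        LSRI.IsBranchW P p₀ W ∧ LSRI.IsBranchP P p₀ pκ ∧ LSRI.Compatible p₀ T W pκ) ∧
      (∀ W : ℂ → ℂ, LSRI.IsBranchW P p₀ W → ∃ T pκ : ℂ → ℂ,
        LSRI.IsBranchT P p₀ T ∧ LSRI.IsBranchP P p₀ pκ ∧ LSRI.Compatible p₀ T W pκ) ∧
      (∀ pκ : ℂ → ℂ, LSRI.IsBranchP P p₀ pκ → ∃ T W : ℂ → ℂ,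
        LSRI.IsBranchT P p₀ T ∧ LSRI.IsBranchW P p₀ W ∧ LSRI.Compatible p₀ T W pκ)) ∧
    -- (a) solutions in differential operator form
    (∀ T W : ℂ → ℂ, LSRI.IsBranchT P p₀ T → LSRI.IsBranchW P p₀ W →
      ∀ a' : ℕ → ℂ, LSRI.ConvergesNearZero a' →
        LSRI.TauSolves P (LSRI.tauDiff P p₀ T W a' N) ∧
        LSRI.IsRationalRogueWave P p₀ (N * (N + 1) / 2)
          (LSRI.fieldA P (LSRI.tauDiff P p₀ T W a' N))
          (LSRI.fieldB P (LSRI.tauDiff P p₀ T W a' N))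
          (LSRI.fieldL P (LSRI.tauDiff P p₀ T W a' N))) ∧
    -- (b) solutions through Schur polynomials
    (∀ pκ : ℂ → ℂ, LSRI.IsBranchP P p₀ pκ → ∀ a : ℕ → ℂ,
        LSRI.TauSolves P (LSRI.tauSchur P p₀ pκ a N) ∧
        LSRI.IsRationalRogueWave P p₀ (N * (N + 1) / 2)
          (LSRI.fieldA P (LSRI.tauSchur P p₀ pκ a N))
          (LSRI.fieldB P (LSRI.tauSchur P p₀ pκ a N))
          (LSRI.fieldL P (LSRI.tauSchur P p₀ pκ a N)) ∧
        ∀ n k : ℤ, ∃ R : MvPolynomial (Fin 2) ℂ, LSRI.HasDegree R (N * (N + 1)) ∧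
          ∀ x t : ℝ, LSRI.tauSchur P p₀ pκ a N n k x t
            = MvPolynomial.eval ![(x : ℂ), (t : ℂ)] R) ∧
    -- equivalence of the two forms
    (∀ T W pκ : ℂ → ℂ, LSRI.IsBranchT P p₀ T → LSRI.IsBranchW P p₀ W →
      LSRI.IsBranchP P p₀ pκ → LSRI.Compatible p₀ T W pκ →
      ∀ a' a : ℕ → ℂ, LSRI.ConvergesNearZero a' →
        (∀ r : ℕ, 1 ≤ r → a r = a' r - LSRI.bCoeff p₀ pκ r) →
        (∀ (n k : ℤ) (x t : ℝ) (s j : ℕ), LSRI.entryDiff P p₀ T W a' n k x t s j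
          = LSRI.kernel P W a' n k x t p₀ (starRingEnd ℂ p₀)
            * LSRI.entrySchur P p₀ pκ a n k x t s j) ∧
        (∀ (n k : ℤ) (x t : ℝ), LSRI.tauDiff P p₀ T W a' N n k x t
          = LSRI.kernel P W a' n k x t p₀ (starRingEnd ℂ p₀) ^ N
            * LSRI.tauSchur P p₀ pκ a N n k x t) ∧
        (∃ u v : ℂ, ‖u‖ = 1 ∧ ‖v‖ = 1 ∧ ∀ x t : ℝ,
          LSRI.fieldA P (LSRI.tauDiff P p₀ T W a' N) x t
            = u * LSRI.fieldA P (LSRI.tauSchur P p₀ pκ a N) x t ∧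
          LSRI.fieldB P (LSRI.tauDiff P p₀ T W a' N) x t
            = v * LSRI.fieldB P (LSRI.tauSchur P p₀ pκ a N) x t ∧
          LSRI.fieldL P (LSRI.tauDiff P p₀ T W a' N) x t
            = LSRI.fieldL P (LSRI.tauSchur P p₀ pκ a N) x t)) := by
  refine ⟨LSRI.exists_branches hre hroot, ?_, ?_, ?_⟩
  · intro T W hT hW a' ha
    exact LSRI.tauDiff_solves hre hroot hT hW ha hN
  · intro pκ hp a
    refine ⟨LSRI.tauSolves_tauSchur hre hroot hp a N,
      LSRI.isRationalRogueWave_tauSchur hre hroot hp a hN, fun n k => ?_⟩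
    have h := LSRI.exists_hasDegree_tauSchur hre hroot hp a N n k
    rwa [Nat.two_mul_div_two_of_even (Nat.even_mul_succ_self N)] at h
  · intro T W pκ hT hW hp hc a' a ha haa
    exact ⟨fun n k x t s j => LSRI.entryDiff_eq hre hroot hT.1 hW.1 hp hc ha haa n k x t s j,
      fun n k x t => LSRI.tauDiff_eq hre hroot hT.1 hW.1 hp hc ha haa N n k x t,
      LSRI.exists_phases hre hroot hT.1 hW.1 hp hc ha haa N⟩
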